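/- **Setting.** Let $d\ge 1$, $P,m,K\in\mathbb N_0$, $s>1$, $\varepsilon>0$, $k:=\max\{P,m\}$. For an open set $\Omega\subset\mathbb R^d$ let $W^{j,p}(\Omega)$ be the Sobolev space with norm $\bigl(\sum_{|\alpha|\le j}\|\partial^\alpha f\|_{L^p(\Omega)}^p\bigr)^{1/p}$ and semi-norm $|f|_{W^{j,p}(\Omega)}=\bigl(\sum_{|\alpha|=j}\|\partial^\alpha f\|_{L^p(\Omega)}^p\bigr)^{1/p}$, and let $W^{-j,2}(\Omega):=W^{j,2}(\Omega)'$ with the dual norm; a function $u\in L^2(\Omega)$ is identified with $v\mapsto\int_\Omega uv\,dx$. *Grid and finite element space.* Given $\sigma>0$ and $i\in\mathbb Z^d$ put $Q_i=\prod_l(i_l\sigma,(i_l+1)\sigma)$, $\Omega_i=\prod_l((i_l-1)\sigma,(i_l+1)\sigma)$, $\omega_i=\prod_l((i_l-\tfrac12)\sigma,(i_l+\tfrac12)\sigma)$. Let $\zeta(x)=\kappa^{-1}\exp(-1/(1-4x^2))$ for $|x|<\tfrac12$ and $\zeta(x)=0$ otherwise, with $\kappa$ such that $\int_{\mathbb R}\zeta=1$,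 let $\zeta_\sigma(x)=\sigma^{-d}\prod_l\zeta(x_l/\sigma)$ for $x\in\mathbb R^d$, and $\varphi_i(x)=\int_{\omega_i}\zeta_\sigma(x-y)\,dy$. The element $Q_i$ is *active* if $|Q_i\cap\Omega|>0$; an active element is *uncut* if $Q_i\subset\Omega$ and *cut* otherwise. The fictitious domain $\Omega_\sigma$ is the interior of the union of the closures of all active elements. $V_\sigma^P(\Omega_\sigma)$ is the space of the restrictions to $\Omega_\sigma$ of linear combinations of the functions $\varphi_i\,x^\alpha$, $|\alpha|\le P$, $\Omega_i\cap\Omega_\sigma\neq\emptyset$. *Problem.* Set $$j(u,v)=\sigma^{2(P+1)}\sum_{Q_i\ \mathrm{cut}}\ \sum_{|\alpha|=P+1}\int_{Q_i}\partial^\alpha u\,\partial^\alpha v\,dx,\qquad A_h(u,v)=I_m(uv)+\varepsilon\, j(u,v),$$ where $I_m$ is a quadrature rule, i.e. a linear functional on functions, approximating $\int_\Omega$. **Theorem.** Let $C_E(j)$ ($j\in\mathbb N_0$), $C_Q$, $C_P$ be constants. There are $C>0$ and $\sigma_0>0$, depending only on $d,P,m,K,s,\varepsilon,C_E,C_Q,C_P$,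 such that the following holds. Let $\Omega\subset\mathbb R^d$ be bounded and open, let $0<\sigma<\sigma_0$ and $h=\sigma^s$, and assume: 1. for every $j\in\mathbb N_0$ there is a linear extension operator $W^{j,2}(\Omega)\to W^{j,2}(\mathbb R^d)$ of norm at most $C_E(j)$; 2. for every cut element $Q$ there are cut elements $Q=Q_1,\dots,Q_n$, $1\le n\le K$, such that any two subsequent ones share a grid node and $Q_n$ shares a grid node with an uncut element; 3. $\bigl|\int_\Omega f\,dx-I_m(f)\bigr|\le C_Q h^{m+1}|f|_{W^{m+1,1}(\Omega)}$ for all $f\in W^{m+1,1}(\Omega)$ that are restrictions of continuous functions on $\mathbb R^d$; 4. $u\in W^{k+1,2}(\Omega)$, and $u_h\in W^{-(m+1),2}(\Omega)$ satisfies $\|u_h-u\|_{W^{-(m+1),2}(\Omega)}\le C_P h^{m+1}\|u\|_{W^{m+1,2}(\Omega)}$. Then the problem of finding $u_\sigma\in V_\sigma^P(\Omega_\sigma)$ with $$A_h(u_\sigma,v_\sigma)=\langle u_h,v_\sigma\rangle\qquad\text{for all }v_\sigma\in V_\sigma^P(\Omega_\sigma)$$ has exactly one solution, and this solution satisfies $$\|u-u_\sigma\|_{L^2(\Omega)}\le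 C\bigl(\sigma^{P+1}+h^{m+1}\sigma^{-(m+1)}\bigr)\|u\|_{W^{k+1,2}(\Omega)} .$$ In particular $C$ and $\sigma_0$ do not depend on $u$, $u_h$, $I_m$, or on the position of $\partial\Omega$ relative to the grid, and $C$ does not depend on $\sigma$. -/

import Mathlib

open Set MeasureTheory
open scoped ENNReal ContDiff

noncomputable section

namespace SmoothPUFEM

/-! ### Multi-indices and classical partial derivatives

Points of `ℝ^d` are functions `Fin d → ℝ`; only the topology, the bounded sets, the smooth
functions and the Lebesgue measure of `ℝ^d` are used, and these do not depend on the norm. -/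

/-- The multi-indices `α` with `|α| = k`. -/
def multiIdxEq (d k : ℕ) : Finset (Fin d → ℕ) :=
  (Fintype.piFinset fun _ => Finset.range (k + 1)).filter fun α => ∑ l, α l = k

/-- The multi-indices `α` with `|α| ≤ k`. -/
def multiIdxLE (d k : ℕ) : Finset (Fin d → ℕ) :=
  (Fintype.piFinset fun _ => Finset.range (k + 1)).filter fun α => ∑ l, α l ≤ k

theorem mem_multiIdxEq {d k : ℕ} {α : Fin d → ℕ} : α ∈ multiIdxEq d k ↔ ∑ l, α l = k := by
  simp only [multiIdxEq, Finset.mem_filter, Fintype.mem_piFinset, Finset.mem_range,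
    and_iff_right_iff_imp]
  intro h l
  have := Finset.single_le_sum (f := α) (fun i _ => Nat.zero_le _) (Finset.mem_univ l)
  omega

theorem mem_multiIdxLE {d k : ℕ} {α : Fin d → ℕ} : α ∈ multiIdxLE d k ↔ ∑ l, α l ≤ k := by
  simp only [multiIdxLE, Finset.mem_filter, Fintype.mem_piFinset, Finset.mem_range,
    and_iff_right_iff_imp]
  intro h l
  have := Finset.single_le_sum (f := α) (fun i _ => Nat.zero_le _) (Finset.mem_univ l)
  omega

theorem zero_mem_multiIdxLE (d k : ℕ) : (0 : Fin d → ℕ) ∈ multiIdxLE d k := by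
  simp [mem_multiIdxLE]

theorem multiIdxLE_mono {d j k : ℕ} (h : j ≤ k) {α : Fin d → ℕ} (hα : α ∈ multiIdxLE d j) :
    α ∈ multiIdxLE d k :=
  mem_multiIdxLE.2 ((mem_multiIdxLE.1 hα).trans h)

theorem multiIdxEq_subset_LE {d k : ℕ} {α : Fin d → ℕ} (hα : α ∈ multiIdxEq d k) :
    α ∈ multiIdxLE d k :=
  mem_multiIdxLE.2 (mem_multiIdxEq.1 hα).le

/-- The classical partial derivative `∂f/∂x_l`. -/
def pderiv {d : ℕ} (l : Fin d) (f : (Fin d → ℝ) → ℝ) : (Fin d → ℝ) → ℝ :=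
  fun x => fderiv ℝ f x (Pi.single l 1)

/-- The classical partial derivative `∂^α f` of a smooth function. -/
def mderiv {d : ℕ} (α : Fin d → ℕ) (f : (Fin d → ℝ) → ℝ) : (Fin d → ℝ) → ℝ :=
  (List.finRange d).foldr (fun l g => (pderiv l)^[α l] g) f

/-- Test functions on `Ω`: smooth functions with compact support contained in `Ω`. -/
def IsTest {d : ℕ} (Ω : Set (Fin d → ℝ)) (φ : (Fin d → ℝ) → ℝ) : Prop :=
  ContDiff ℝ ∞ φ ∧ HasCompactSupport φ ∧ tsupport φ ⊆ Ω

theorem pderiv_smooth {d : ℕ} (l : Fin d) {f : (Fin d → ℝ) → ℝ}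
    (hf : ContDiff ℝ ∞ f ∧ HasCompactSupport f) :
    ContDiff ℝ ∞ (pderiv l f) ∧ HasCompactSupport (pderiv l f) :=
  ⟨(hf.1.fderiv_right (m := ∞) (by simp)).clm_apply contDiff_const, hf.2.fderiv_apply ℝ _⟩

theorem mderiv_smooth {d : ℕ} (α : Fin d → ℕ) {f : (Fin d → ℝ) → ℝ}
    (hf : ContDiff ℝ ∞ f ∧ HasCompactSupport f) :
    ContDiff ℝ ∞ (mderiv α f) ∧ HasCompactSupport (mderiv α f) := by
  unfold mderiv
  induction List.finRange d with
  | nil => simpa using hf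
  | cons l t ih =>
    rw [List.foldr_cons]
    generalize List.foldr (fun l g => (pderiv l)^[α l] g) f t = g at ih ⊢
    induction α l with
    | zero => simpa using ih
    | succ n ihn =>
      rw [Function.iterate_succ_apply']
      exact pderiv_smooth l ihn

/-! ### Sobolev spaces `W^{k,p}(Ω)` -/

/-- `L^p(Ω)` for the Lebesgue measure. -/
abbrev LpOn {d : ℕ} (p : ℝ≥0∞) (Ω : Set (Fin d → ℝ)) : Type :=
  Lp ℝ p ((volume : Measure (Fin d → ℝ)).restrict Ω)

/-- `g` is the weak derivative `∂^α f` on `Ω`. -/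
def IsWeakDeriv {d : ℕ} {p : ℝ≥0∞} (Ω : Set (Fin d → ℝ)) (α : Fin d → ℕ) (f g : LpOn p Ω) :
    Prop :=
  ∀ φ : (Fin d → ℝ) → ℝ, IsTest Ω φ →
    ∫ x in Ω, f x * mderiv α φ x = (-1) ^ (∑ l, α l) * ∫ x in Ω, g x * φ x

theorem integrable_mul_test {d : ℕ} {p : ℝ≥0∞} [hp : Fact (1 ≤ p)] {Ω : Set (Fin d → ℝ)}
    (f : LpOn p Ω) {φ : (Fin d → ℝ) → ℝ} (hφ : ContDiff ℝ ∞ φ ∧ HasCompactSupport φ) :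
    Integrable (fun x => f x * φ x) (volume.restrict Ω) := by
  have h := ((Lp.memLp f).locallyIntegrable hp.out).integrable_smul_right_of_hasCompactSupport
    hφ.1.continuous hφ.2
  simpa [smul_eq_mul, mul_comm] using h

/-- The Sobolev space `W^{k,p}(Ω)`. An element is the family `(∂^α f)_{|α| ≤ k}` of the weak
derivatives of a function `f = ∂^0 f` in `L^p(Ω)`, all of them in `L^p(Ω)`. The norm inherited from
the `ℓ^p`-product is `(∑_{|α| ≤ k} ‖∂^α f‖_{L^p(Ω)}^p)^{1/p}`. -/
def Sobolev {d : ℕ} (k : ℕ) (p : ℝ≥0∞) [Fact (1 ≤ p)] (Ω : Set (Fin d → ℝ)) :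
    Submodule ℝ (PiLp p fun _ : multiIdxLE d k => LpOn p Ω) where
  carrier := {w | ∀ α : multiIdxLE d k,
    IsWeakDeriv Ω α.1 (w ⟨0, zero_mem_multiIdxLE d k⟩) (w α)}
  zero_mem' := by
    intro α φ hφ
    have h0 : ∀ ψ : (Fin d → ℝ) → ℝ, ∫ x in Ω, (0 : LpOn p Ω) x * ψ x = 0 := by
      intro ψ
      rw [integral_eq_zero_of_ae]
      filter_upwards [Lp.coeFn_zero ℝ p ((volume : Measure (Fin d → ℝ)).restrict Ω)] with x hx
      rw [hx]
      simp
    simp only [PiLp.zero_apply]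
    rw [h0, h0, mul_zero]
  add_mem' := by
    intro v w hv hw α φ hφ
    have hadd : ∀ (f g : LpOn p Ω) (ψ : (Fin d → ℝ) → ℝ),
        ContDiff ℝ ∞ ψ ∧ HasCompactSupport ψ →
        ∫ x in Ω, (f + g) x * ψ x = (∫ x in Ω, f x * ψ x) + ∫ x in Ω, g x * ψ x := by
      intro f g ψ hψ
      rw [← integral_add (integrable_mul_test f hψ) (integrable_mul_test g hψ)]
      refine integral_congr_ae ?_
      filter_upwards [Lp.coeFn_add f g] with x hx
      rw [hx, Pi.add_apply, add_mul]
    simp only [PiLp.add_apply]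
    rw [hadd _ _ _ (mderiv_smooth α.1 ⟨hφ.1, hφ.2.1⟩), hadd _ _ _ ⟨hφ.1, hφ.2.1⟩,
      hv α φ hφ, hw α φ hφ, mul_add]
  smul_mem' := by
    intro c w hw α φ hφ
    have hsmul : ∀ (f : LpOn p Ω) (ψ : (Fin d → ℝ) → ℝ),
        ∫ x in Ω, (c • f) x * ψ x = c * ∫ x in Ω, f x * ψ x := by
      intro f ψ
      rw [← integral_const_mul]
      refine integral_congr_ae ?_
      filter_upwards [Lp.coeFn_smul c f] with x hx
      simp [hx, mul_assoc]
    simp only [PiLp.smul_apply]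
    rw [hsmul, hsmul, hw α φ hφ]
    ring

/-- The map `W^{k,p}(Ω) → L^p(Ω)` sending an element to the function it stands for. -/
def toLpL {d : ℕ} (k : ℕ) (p : ℝ≥0∞) [Fact (1 ≤ p)] (Ω : Set (Fin d → ℝ)) :
    Sobolev k p Ω →L[ℝ] LpOn p Ω :=
  (PiLp.proj p (𝕜 := ℝ) (fun _ : multiIdxLE d k => LpOn p Ω) ⟨0, zero_mem_multiIdxLE d k⟩).comp
    (Sobolev k p Ω).subtypeL

/-- The function that an element of `W^{k,p}(Ω)` stands for. -/
def toFn {d k : ℕ} {p : ℝ≥0∞} [Fact (1 ≤ p)] {Ω : Set (Fin d → ℝ)} (w : Sobolev k p Ω) :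
    LpOn p Ω :=
  toLpL k p Ω w

/-- The semi-norm `|w|_{W^{k,p}(Ω)}`: the `ℓ^p`-norm of the family
`(‖∂^α w‖_{L^p(Ω)})_{|α| = k}`. -/
def sobolevSeminorm {d k : ℕ} {p : ℝ≥0∞} [Fact (1 ≤ p)] {Ω : Set (Fin d → ℝ)}
    (w : Sobolev k p Ω) : ℝ :=
  ‖(WithLp.toLp p fun α : multiIdxEq d k => w.1 ⟨α.1, multiIdxEq_subset_LE α.2⟩ :
    PiLp p fun _ : multiIdxEq d k => LpOn p Ω)‖

/-- The inclusion `W^{k,p}(Ω) ⊆ W^{j,p}(Ω)` for `j ≤ k`. -/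
def lower {d j k : ℕ} {p : ℝ≥0∞} [Fact (1 ≤ p)] {Ω : Set (Fin d → ℝ)} (h : j ≤ k)
    (w : Sobolev k p Ω) : Sobolev j p Ω :=
  ⟨WithLp.toLp p fun α : multiIdxLE d j => w.1 ⟨α.1, multiIdxLE_mono h α.2⟩,
    fun α => w.2 ⟨α.1, multiIdxLE_mono h α.2⟩⟩

open Classical in
/-- The element of `W^{k,p}(Ω)` given by the restriction of `f` to `Ω` (and `0` if that restriction
is not in `W^{k,p}(Ω)`). -/
def sobolevOf {d : ℕ} (k : ℕ) (p : ℝ≥0∞) [Fact (1 ≤ p)] (Ω : Set (Fin d → ℝ))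
    (f : (Fin d → ℝ) → ℝ) : Sobolev k p Ω :=
  if h : ∃ w : Sobolev k p Ω, toFn w =ᵐ[volume.restrict Ω] f then h.choose else 0

/-- The dual space `W^{-k,2}(Ω) = W^{k,2}(Ω)'`, with the dual norm. -/
abbrev SobolevDual {d : ℕ} (k : ℕ) (Ω : Set (Fin d → ℝ)) : Type :=
  StrongDual ℝ (Sobolev k 2 Ω)

/-- A function `f` in `L²(Ω)` as the element `v ↦ ∫_Ω f v` of `W^{-k,2}(Ω)`. -/
def l2Dual {d : ℕ} (k : ℕ) {Ω : Set (Fin d → ℝ)} (f : LpOn 2 Ω) : SobolevDual k Ω :=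
  (innerSL ℝ f).comp (toLpL k 2 Ω)

/-- For every `k` there is a linear extension operator `W^{k,2}(Ω) → W^{k,2}(ℝ^d)` of norm at most
`CE k`. -/
def HasExtension {d : ℕ} (Ω : Set (Fin d → ℝ)) (CE : ℕ → ℝ) : Prop :=
  ∀ k : ℕ, ∃ E : Sobolev k 2 Ω →L[ℝ] Sobolev k 2 (univ : Set (Fin d → ℝ)),
    (∀ u : Sobolev k 2 Ω, toFn (E u) =ᵐ[volume.restrict Ω] toFn u) ∧ ‖E‖ ≤ CE k

/-! ### The smooth partition of unity on the Cartesian grid -/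

/-- The unnormalised mollifier `exp(-1/(1-4x²))` on `(-1/2, 1/2)`. -/
def bump (x : ℝ) : ℝ := if 1 / 2 ≤ |x| then 0 else Real.exp (-(1 / (1 - 4 * x ^ 2)))

/-- Friedrichs' mollifier in one dimension, with integral one. -/
def mollifier (x : ℝ) : ℝ := (∫ y, bump y)⁻¹ * bump x

/-- The scaled Friedrichs mollifier `ζ_σ(x) = σ^{-d} ∏_l ζ(x_l/σ)` on `ℝ^d`. -/
def scaledMollifier {d : ℕ} (σ : ℝ) (x : Fin d → ℝ) : ℝ :=
  (σ ^ d)⁻¹ * ∏ l, mollifier (x l / σ)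

/-- The patch `Ω_i`. -/
def patch {d : ℕ} (σ : ℝ) (i : Fin d → ℤ) : Set (Fin d → ℝ) :=
  {x | ∀ l, x l ∈ Ioo (((i l : ℝ) - 1) * σ) (((i l : ℝ) + 1) * σ)}

/-- The patch core `ω_i`. -/
def patchCore {d : ℕ} (σ : ℝ) (i : Fin d → ℤ) : Set (Fin d → ℝ) :=
  {x | ∀ l, x l ∈ Ioo (((i l : ℝ) - 1 / 2) * σ) (((i l : ℝ) + 1 / 2) * σ)}

/-- The partition of unity function `φ_i = χ_{ω_i} ⋆ ζ_σ`. -/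
def pou {d : ℕ} (σ : ℝ) (i : Fin d → ℤ) (x : Fin d → ℝ) : ℝ :=
  ∫ y in patchCore σ i, scaledMollifier σ (x - y)

/-- The element (grid cell) `Q_i`. -/
def cell {d : ℕ} (σ : ℝ) (i : Fin d → ℤ) : Set (Fin d → ℝ) :=
  {x | ∀ l, x l ∈ Ioo ((i l : ℝ) * σ) (((i l : ℝ) + 1) * σ)}

/-! ### The fictitious domain -/

/-- Indices of the elements that make up the fictitious domain. -/
def activeCells {d : ℕ} (Ω : Set (Fin d → ℝ)) (σ : ℝ) : Set (Fin d → ℤ) :=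
  {i | 0 < volume (cell σ i ∩ Ω)}

/-- Indices of the cut elements. -/
def cutCells {d : ℕ} (Ω : Set (Fin d → ℝ)) (σ : ℝ) : Set (Fin d → ℤ) :=
  {i | i ∈ activeCells Ω σ ∧ ¬ cell σ i ⊆ Ω}

/-- Indices of the uncut elements. -/
def uncutCells {d : ℕ} (Ω : Set (Fin d → ℝ)) (σ : ℝ) : Set (Fin d → ℤ) :=
  {i | i ∈ activeCells Ω σ ∧ cell σ i ⊆ Ω}

/-- The fictitious domain `Ω_σ`. -/
def fictitious {d : ℕ} (Ω : Set (Fin d → ℝ)) (σ : ℝ) : Set (Fin d → ℝ) :=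
  interior (⋃ i ∈ activeCells Ω σ, closure (cell σ i))

/-- The grid node with index `n` is a vertex of the element `Q_i`. -/
def IsNodeOf {d : ℕ} (n i : Fin d → ℤ) : Prop := ∀ l, n l = i l ∨ n l = i l + 1

/-- Two elements are neighbours if they share at least one grid node. -/
def Neighbors {d : ℕ} (i i' : Fin d → ℤ) : Prop := ∃ n, IsNodeOf n i ∧ IsNodeOf n i'

/-- From every cut element one can pass through at most `K` cut elements `q 0, …, q n`, subsequent
ones being neighbours, to a cut element that has an uncut neighbour. -/
def CutCellsReach {d : ℕ} (Ω : Set (Fin d → ℝ)) (σ : ℝ) (K : ℕ) : Prop :=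
  ∀ i ∈ cutCells Ω σ, ∃ (n : ℕ) (q : ℕ → Fin d → ℤ), n + 1 ≤ K ∧ q 0 = i ∧
    (∀ r ≤ n, q r ∈ cutCells Ω σ) ∧ (∀ r < n, Neighbors (q r) (q (r + 1))) ∧
    ∃ i' ∈ uncutCells Ω σ, Neighbors (q n) i'

/-- The space `V_σ^P(Ω_σ)`, spanned by `φ_i x^α` with `|α| ≤ P` and `Ω_i ∩ Ω_σ ≠ ∅`. Its elements
are given as smooth functions on `ℝ^d`, of which only the restriction to `Ω_σ` matters. -/
def pufem {d : ℕ} (Ω : Set (Fin d → ℝ)) (σ : ℝ) (P : ℕ) : Submodule ℝ ((Fin d → ℝ) → ℝ) :=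
  Submodule.span ℝ {f | ∃ (i : Fin d → ℤ) (α : Fin d → ℕ),
    (patch σ i ∩ fictitious Ω σ).Nonempty ∧ ∑ l, α l ≤ P ∧
    f = fun x => pou σ i x * ∏ l, x l ^ α l}

/-! ### The perturbed variational problem -/

/-- The stabilisation form `j`. -/
def stab {d : ℕ} (Ω : Set (Fin d → ℝ)) (σ : ℝ) (P : ℕ) (u v : (Fin d → ℝ) → ℝ) : ℝ :=
  σ ^ (2 * (P + 1)) * ∑ᶠ i ∈ cutCells Ω σ, ∑ α ∈ multiIdxEq d (P + 1),
    ∫ x in cell σ i, mderiv α u x * mderiv α v x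

/-- The perturbed bilinear form `A_h(u, v) = I(u v) + ε j(u, v)`, where `I` is the quadrature
rule. -/
def formAh {d : ℕ} (Ω : Set (Fin d → ℝ)) (σ : ℝ) (P : ℕ) (ε : ℝ)
    (I : ((Fin d → ℝ) → ℝ) →ₗ[ℝ] ℝ) (u v : (Fin d → ℝ) → ℝ) : ℝ :=
  I (fun x => u x * v x) + ε * stab Ω σ P u v

/-- The quadrature error bound `|∫_Ω f - I(f)| ≤ CQ h^{m+1} |f|_{W^{m+1,1}(Ω)}` for `f` in
`W^{m+1,1}(Ω)`. Quadrature evaluates functions at points, possibly on the boundary of `Ω`, and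
so `f` is given as a continuous function on `ℝ^d`. -/
def QuadratureBound {d : ℕ} (Ω : Set (Fin d → ℝ)) (m : ℕ) (h CQ : ℝ)
    (I : ((Fin d → ℝ) → ℝ) →ₗ[ℝ] ℝ) : Prop :=
  ∀ f : (Fin d → ℝ) → ℝ, Continuous f →
    ∀ w : Sobolev (m + 1) 1 Ω, toFn w =ᵐ[volume.restrict Ω] f →
      |(∫ x in Ω, f x) - I f| ≤ CQ * h ^ (m + 1) * sobolevSeminorm w

/-- `uσ` solves `A_h(uσ, v) = ⟨uh, v⟩` for all `v ∈ V_σ^P(Ω_σ)`. -/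
def Solves {d : ℕ} (Ω : Set (Fin d → ℝ)) (σ : ℝ) (P m : ℕ) (ε : ℝ)
    (I : ((Fin d → ℝ) → ℝ) →ₗ[ℝ] ℝ) (uh : SobolevDual (m + 1) Ω) (uσ : (Fin d → ℝ) → ℝ) : Prop :=
  uσ ∈ pufem Ω σ P ∧
    ∀ v ∈ pufem Ω σ P, formAh Ω σ P ε I uσ v = uh (sobolevOf (m + 1) 2 Ω v)

end SmoothPUFEM

end

open SmoothPUFEM

/-! The estimate is of Strang type, and the analysis lives in the norm `cellNorm`: the L² norm over
the whole active cells, including the parts of cut cells outside Ω. In this norm inverse estimates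
hold with constants that do not see how the boundary cuts the cells, and the stabilised form is
coercive.

Uniform constants. After translation and dilation, a finite element function near a cell and its
neighbours belongs to one fixed finite-dimensional space `refSpace` (`exists_refSpace_eq`). There a
seminorm dominates every pointwise bounded family of seminorms vanishing on its kernel
(`exists_seminorm_family_le`). This yields the inverse estimates. It also bounds the norm on a cell
by the norm on a neighbour plus the derivatives of order P+1 on the cell: if both of these vanish,
so does the function, by Taylor's formula at a shared node (`eq_zero_of_derivs_vanish`). Along
chains of at most K cut cells this becomes `exists_cellNorm_sq_le`: uncut cells and the
stabilisation form control all active cells.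

Coercivity. The quadrature error of a product of two finite element functions is at most a constant
times h^(m+1) σ^(-(m+1)) times their discrete norms (`exists_quadrature_error_le`). Since h = σ^s
with s > 1, this factor is small for small σ and the error is absorbed (`exists_coercive`).
Existence, and uniqueness on the fictitious domain, follow.

Approximation. The function u is extended to the whole space and mollified; on each patch it is
replaced by a Taylor polynomial about a well-chosen point (a Bramble–Hilbert argument), and the
polynomials are glued by the partition of unity. The L² error is of order σ^(P+1). The stabilisation
energy of the result is equally small, because on each cell it is one polynomial of degree at most
P, which the form does not see, plus a small remainder (`exists_cellEnergy_quasi_le`). All this is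
collected in `exists_pufem_approx`.

Conclusion. Coercivity is tested with e = w - u_σ, where w is this approximant
(`Solves.l2norm_sub_le`). Four errors appear: quadrature, L² approximation, data, stabilisation. The
data error is measured in a negative norm, so pairing it with e costs an inverse estimate of order
m+1; hence it has the same size h^(m+1) σ^(-(m+1)) as the quadrature error. -/

noncomputable section

namespace SmoothPUFEM

/-! ### Iterated partial derivatives of smooth functions -/

section Calculus

variable {d : ℕ}

/-- The iterated partial derivative in the directions listed in `L`. -/
def listDeriv (L : List (Fin d)) (f : (Fin d → ℝ) → ℝ) : (Fin d → ℝ) → ℝ :=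
  L.foldr pderiv f

@[simp] theorem listDeriv_nil (f : (Fin d → ℝ) → ℝ) : listDeriv [] f = f := rfl

@[simp] theorem listDeriv_cons (l : Fin d) (L : List (Fin d)) (f : (Fin d → ℝ) → ℝ) :
    listDeriv (l :: L) f = pderiv l (listDeriv L f) := rfl

theorem listDeriv_append (L L' : List (Fin d)) (f : (Fin d → ℝ) → ℝ) :
    listDeriv (L ++ L') f = listDeriv L (listDeriv L' f) := by
  simp [listDeriv]

theorem listDeriv_replicate (l : Fin d) (n : ℕ) (f : (Fin d → ℝ) → ℝ) :
    listDeriv (List.replicate n l) f = (pderiv l)^[n] f := by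
  induction n with
  | zero => rfl
  | succ n ih => rw [List.replicate_succ, listDeriv_cons, ih, Function.iterate_succ_apply']

/-- The list of directions in which `mderiv α` differentiates. -/
def multiIdxList (α : Fin d → ℕ) : List (Fin d) :=
  (List.finRange d).flatMap fun l => List.replicate (α l) l

theorem mderiv_eq_listDeriv (α : Fin d → ℕ) (f : (Fin d → ℝ) → ℝ) :
    mderiv α f = listDeriv (multiIdxList α) f := by
  unfold mderiv multiIdxList
  induction List.finRange d with
  | nil => rfl
  | cons l t ih =>
    rw [List.foldr_cons, ih, List.flatMap_cons, listDeriv_append, listDeriv_replicate]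

theorem count_multiIdxList (α : Fin d → ℕ) (l : Fin d) : (multiIdxList α).count l = α l := by
  unfold multiIdxList
  rw [List.count_flatMap]
  simp only [Function.comp_def, List.count_replicate, beq_iff_eq]
  rw [← Fin.sum_univ_def]
  simp

theorem length_multiIdxList (α : Fin d → ℕ) : (multiIdxList α).length = ∑ l, α l := by
  unfold multiIdxList
  rw [List.length_flatMap]
  simp [Fin.sum_univ_def]

theorem contDiff_pderiv (l : Fin d) {f : (Fin d → ℝ) → ℝ} (hf : ContDiff ℝ ∞ f) :
    ContDiff ℝ ∞ (pderiv l f) :=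
  (hf.fderiv_right (m := ∞) (by simp)).clm_apply contDiff_const

theorem contDiff_listDeriv (L : List (Fin d)) {f : (Fin d → ℝ) → ℝ} (hf : ContDiff ℝ ∞ f) :
    ContDiff ℝ ∞ (listDeriv L f) := by
  induction L with
  | nil => exact hf
  | cons l L ih => exact contDiff_pderiv l ih

theorem contDiff_mderiv (α : Fin d → ℕ) {f : (Fin d → ℝ) → ℝ} (hf : ContDiff ℝ ∞ f) :
    ContDiff ℝ ∞ (mderiv α f) := by
  rw [mderiv_eq_listDeriv]; exact contDiff_listDeriv _ hf

theorem continuous_mderiv (α : Fin d → ℕ) {f : (Fin d → ℝ) → ℝ} (hf : ContDiff ℝ ∞ f) :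
    Continuous (mderiv α f) := (contDiff_mderiv α hf).continuous

theorem pderiv_comm (l l' : Fin d) {f : (Fin d → ℝ) → ℝ} (hf : ContDiff ℝ ∞ f) :
    pderiv l (pderiv l' f) = pderiv l' (pderiv l f) := by
  have key : ∀ a b : Fin d, ∀ x, pderiv a (pderiv b f) x =
      fderiv ℝ (fderiv ℝ f) x (Pi.single a 1) (Pi.single b 1) := by
    intro a b x
    have h : DifferentiableAt ℝ (fderiv ℝ f) x :=
      ((hf.fderiv_right (m := ∞) (by simp)).differentiable (by simp)).differentiableAt
    unfold pderiv
    rw [fderiv_clm_apply h (differentiableAt_const _)]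
    simp
  funext x
  rw [key, key]
  refine hf.contDiffAt.isSymmSndFDerivAt ?_ _ _
  rw [minSmoothness_of_isRCLikeNormedField]
  exact WithTop.coe_le_coe.2 (le_top : (2 : ℕ∞) ≤ ⊤)

/-- Schwarz's theorem, applied to adjacent transpositions. Directions can thus be sorted, and every
iterated partial derivative is some `mderiv α`. -/
theorem listDeriv_perm {L L' : List (Fin d)} (h : L.Perm L') {f : (Fin d → ℝ) → ℝ}
    (hf : ContDiff ℝ ∞ f) : listDeriv L f = listDeriv L' f := by
  induction h with
  | nil => rfl
  | cons l _ ih => rw [listDeriv_cons, ih, listDeriv_cons]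
  | swap a b L => exact pderiv_comm _ _ (contDiff_listDeriv L hf)
  | trans _ _ h1 h2 => rw [h1, h2]

theorem listDeriv_eq_mderiv (L : List (Fin d)) {f : (Fin d → ℝ) → ℝ} (hf : ContDiff ℝ ∞ f) :
    listDeriv L f = mderiv (fun l => L.count l) f := by
  rw [mderiv_eq_listDeriv]
  refine listDeriv_perm ?_ hf
  rw [List.perm_iff_count]
  intro l
  rw [count_multiIdxList]

theorem sum_count_eq_length (L : List (Fin d)) : ∑ l, L.count l = L.length := by
  have := length_multiIdxList (fun l => L.count l)
  rw [← this]
  refine List.Perm.length_eq ?_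
  rw [List.perm_iff_count]
  intro l
  rw [count_multiIdxList]

/-- Bridge between the coordinate derivatives that enter the norms and `iteratedFDeriv`, in which
Leibniz's rule and Taylor's formula are expressed. -/
theorem listDeriv_eq_iteratedFDeriv (L : List (Fin d)) {f : (Fin d → ℝ) → ℝ}
    (hf : ContDiff ℝ ∞ f) (x : Fin d → ℝ) :
    listDeriv L f x = iteratedFDeriv ℝ L.length f x fun i => Pi.single (L.get i) 1 := by
  induction L generalizing x with
  | nil => simp
  | cons l L ih =>
    have hd : DifferentiableAt ℝ (iteratedFDeriv ℝ L.length f) x :=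
      hf.contDiffAt.differentiableAt_iteratedFDeriv (by exact_mod_cast WithTop.coe_lt_top _)
    rw [listDeriv_cons]
    unfold pderiv
    have : listDeriv L f = fun y => iteratedFDeriv ℝ L.length f y
        fun i => Pi.single (L.get i) 1 := funext ih
    rw [this]
    rw [fderiv_continuousMultilinear_apply_const_apply hd]
    exact (iteratedFDeriv_succ_apply_left (fun i => Pi.single ((l :: L).get i) 1)).symm

theorem abs_mderiv_le (α : Fin d → ℕ) {f : (Fin d → ℝ) → ℝ} (hf : ContDiff ℝ ∞ f)
    (x : Fin d → ℝ) : |mderiv α f x| ≤ ‖iteratedFDeriv ℝ (∑ l, α l) f x‖ := by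
  rw [mderiv_eq_listDeriv, listDeriv_eq_iteratedFDeriv _ hf, ← length_multiIdxList,
    ← Real.norm_eq_abs]
  refine (ContinuousMultilinearMap.le_opNorm _ _).trans ?_
  refine mul_le_of_le_one_right (norm_nonneg _) ?_
  refine Finset.prod_le_one (fun _ _ => norm_nonneg _) fun i _ => ?_
  simp [Pi.norm_single]

/-- Expanding the k arguments in the standard basis gives d^k terms; each is a coordinate derivative
with a coefficient bounded by the product of the sup norms. -/
theorem norm_iteratedFDeriv_le_sum (k : ℕ) {f : (Fin d → ℝ) → ℝ} (hf : ContDiff ℝ ∞ f)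
    (x : Fin d → ℝ) :
    ‖iteratedFDeriv ℝ k f x‖ ≤ (d : ℝ) ^ k * ∑ α ∈ multiIdxEq d k, |mderiv α f x| := by
  set S := ∑ α ∈ multiIdxEq d k, |mderiv α f x| with hS
  have hS0 : 0 ≤ S := Finset.sum_nonneg fun _ _ => abs_nonneg _
  have key : ∀ r : Fin k → Fin d,
      |iteratedFDeriv ℝ k f x fun i => Pi.single (r i) 1| ≤ S := by
    intro r
    have h1 := listDeriv_eq_iteratedFDeriv (List.ofFn r) hf x
    have h2 : (iteratedFDeriv ℝ k f x fun i => Pi.single (r i) 1) =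
        listDeriv (List.ofFn r) f x := by
      rw [h1]
      have hl : (List.ofFn r).length = k := List.length_ofFn
      have : ∀ (n : ℕ) (h : n = k), (iteratedFDeriv ℝ k f x fun i => Pi.single (r i) (1 : ℝ)) =
          iteratedFDeriv ℝ n f x fun i => Pi.single (r (Fin.cast h i)) (1 : ℝ) := by
        intro n h; subst h; rfl
      rw [this _ hl]
      congr 1
      funext i
      congr 1
      simp only [List.get_eq_getElem, List.getElem_ofFn]
      rfl
    rw [h2, listDeriv_eq_mderiv _ hf]
    refine Finset.single_le_sum (f := fun α => |mderiv α f x|) (fun _ _ => abs_nonneg _) ?_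
    rw [mem_multiIdxEq, sum_count_eq_length, List.length_ofFn]
  refine ContinuousMultilinearMap.opNorm_le_bound (by positivity) fun v => ?_
  have hv : v = fun i => ∑ l, v i l • (Pi.single l (1 : ℝ) : Fin d → ℝ) := by
    funext i
    exact pi_eq_sum_univ' (v i)
  have hexp : iteratedFDeriv ℝ k f x v = ∑ r : Fin k → Fin d,
      (∏ i, v i (r i)) * iteratedFDeriv ℝ k f x fun i => Pi.single (r i) 1 := by
    conv_lhs => rw [hv]
    rw [ContinuousMultilinearMap.map_sum]
    refine Finset.sum_congr rfl fun r _ => ?_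
    rw [ContinuousMultilinearMap.map_smul_univ, smul_eq_mul]
  rw [hexp, Real.norm_eq_abs]
  refine (Finset.abs_sum_le_sum_abs _ _).trans ?_
  have : ∀ r ∈ (Finset.univ : Finset (Fin k → Fin d)),
      |(∏ i, v i (r i)) * iteratedFDeriv ℝ k f x fun i => Pi.single (r i) 1| ≤
        S * ∏ i, ‖v i‖ := by
    intro r _
    rw [abs_mul, mul_comm]
    refine mul_le_mul (key r) ?_ (abs_nonneg _) hS0
    rw [Finset.abs_prod]
    exact Finset.prod_le_prod (fun _ _ => abs_nonneg _) fun i _ => norm_le_pi_norm (v i) (r i)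
  refine (Finset.sum_le_card_nsmul _ _ _ this).trans ?_
  simp [nsmul_eq_mul, mul_assoc]

theorem listDeriv_eventuallyEq (L : List (Fin d)) {f g : (Fin d → ℝ) → ℝ} {x : Fin d → ℝ}
    (h : f =ᶠ[nhds x] g) : listDeriv L f =ᶠ[nhds x] listDeriv L g := by
  induction L with
  | nil => exact h
  | cons l L ih =>
    filter_upwards [ih.fderiv (𝕜 := ℝ)] with y hy
    simp only [listDeriv_cons, pderiv, hy]

theorem mderiv_eqOn (α : Fin d → ℕ) {f g : (Fin d → ℝ) → ℝ} {U : Set (Fin d → ℝ)}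
    (hU : IsOpen U) (h : EqOn f g U) : EqOn (mderiv α f) (mderiv α g) U := by
  intro x hx
  rw [mderiv_eq_listDeriv, mderiv_eq_listDeriv]
  exact (listDeriv_eventuallyEq _ (h.eventuallyEq_of_mem (hU.mem_nhds hx))).eq_of_nhds

theorem listDeriv_add (L : List (Fin d)) {f g : (Fin d → ℝ) → ℝ} (hf : ContDiff ℝ ∞ f)
    (hg : ContDiff ℝ ∞ g) : listDeriv L (f + g) = listDeriv L f + listDeriv L g := by
  induction L with
  | nil => rfl
  | cons l L ih =>
    funext x
    have h1 := ((contDiff_listDeriv L hf).differentiable (by simp)).differentiableAt (x := x)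
    have h2 := ((contDiff_listDeriv L hg).differentiable (by simp)).differentiableAt (x := x)
    rw [listDeriv_cons, ih]
    simp only [listDeriv_cons, pderiv, Pi.add_apply]
    rw [fderiv_add h1 h2]
    rfl

theorem listDeriv_smul (L : List (Fin d)) (c : ℝ) {f : (Fin d → ℝ) → ℝ} (hf : ContDiff ℝ ∞ f) :
    listDeriv L (c • f) = c • listDeriv L f := by
  induction L with
  | nil => rfl
  | cons l L ih =>
    funext x
    have h1 := ((contDiff_listDeriv L hf).differentiable (by simp)).differentiableAt (x := x)
    rw [listDeriv_cons, ih]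
    simp only [listDeriv_cons, pderiv, Pi.smul_apply]
    rw [fderiv_const_smul h1]
    rfl

theorem mderiv_add (α : Fin d → ℕ) {f g : (Fin d → ℝ) → ℝ} (hf : ContDiff ℝ ∞ f)
    (hg : ContDiff ℝ ∞ g) : mderiv α (f + g) = mderiv α f + mderiv α g := by
  simp only [mderiv_eq_listDeriv, listDeriv_add _ hf hg]

theorem mderiv_smul (α : Fin d → ℕ) (c : ℝ) {f : (Fin d → ℝ) → ℝ} (hf : ContDiff ℝ ∞ f) :
    mderiv α (c • f) = c • mderiv α f := by
  simp only [mderiv_eq_listDeriv, listDeriv_smul _ _ hf]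

theorem listDeriv_comp_affine (L : List (Fin d)) (a : Fin d → ℝ) (σ : ℝ)
    {f : (Fin d → ℝ) → ℝ} (hf : ContDiff ℝ ∞ f) (y : Fin d → ℝ) :
    listDeriv L (fun y => f (a + σ • y)) y = σ ^ L.length * listDeriv L f (a + σ • y) := by
  induction L generalizing y with
  | nil => simp
  | cons l L ih =>
    rw [listDeriv_cons, funext ih]
    have h1 := ((contDiff_listDeriv L hf).differentiable (by simp)).differentiableAt
      (x := a + σ • y)
    have h2 : HasFDerivAt (fun y : Fin d → ℝ => a + σ • y)
        (σ • ContinuousLinearMap.id ℝ (Fin d → ℝ)) y :=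
      ((hasFDerivAt_id y).const_smul σ).const_add a
    have h3 := (h1.hasFDerivAt.comp y h2).const_mul (σ ^ L.length)
    simp only [listDeriv_cons, pderiv, List.length_cons]
    erw [h3.fderiv]
    simp [pow_succ]
    ring

theorem mderiv_comp_affine (α : Fin d → ℕ) (a : Fin d → ℝ) (σ : ℝ)
    {f : (Fin d → ℝ) → ℝ} (hf : ContDiff ℝ ∞ f) (y : Fin d → ℝ) :
    mderiv α (fun y => f (a + σ • y)) y = σ ^ (∑ l, α l) * mderiv α f (a + σ • y) := by
  rw [mderiv_eq_listDeriv, mderiv_eq_listDeriv, listDeriv_comp_affine _ _ _ hf,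
    length_multiIdxList]

end Calculus

/-! ### Polynomials of bounded total degree and Taylor polynomials -/

section Polynomials

variable {d : ℕ}

/-- The monomial function `x ↦ x^α`. -/
def monom (α : Fin d → ℕ) : (Fin d → ℝ) → ℝ := fun x => ∏ l, x l ^ α l

/-- The polynomial functions of total degree at most `n`. -/
def polyLE (d n : ℕ) : Submodule ℝ ((Fin d → ℝ) → ℝ) :=
  Submodule.span ℝ {f | ∃ α : Fin d → ℕ, ∑ l, α l ≤ n ∧ f = monom α}

theorem monom_mem_polyLE {α : Fin d → ℕ} {n : ℕ} (h : ∑ l, α l ≤ n) : monom α ∈ polyLE d n :=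
  Submodule.subset_span ⟨α, h, rfl⟩

theorem polyLE_mono {a b : ℕ} (h : a ≤ b) : polyLE d a ≤ polyLE d b :=
  Submodule.span_mono fun _ ⟨α, hα, hf⟩ => ⟨α, hα.trans h, hf⟩

theorem mul_mem_polyLE {a b : ℕ} {p q : (Fin d → ℝ) → ℝ} (hp : p ∈ polyLE d a)
    (hq : q ∈ polyLE d b) : p * q ∈ polyLE d (a + b) := by
  have h := Submodule.mul_mem_mul hp hq
  rw [polyLE, polyLE, Submodule.span_mul_span] at h
  refine Submodule.span_mono ?_ h
  rintro _ ⟨_, ⟨α, hα, rfl⟩, _, ⟨β, hβ, rfl⟩, rfl⟩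
  refine ⟨α + β, ?_, ?_⟩
  · simp only [Pi.add_apply, Finset.sum_add_distrib]; omega
  · funext x
    simp [monom, pow_add, Finset.prod_mul_distrib]

theorem const_mem_polyLE (c : ℝ) (n : ℕ) : (fun _ => c) ∈ polyLE d n := by
  have h : monom (0 : Fin d → ℕ) ∈ polyLE d n := monom_mem_polyLE (by simp)
  convert (polyLE d n).smul_mem c h using 1
  funext x
  simp [monom]

theorem coord_mem_polyLE (l : Fin d) : (fun x => x l) ∈ polyLE d 1 := by
  have h : monom (Pi.single l 1 : Fin d → ℕ) ∈ polyLE d 1 :=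
    monom_mem_polyLE (by simp)
  convert h using 1
  funext x
  simp only [monom, Pi.single_apply]
  rw [Finset.prod_eq_single l] <;> simp +contextual

theorem prod_mem_polyLE {ι : Type*} (s : Finset ι) {n : ι → ℕ} {q : ι → (Fin d → ℝ) → ℝ}
    (h : ∀ i ∈ s, q i ∈ polyLE d (n i)) : ∏ i ∈ s, q i ∈ polyLE d (∑ i ∈ s, n i) := by
  classical
  induction s using Finset.induction_on with
  | empty => exact const_mem_polyLE (d := d) 1 0
  | insert a s ha ih =>
    rw [Finset.prod_insert ha, Finset.sum_insert ha]
    exact mul_mem_polyLE (h a (Finset.mem_insert_self _ _))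
      (ih fun i hi => h i (Finset.mem_insert_of_mem hi))

theorem affine_coord_mem_polyLE (a : Fin d → ℝ) (σ : ℝ) (l : Fin d) :
    (fun x => a l + σ * x l) ∈ polyLE d 1 :=
  (polyLE d 1).add_mem (const_mem_polyLE (a l) 1) ((polyLE d 1).smul_mem σ (coord_mem_polyLE l))

theorem comp_affine_mem_polyLE {n : ℕ} (a : Fin d → ℝ) (σ : ℝ) {p : (Fin d → ℝ) → ℝ}
    (hp : p ∈ polyLE d n) : (fun y => p (a + σ • y)) ∈ polyLE d n := by
  induction hp using Submodule.span_induction with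
  | mem f hf =>
    obtain ⟨α, hα, rfl⟩ := hf
    refine polyLE_mono hα ?_
    have : (fun y => monom α (a + σ • y)) =
        ∏ l, (∏ _i : Fin (α l), fun x : Fin d → ℝ => a l + σ * x l) := by
      funext y
      simp [monom]
    rw [this]
    refine prod_mem_polyLE _ fun l _ => ?_
    simpa using prod_mem_polyLE (n := fun _ => 1) (Finset.univ : Finset (Fin (α l)))
      fun _ _ => affine_coord_mem_polyLE a σ l
  | zero => exact (polyLE d n).zero_mem
  | add f g _ _ hf hg => exact (polyLE d n).add_mem hf hg
  | smul c f _ hf => exact (polyLE d n).smul_mem c hf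

theorem contDiff_monom (α : Fin d → ℕ) : ContDiff ℝ ∞ (monom α) := by
  unfold monom; fun_prop

theorem contDiff_of_mem_polyLE {n : ℕ} {p : (Fin d → ℝ) → ℝ} (hp : p ∈ polyLE d n) :
    ContDiff ℝ ∞ p := by
  induction hp using Submodule.span_induction with
  | mem f hf => obtain ⟨α, _, rfl⟩ := hf; exact contDiff_monom α
  | zero => exact contDiff_const
  | add f g _ _ hf hg => exact hf.add hg
  | smul c f _ hf => exact hf.const_smul c

/-- The truncated subtraction is harmless: for α l = 0 the coefficient vanishes. -/
theorem pderiv_monom (l : Fin d) (α : Fin d → ℕ) :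
    pderiv l (monom α) = (α l : ℝ) • monom (Function.update α l (α l - 1)) := by
  funext x
  have hd : DifferentiableAt ℝ (monom α) x := (contDiff_monom α).differentiable (by simp) x
  have h1 : pderiv l (monom α) x = deriv (fun t : ℝ => monom α (x + t • Pi.single l 1)) 0 := by
    have := hd.hasFDerivAt.hasLineDerivAt (Pi.single l 1)
    exact this.deriv.symm
  have h2 : (fun t : ℝ => monom α (x + t • Pi.single l 1)) =
      fun t => (∏ l' ∈ Finset.univ.erase l, x l' ^ α l') * (x l + t) ^ α l := by
    funext t
    simp only [monom]
    rw [← Finset.prod_erase_mul _ _ (Finset.mem_univ l)]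
    congr 1
    · refine Finset.prod_congr rfl fun l' hl' => ?_
      simp [Finset.ne_of_mem_erase hl']
    · simp
  have h3 : HasDerivAt (fun t : ℝ => (∏ l' ∈ Finset.univ.erase l, x l' ^ α l') * (x l + t) ^ α l)
      ((∏ l' ∈ Finset.univ.erase l, x l' ^ α l') * (α l * (x l + 0) ^ (α l - 1) * 1)) 0 :=
    (((hasDerivAt_id (0 : ℝ)).const_add (x l)).pow (α l)).const_mul _
  rw [h1, h2, h3.deriv]
  simp only [Pi.smul_apply, smul_eq_mul, monom]
  rw [← Finset.prod_erase_mul _ _ (Finset.mem_univ l)]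
  have : ∏ l' ∈ Finset.univ.erase l, x l' ^ Function.update α l (α l - 1) l' =
      ∏ l' ∈ Finset.univ.erase l, x l' ^ α l' :=
    Finset.prod_congr rfl fun l' hl' => by
      rw [Function.update_of_ne (Finset.ne_of_mem_erase hl')]
  rw [this, Function.update_self]
  ring

theorem pderiv_zero (l : Fin d) : pderiv l (0 : (Fin d → ℝ) → ℝ) = 0 := by
  funext x
  simp only [pderiv]
  rw [fderiv_zero]; rfl

theorem listDeriv_zero (L : List (Fin d)) : listDeriv L (0 : (Fin d → ℝ) → ℝ) = 0 := by
  induction L with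
  | nil => rfl
  | cons l L ih => rw [listDeriv_cons, ih, pderiv_zero]

theorem pderiv_mem_polyLE (l : Fin d) {n : ℕ} {p : (Fin d → ℝ) → ℝ}
    (hp : p ∈ polyLE d (n + 1)) : pderiv l p ∈ polyLE d n := by
  induction hp using Submodule.span_induction with
  | mem f hf =>
    obtain ⟨α, hα, rfl⟩ := hf
    rw [pderiv_monom]
    rcases Nat.eq_zero_or_pos (α l) with h | h
    · simp [h]
    · refine (polyLE d n).smul_mem _ (monom_mem_polyLE ?_)
      rw [Finset.sum_update_of_mem (Finset.mem_univ l)]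
      have := Finset.add_sum_erase Finset.univ α (Finset.mem_univ l)
      rw [Finset.sdiff_singleton_eq_erase]
      omega
  | zero => rw [pderiv_zero]; exact (polyLE d n).zero_mem
  | add f g hf' hg' hf hg =>
    have := listDeriv_add [l] (contDiff_of_mem_polyLE hf') (contDiff_of_mem_polyLE hg')
    simp only [listDeriv_cons, listDeriv_nil] at this
    rw [this]
    exact (polyLE d n).add_mem hf hg
  | smul c f hf' hf =>
    have := listDeriv_smul [l] c (contDiff_of_mem_polyLE hf')
    simp only [listDeriv_cons, listDeriv_nil] at this
    rw [this]
    exact (polyLE d n).smul_mem c hf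

theorem pderiv_of_mem_polyLE_zero (l : Fin d) {p : (Fin d → ℝ) → ℝ}
    (hp : p ∈ polyLE d 0) : pderiv l p = 0 := by
  induction hp using Submodule.span_induction with
  | mem f hf =>
    obtain ⟨α, hα, rfl⟩ := hf
    have : α l = 0 := by
      have := Finset.single_le_sum (f := α) (fun _ _ => Nat.zero_le _) (Finset.mem_univ l)
      omega
    rw [pderiv_monom, this]
    simp
  | zero => exact pderiv_zero l
  | add f g hf' hg' hf hg =>
    have := listDeriv_add [l] (contDiff_of_mem_polyLE hf') (contDiff_of_mem_polyLE hg')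
    simp only [listDeriv_cons, listDeriv_nil] at this
    rw [this, hf, hg, add_zero]
  | smul c f hf' hf =>
    have := listDeriv_smul [l] c (contDiff_of_mem_polyLE hf')
    simp only [listDeriv_cons, listDeriv_nil] at this
    rw [this, hf, smul_zero]

theorem listDeriv_of_mem_polyLE (n : ℕ) : ∀ (L : List (Fin d)), L.length = n + 1 →
    ∀ {p : (Fin d → ℝ) → ℝ}, p ∈ polyLE d n → listDeriv L p = 0 := by
  induction n with
  | zero =>
    intro L hL p hp
    obtain ⟨l, rfl⟩ := List.length_eq_one_iff.1 hL
    exact pderiv_of_mem_polyLE_zero l hp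
  | succ n ih =>
    intro L hL p hp
    -- The last entry of the list acts first; splitting it off lowers the degree of the polynomial
    -- by one.
    obtain ⟨L', l, rfl⟩ := (List.eq_nil_or_concat L).resolve_left (by rintro rfl; simp at hL)
    rw [List.concat_eq_append, listDeriv_append]
    exact ih L' (by simpa using hL) (pderiv_mem_polyLE l hp)

theorem mderiv_of_mem_polyLE {n : ℕ} {α : Fin d → ℕ} (hα : α ∈ multiIdxEq d (n + 1))
    {p : (Fin d → ℝ) → ℝ} (hp : p ∈ polyLE d n) : mderiv α p = 0 := by
  rw [mderiv_eq_listDeriv]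
  exact listDeriv_of_mem_polyLE n _ (by rw [length_multiIdxList]; exact mem_multiIdxEq.1 hα) hp

/-- By multilinearity this is a combination of products of k affine coordinate functions. Applied to
the terms of the Taylor polynomial. -/
theorem multilinear_diag_mem_polyLE {k : ℕ}
    (M : ContinuousMultilinearMap ℝ (fun _ : Fin k => (Fin d → ℝ)) ℝ) (y : Fin d → ℝ) :
    (fun x => M fun _ => x - y) ∈ polyLE d k := by
  have hexp : (fun x => M fun _ => x - y) = ∑ r : Fin k → Fin d,
      (M fun i => Pi.single (r i) 1) • ∏ i : Fin k, fun x : Fin d → ℝ => (-y) (r i) + 1 * x (r i) := by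
    funext x
    have hv : (fun _ : Fin k => x - y) =
        fun _ => ∑ l, (x - y) l • (Pi.single l (1 : ℝ) : Fin d → ℝ) := by
      funext i
      exact pi_eq_sum_univ' (x - y)
    rw [hv, ContinuousMultilinearMap.map_sum]
    rw [Finset.sum_apply]
    refine Finset.sum_congr rfl fun r _ => ?_
    rw [ContinuousMultilinearMap.map_smul_univ, smul_eq_mul]
    simp only [Pi.smul_apply, smul_eq_mul, Finset.prod_apply]
    rw [mul_comm]
    congr 1
    refine Finset.prod_congr rfl fun i _ => ?_
    simp; ring
  rw [hexp]
  refine Submodule.sum_mem _ fun r _ => Submodule.smul_mem _ _ ?_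
  simpa using prod_mem_polyLE (n := fun _ => 1) (Finset.univ : Finset (Fin k))
    fun i _ => affine_coord_mem_polyLE (-y) 1 (r i)

/-- The Taylor polynomial of degree `n` of `f` at `y`. -/
def taylorPoly (n : ℕ) (f : (Fin d → ℝ) → ℝ) (y x : Fin d → ℝ) : ℝ :=
  ∑ k ∈ Finset.range (n + 1), (k.factorial : ℝ)⁻¹ • iteratedFDeriv ℝ k f y fun _ => x - y

theorem taylorPoly_mem_polyLE (n : ℕ) (f : (Fin d → ℝ) → ℝ) (y : Fin d → ℝ) :
    taylorPoly n f y ∈ polyLE d n := by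
  have : taylorPoly n f y = ∑ k ∈ Finset.range (n + 1), (k.factorial : ℝ)⁻¹ •
      fun x => iteratedFDeriv ℝ k f y fun _ => x - y := by
    funext x
    simp [taylorPoly, Finset.sum_apply]
  rw [this]
  refine Submodule.sum_mem _ fun k hk => Submodule.smul_mem _ _ ?_
  exact polyLE_mono (by simpa [Nat.lt_succ_iff] using hk) (multilinear_diag_mem_polyLE _ y)

theorem sub_taylorPoly_eq_integral (n : ℕ) {f : (Fin d → ℝ) → ℝ} (hf : ContDiff ℝ ∞ f)
    (x y : Fin d → ℝ) :
    f x - taylorPoly n f y x = (n.factorial : ℝ)⁻¹ * ∫ t in (0 : ℝ)..1,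
      (1 - t) ^ n * iteratedFDeriv ℝ (n + 1) f (y + t • (x - y)) fun _ => x - y := by
  have h := map_add_eq_sum_add_integral_iteratedFDeriv (f := f) (x := y) (y := x - y) (n := n)
    fun t _ => hf.contDiffAt.of_le (by exact_mod_cast le_top)
  rw [add_sub_cancel] at h
  rw [h, taylorPoly]
  simp

end Polynomials

/-! ### The partition of unity -/

section PartitionOfUnity

/-- The cut-off at |x| = 1/2 is where 1 - 4x² changes sign, so smoothness is inherited from the flat
function `expNegInvGlue`. -/
theorem bump_eq (x : ℝ) : bump x = expNegInvGlue (1 - 4 * x ^ 2) := by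
  have h : 1 / 2 ≤ |x| ↔ 1 - 4 * x ^ 2 ≤ 0 := by
    rw [← sq_abs x]
    constructor <;> intro h <;> nlinarith [abs_nonneg x]
  unfold bump expNegInvGlue
  rw [one_div (1 - 4 * x ^ 2)]
  exact if_congr h rfl rfl

theorem contDiff_bump : ContDiff ℝ ∞ bump := by
  rw [funext bump_eq]
  exact expNegInvGlue.contDiff.comp (by fun_prop)

theorem bump_nonneg (x : ℝ) : 0 ≤ bump x := by
  rw [bump_eq]; exact expNegInvGlue.nonneg _

theorem support_bump_subset : Function.support bump ⊆ Ioo (-(1 / 2)) (1 / 2) := by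
  intro x hx
  rw [mem_Ioo, ← abs_lt]
  by_contra h
  exact hx (if_pos (not_lt.1 h))

theorem integrable_bump : Integrable bump := by
  refine contDiff_bump.continuous.integrable_of_hasCompactSupport ?_
  exact HasCompactSupport.of_support_subset_isCompact isCompact_Icc
    (support_bump_subset.trans Ioo_subset_Icc_self)

theorem integral_bump_pos : 0 < ∫ x, bump x := by
  rw [integral_pos_iff_support_of_nonneg bump_nonneg integrable_bump]
  refine IsOpen.measure_pos _ contDiff_bump.continuous.isOpen_support ⟨0, ?_⟩
  rw [Function.mem_support, bump_eq]
  exact (expNegInvGlue.pos_of_pos (by norm_num)).ne'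

theorem contDiff_mollifier : ContDiff ℝ ∞ mollifier := contDiff_const.mul contDiff_bump

theorem mollifier_nonneg (x : ℝ) : 0 ≤ mollifier x :=
  mul_nonneg (inv_nonneg.2 integral_bump_pos.le) (bump_nonneg x)

theorem integral_mollifier : ∫ x, mollifier x = 1 := by
  unfold mollifier
  rw [integral_const_mul, inv_mul_cancel₀ integral_bump_pos.ne']

theorem support_mollifier_subset : Function.support mollifier ⊆ Ioo (-(1 / 2)) (1 / 2) :=
  fun _ hx => support_bump_subset (right_ne_zero_of_mul hx)

/-- The antiderivative of the mollifier. -/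
def mollifierPrim (x : ℝ) : ℝ := ∫ s in (-(1 / 2))..x, mollifier s

theorem hasDerivAt_mollifierPrim (x : ℝ) : HasDerivAt mollifierPrim (mollifier x) x :=
  intervalIntegral.integral_hasDerivAt_right
    (contDiff_mollifier.continuous.intervalIntegrable _ _)
    (contDiff_mollifier.continuous.stronglyMeasurableAtFilter _ _)
    contDiff_mollifier.continuous.continuousAt

theorem contDiff_mollifierPrim : ContDiff ℝ ∞ mollifierPrim := by
  rw [contDiff_infty_iff_deriv]
  refine ⟨fun x => (hasDerivAt_mollifierPrim x).differentiableAt, ?_⟩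
  rw [show deriv mollifierPrim = mollifier from funext fun x => (hasDerivAt_mollifierPrim x).deriv]
  exact contDiff_mollifier

theorem mollifierPrim_of_le {x : ℝ} (hx : x ≤ -(1 / 2)) : mollifierPrim x = 0 := by
  unfold mollifierPrim
  rw [intervalIntegral.integral_congr (g := fun _ => (0 : ℝ))]
  · simp
  · intro s hs
    rw [uIcc_of_ge hx] at hs
    by_contra h
    exact absurd (support_mollifier_subset h).1 (not_lt.2 hs.2)

theorem mollifierPrim_of_ge {x : ℝ} (hx : 1 / 2 ≤ x) : mollifierPrim x = 1 := by
  unfold mollifierPrim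
  rw [intervalIntegral.integral_eq_integral_of_support_subset, integral_mollifier]
  exact support_mollifier_subset.trans fun s hs => ⟨hs.1, hs.2.le.trans hx⟩

theorem mollifierPrim_mono : Monotone mollifierPrim :=
  monotone_of_deriv_nonneg (fun x => (hasDerivAt_mollifierPrim x).differentiableAt)
    fun x => by rw [(hasDerivAt_mollifierPrim x).deriv]; exact mollifier_nonneg x

/-- The one-dimensional profile of the partition of unity. -/
def profile (t : ℝ) : ℝ := mollifierPrim (t + 1 / 2) - mollifierPrim (t - 1 / 2)

theorem contDiff_profile : ContDiff ℝ ∞ profile :=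
  (contDiff_mollifierPrim.comp (contDiff_id.add contDiff_const)).sub
    (contDiff_mollifierPrim.comp (contDiff_id.sub contDiff_const))

theorem profile_nonneg (t : ℝ) : 0 ≤ profile t :=
  sub_nonneg.2 (mollifierPrim_mono (by linarith))

theorem profile_of_one_le_abs {t : ℝ} (ht : 1 ≤ |t|) : profile t = 0 := by
  unfold profile
  rcases le_abs.1 ht with h | h
  · rw [mollifierPrim_of_ge (by linarith), mollifierPrim_of_ge (by linarith), sub_self]
  · rw [mollifierPrim_of_le (by linarith), mollifierPrim_of_le (by linarith), sub_self]

/-- The sum telescopes: the inner antiderivatives cancel and the outer ones have already reached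
their limits 1 and 0. This is the partition of unity in one dimension. -/
theorem profile_add_profile {t : ℝ} (h0 : 0 ≤ t) (h1 : t ≤ 1) :
    profile t + profile (t - 1) = 1 := by
  unfold profile
  rw [mollifierPrim_of_ge (x := t + 1 / 2) (by linarith),
    mollifierPrim_of_le (x := t - 1 - 1 / 2) (by linarith)]
  ring_nf

theorem profile_le_one (t : ℝ) : profile t ≤ 1 := by
  rcases le_total 1 |t| with h | h
  · rw [profile_of_one_le_abs h]; exact zero_le_one
  · rw [abs_le] at h
    rcases le_total 0 t with h0 | h0
    · linarith [profile_add_profile h0 h.2, profile_nonneg (t - 1)]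
    · have := profile_add_profile (t := t + 1) (by linarith) (by linarith)
      rw [add_sub_cancel_right] at this
      linarith [profile_nonneg (t + 1)]

/-- Convolving the indicator of an interval with the mollifier gives a difference of
antiderivatives; this is why `profile` is defined as it is. -/
theorem integral_scaled_mollifier {σ : ℝ} (hσ : 0 < σ) (n x : ℝ) :
    ∫ y in Ioo ((n - 1 / 2) * σ) ((n + 1 / 2) * σ), σ⁻¹ * mollifier ((x - y) / σ) =
      profile (x / σ - n) := by
  have hle : (n - 1 / 2) * σ ≤ (n + 1 / 2) * σ := by nlinarith
  rw [← integral_Ioc_eq_integral_Ioo, ← intervalIntegral.integral_of_le hle]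
  have h : (fun y => σ⁻¹ * mollifier ((x - y) / σ)) = fun y => σ⁻¹ * mollifier (x / σ - y / σ) := by
    funext y; rw [sub_div]
  rw [h, intervalIntegral.integral_const_mul]
  have h2 := intervalIntegral.integral_comp_sub_div (a := (n - 1 / 2) * σ) (b := (n + 1 / 2) * σ)
    mollifier hσ.ne' (x / σ)
  rw [h2, smul_eq_mul, inv_mul_cancel_left₀ hσ.ne', mul_div_assoc, mul_div_assoc, div_self hσ.ne']
  unfold profile mollifierPrim
  rw [intervalIntegral.integral_interval_sub_left
    (contDiff_mollifier.continuous.intervalIntegrable _ _)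
    (contDiff_mollifier.continuous.intervalIntegrable _ _)]
  congr 1 <;> ring

variable {d : ℕ}

theorem patchCore_eq_pi (σ : ℝ) (i : Fin d → ℤ) : patchCore σ i =
    Set.pi univ fun l => Ioo (((i l : ℝ) - 1 / 2) * σ) (((i l : ℝ) + 1 / 2) * σ) := by
  ext x; simp [patchCore]

theorem pou_eq_prod {σ : ℝ} (hσ : 0 < σ) (i : Fin d → ℤ) (x : Fin d → ℝ) :
    pou σ i x = ∏ l, profile (x l / σ - i l) := by
  unfold pou scaledMollifier
  rw [patchCore_eq_pi, volume_pi, Measure.restrict_pi_pi]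
  have h : ∀ y : Fin d → ℝ, (σ ^ d)⁻¹ * ∏ l, mollifier ((x - y) l / σ) =
      ∏ l, σ⁻¹ * mollifier ((x l - y l) / σ) := by
    intro y
    rw [Finset.prod_mul_distrib]
    simp
  simp only [h]
  rw [integral_fintype_prod_eq_prod (𝕜 := ℝ)
    (f := fun l (y : ℝ) => σ⁻¹ * mollifier ((x l - y) / σ))]
  exact Finset.prod_congr rfl fun l _ => integral_scaled_mollifier hσ _ _

theorem contDiff_pou {σ : ℝ} (hσ : 0 < σ) (i : Fin d → ℤ) : ContDiff ℝ ∞ (pou σ i) := by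
  rw [funext (pou_eq_prod hσ i)]
  refine contDiff_prod fun l _ => contDiff_profile.comp ?_
  fun_prop

theorem pou_nonneg {σ : ℝ} (hσ : 0 < σ) (i : Fin d → ℤ) (x : Fin d → ℝ) : 0 ≤ pou σ i x := by
  rw [pou_eq_prod hσ]; exact Finset.prod_nonneg fun l _ => profile_nonneg _

theorem pou_le_one {σ : ℝ} (hσ : 0 < σ) (i : Fin d → ℤ) (x : Fin d → ℝ) : pou σ i x ≤ 1 := by
  rw [pou_eq_prod hσ]
  exact Finset.prod_le_one (fun l _ => profile_nonneg _) fun l _ => profile_le_one _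

/-- Self-similarity of the partition of unity, the source of all constants independent of σ and of
the position in the grid. -/
theorem pou_affine {σ : ℝ} (hσ : 0 < σ) (i j : Fin d → ℤ) (y : Fin d → ℝ) :
    pou σ j (σ • ((fun l => (i l : ℝ)) + y)) = pou 1 (j - i) y := by
  rw [pou_eq_prod hσ, pou_eq_prod one_pos]
  refine Finset.prod_congr rfl fun l _ => ?_
  congr 1
  simp [mul_div_cancel_left₀ _ hσ.ne']
  ring

theorem pou_one_eq_zero {n : Fin d → ℤ} {y : Fin d → ℝ} (h : ∃ l, 1 ≤ |y l - n l|) :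
    pou 1 n y = 0 := by
  obtain ⟨l, hl⟩ := h
  rw [pou_eq_prod one_pos]
  exact Finset.prod_eq_zero (Finset.mem_univ l) (profile_of_one_le_abs (by simpa using hl))

/-- The vertices of the reference cell. -/
def unitVertices (d : ℕ) : Finset (Fin d → ℤ) := Fintype.piFinset fun _ => {0, 1}

/-- Distributivity turns the sum over the vertices into a product over the coordinates of two-term
sums, each equal to 1. -/
theorem sum_pou_one {y : Fin d → ℝ} (hy : ∀ l, y l ∈ Icc (0 : ℝ) 1) :
    ∑ n ∈ unitVertices d, pou 1 n y = 1 := by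
  have h : ∀ n : Fin d → ℤ, pou 1 n y = ∏ l, profile (y l - n l) := fun n => by
    rw [pou_eq_prod one_pos]; simp
  simp only [h]
  unfold unitVertices
  rw [← Finset.prod_univ_sum (fun _ => ({0, 1} : Finset ℤ))
    (fun (l : Fin d) (n : ℤ) => profile (y l - (n : ℝ)))]
  refine Finset.prod_eq_one fun l _ => ?_
  rw [Finset.sum_pair (by norm_num)]
  simpa using profile_add_profile (hy l).1 (hy l).2

end PartitionOfUnity

/-! ### Comparison of seminorms on a finite-dimensional space -/

/-- On a complement T of its kernel q is a norm, for which the coordinate functionals of a basis are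
continuous by finite dimension. The p i ignore the kernel, and on T they are bounded through their
values at the basis vectors. Allowing a family gives one constant for all evaluation points of a
cell. -/
theorem exists_seminorm_family_le {E ι : Type*} [AddCommGroup E] [Module ℝ E]
    [FiniteDimensional ℝ E] (p : ι → Seminorm ℝ E) (q : Seminorm ℝ E)
    (hb : ∀ x, ∃ M, ∀ i, p i x ≤ M) (hk : ∀ x, q x = 0 → ∀ i, p i x = 0) :
    ∃ C : ℝ, 0 < C ∧ ∀ i x, p i x ≤ C * q x := by
  let K : Submodule ℝ E :=
    { carrier := {x | q x = 0}
      zero_mem' := map_zero q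
      add_mem' := fun {a b} ha hb => le_antisymm
        ((map_add_le_add q a b).trans (by rw [ha, hb, add_zero])) (apply_nonneg q _)
      smul_mem' := fun c x hx => by
        show q (c • x) = 0
        rw [map_smul_eq_mul, show q x = 0 from hx, mul_zero] }
  obtain ⟨T, hT⟩ := Submodule.exists_isCompl K
  let : Norm T := ⟨fun x => q x⟩
  have core : NormedSpace.Core ℝ T :=
    { norm_nonneg := fun x => apply_nonneg q _
      norm_smul := fun c x => map_smul_eq_mul q c (x : E)
      norm_triangle := fun x y => map_add_le_add q (x : E) y
      norm_eq_zero_iff := fun x => by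
        refine ⟨fun h => ?_, fun h => by rw [h]; exact map_zero q⟩
        have : (x : E) ∈ K ⊓ T := ⟨h, x.2⟩
        rw [hT.inf_eq_bot] at this
        exact Subtype.ext ((Submodule.mem_bot ℝ).1 this) }
  let : NormedAddCommGroup T := NormedAddCommGroup.ofCore core
  let : NormedSpace ℝ T := NormedSpace.ofCore core
  let b := Module.finBasis ℝ T
  choose M hM using hb
  let coord := fun j => (b.coord j).toContinuousLinearMap
  -- The summand 1 keeps the constant positive even if the sum vanishes.
  refine ⟨1 + ∑ j, ‖coord j‖ * |M (b j)|, ?_, fun i x => ?_⟩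
  · have : 0 ≤ ∑ j, ‖coord j‖ * |M (b j)| := Finset.sum_nonneg fun j _ => by positivity
    linarith
  obtain ⟨k, t, hkt⟩ : ∃ (k : K) (t : T), (k : E) + t = x := by
    obtain ⟨y, hy, z, hz, h⟩ := Submodule.mem_sup.1 (hT.sup_eq_top ▸ Submodule.mem_top (x := x))
    exact ⟨⟨y, hy⟩, ⟨z, hz⟩, h⟩
  have hqk : q k = 0 := k.2
  have hqt : q (t : E) ≤ q x := by
    have : (t : E) = x - k := by rw [← hkt]; abel
    rw [this]
    refine (map_sub_le_add q _ _).trans ?_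
    rw [hqk, add_zero]
  have hpt : p i x ≤ p i (t : E) := by
    rw [← hkt]
    refine (map_add_le_add (p i) _ _).trans ?_
    rw [hk _ hqk, zero_add]
  have hsum : p i (t : E) ≤ ∑ j, p i ((b.repr t j) • (b j : E)) := by
    conv_lhs => rw [← b.sum_repr t]
    rw [Submodule.coe_sum]
    exact Finset.le_sum_of_subadditive (p i) (map_zero _).le (map_add_le_add (p i)) _ _
  have hterm : ∀ j, p i ((b.repr t j) • (b j : E)) ≤ ‖coord j‖ * |M (b j)| * q t := by
    intro j
    rw [map_smul_eq_mul]
    have h1 : ‖b.repr t j‖ ≤ ‖coord j‖ * q t := (coord j).le_opNorm t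
    have h2 : p i (b j : E) ≤ |M (b j)| := (hM _ i).trans (le_abs_self _)
    calc ‖b.repr t j‖ * p i (b j : E) ≤ (‖coord j‖ * q t) * |M (b j)| :=
          mul_le_mul h1 h2 (apply_nonneg _ _)
            (mul_nonneg (norm_nonneg _) (apply_nonneg q _))
      _ = _ := by ring
  calc p i x ≤ ∑ j, ‖coord j‖ * |M (b j)| * q t :=
        hpt.trans (hsum.trans (Finset.sum_le_sum fun j _ => hterm j))
    _ = (∑ j, ‖coord j‖ * |M (b j)|) * q t := by rw [Finset.sum_mul]
    _ ≤ (1 + ∑ j, ‖coord j‖ * |M (b j)|) * q x := by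
        have : 0 ≤ ∑ j, ‖coord j‖ * |M (b j)| := Finset.sum_nonneg fun j _ => by positivity
        exact mul_le_mul (by linarith) hqt (apply_nonneg _ _) (by linarith)

/-! ### `L²` norms of continuous functions on bounded sets -/

section L2

variable {d : ℕ}

theorem memLp_of_continuous_of_isBounded {S : Set (Fin d → ℝ)} (hS : Bornology.IsBounded S)
    {f : (Fin d → ℝ) → ℝ} (hf : Continuous f) (p : ℝ≥0∞) : MemLp f p (volume.restrict S) := by
  have hc : IsCompact (closure S) := hS.isCompact_closure
  obtain ⟨C, hC⟩ := hc.exists_bound_of_continuousOn hf.continuousOn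
  have : IsFiniteMeasure (volume.restrict (closure S)) :=
    ⟨by rw [Measure.restrict_apply_univ]; exact hc.measure_lt_top⟩
  have h : MemLp f p (volume.restrict (closure S)) :=
    MemLp.of_bound hf.aestronglyMeasurable C
      (by filter_upwards [ae_restrict_mem isClosed_closure.measurableSet] with x hx using hC x hx)
  exact h.mono_measure (Measure.restrict_mono subset_closure le_rfl)

theorem integrableOn_of_continuous_of_isBounded {S : Set (Fin d → ℝ)}
    (hS : Bornology.IsBounded S) {f : (Fin d → ℝ) → ℝ} (hf : Continuous f) :
    IntegrableOn f S :=
  memLp_one_iff_integrable.1 (memLp_of_continuous_of_isBounded hS hf 1)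

/-- The norm of `L²(S)`. -/
def l2norm (S : Set (Fin d → ℝ)) (f : (Fin d → ℝ) → ℝ) : ℝ :=
  (eLpNorm f 2 (volume.restrict S)).toReal

theorem l2norm_nonneg (S : Set (Fin d → ℝ)) (f : (Fin d → ℝ) → ℝ) : 0 ≤ l2norm S f :=
  ENNReal.toReal_nonneg

theorem l2norm_sq {S : Set (Fin d → ℝ)} {f : (Fin d → ℝ) → ℝ}
    (hf : MemLp f 2 (volume.restrict S)) : l2norm S f ^ 2 = ∫ x in S, f x ^ 2 := by
  unfold l2norm
  rw [hf.eLpNorm_eq_integral_rpow_norm (by norm_num) (by norm_num)]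
  have h0 : 0 ≤ ∫ x in S, ‖f x‖ ^ (ENNReal.toReal 2) :=
    integral_nonneg fun x => by positivity
  rw [ENNReal.toReal_ofReal (by positivity), ← Real.rpow_natCast, ← Real.rpow_mul h0]
  simp

theorem l2norm_add_le {S : Set (Fin d → ℝ)} {f g : (Fin d → ℝ) → ℝ}
    (hf : MemLp f 2 (volume.restrict S)) (hg : MemLp g 2 (volume.restrict S)) :
    l2norm S (f + g) ≤ l2norm S f + l2norm S g := by
  unfold l2norm
  rw [← ENNReal.toReal_add hf.eLpNorm_ne_top hg.eLpNorm_ne_top]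
  exact ENNReal.toReal_mono (ENNReal.add_ne_top.2 ⟨hf.eLpNorm_ne_top, hg.eLpNorm_ne_top⟩)
    (eLpNorm_add_le hf.1 hg.1 (by norm_num))

theorem l2norm_smul (S : Set (Fin d → ℝ)) (c : ℝ) (f : (Fin d → ℝ) → ℝ) :
    l2norm S (c • f) = |c| * l2norm S f := by
  unfold l2norm
  rw [eLpNorm_const_smul, ENNReal.toReal_mul]
  simp

theorem eqOn_zero_of_l2norm_eq_zero {S : Set (Fin d → ℝ)} (hS : IsOpen S)
    (hb : Bornology.IsBounded S) {f : (Fin d → ℝ) → ℝ} (hf : Continuous f)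
    (h : l2norm S f = 0) : EqOn f 0 S := by
  have hm := memLp_of_continuous_of_isBounded hb hf 2
  have h0 : eLpNorm f 2 (volume.restrict S) = 0 :=
    (ENNReal.toReal_eq_zero_iff _).1 h |>.resolve_right hm.eLpNorm_ne_top
  rw [eLpNorm_eq_zero_iff hm.1 (by norm_num)] at h0
  exact Measure.eqOn_open_of_ae_eq h0 hS hf.continuousOn continuousOn_const

theorem l2norm_eq_zero_of_eqOn {S : Set (Fin d → ℝ)} (hS : MeasurableSet S)
    {f : (Fin d → ℝ) → ℝ} (h : EqOn f 0 S) : l2norm S f = 0 := by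
  unfold l2norm
  rw [eLpNorm_congr_ae (g := 0) ((ae_restrict_iff' hS).2 (Filter.Eventually.of_forall h))]
  simp

/-- The seminorm `x ↦ ‖T x‖_{L²(S)}` for a linear map `T` into the continuous functions. -/
def l2Seminorm {E : Type*} [AddCommGroup E] [Module ℝ E] {S : Set (Fin d → ℝ)}
    (hS : Bornology.IsBounded S) (T : E →ₗ[ℝ] (Fin d → ℝ) → ℝ) (hT : ∀ x, Continuous (T x)) :
    Seminorm ℝ E :=
  Seminorm.of (fun x => l2norm S (T x))
    (fun x y => by
      rw [map_add]
      exact l2norm_add_le (memLp_of_continuous_of_isBounded hS (hT x) 2)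
        (memLp_of_continuous_of_isBounded hS (hT y) 2))
    (fun c x => by rw [map_smul, l2norm_smul, Real.norm_eq_abs])

/-- Cells as boxes. -/
theorem cell_eq_pi (σ : ℝ) (i : Fin d → ℤ) : cell σ i =
    Set.pi univ fun l => Ioo ((i l : ℝ) * σ) (((i l : ℝ) + 1) * σ) := by
  ext x; simp [cell]

theorem isOpen_cell (σ : ℝ) (i : Fin d → ℤ) : IsOpen (cell σ i) := by
  rw [cell_eq_pi]
  exact isOpen_set_pi finite_univ fun _ _ => isOpen_Ioo

theorem measurableSet_cell (σ : ℝ) (i : Fin d → ℤ) : MeasurableSet (cell σ i) :=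
  (isOpen_cell σ i).measurableSet

theorem isBounded_cell (σ : ℝ) (i : Fin d → ℤ) : Bornology.IsBounded (cell σ i) := by
  rw [cell_eq_pi]
  exact Bornology.IsBounded.pi fun l => Metric.isBounded_Ioo _ _

theorem closure_cell {σ : ℝ} (hσ : 0 < σ) (i : Fin d → ℤ) : closure (cell σ i) =
    Set.pi univ fun l => Icc ((i l : ℝ) * σ) (((i l : ℝ) + 1) * σ) := by
  rw [cell_eq_pi, closure_pi_set]
  congr 1
  funext l
  exact closure_Ioo (by nlinarith)

theorem convex_cell (σ : ℝ) (i : Fin d → ℤ) : Convex ℝ (cell σ i) := by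
  rw [cell_eq_pi]
  exact convex_pi fun _ _ => convex_Ioo _ _

theorem node_mem_closure_cell {n i : Fin d → ℤ} (h : IsNodeOf n i) :
    (fun l => (n l : ℝ)) ∈ closure (cell 1 i) := by
  rw [closure_cell one_pos]
  intro l _
  rcases h l with h | h <;> simp [h]

end L2

/-! ### Local estimates on the reference cell -/

section Reference

variable {d P : ℕ}

/-- The indices of the partition of unity functions on the unit grid that do not vanish near the
reference cell and its neighbours. -/
def refBox (d : ℕ) : Finset (Fin d → ℤ) := Fintype.piFinset fun _ => Finset.Icc (-1) 2

/-- The generators `φ_i x^α` of the finite element spaces. -/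
def shapeFn (σ : ℝ) (i : Fin d → ℤ) (p : (Fin d → ℝ) → ℝ) : (Fin d → ℝ) → ℝ :=
  fun x => pou σ i x * p x

/-- The space of shape functions near the reference cell. -/
def refSpace (d P : ℕ) : Submodule ℝ ((Fin d → ℝ) → ℝ) :=
  Submodule.span ℝ {f | ∃ (n : Fin d → ℤ) (α : Fin d → ℕ),
    n ∈ refBox d ∧ ∑ l, α l ≤ P ∧ f = shapeFn 1 n (monom α)}

/-- The span of all the functions `φ_i x^α` with `|α| ≤ P`. -/
def pufemAll (d : ℕ) (σ : ℝ) (P : ℕ) : Submodule ℝ ((Fin d → ℝ) → ℝ) :=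
  Submodule.span ℝ {f | ∃ (i : Fin d → ℤ) (α : Fin d → ℕ),
    ∑ l, α l ≤ P ∧ f = shapeFn σ i (monom α)}

instance : FiniteDimensional ℝ (refSpace d P) := by
  refine FiniteDimensional.span_of_finite ℝ ?_
  refine (((refBox d) ×ˢ (multiIdxLE d P)).finite_toSet.image
    fun z => shapeFn 1 z.1 (monom z.2)).subset ?_
  rintro _ ⟨n, α, hn, hα, rfl⟩
  exact ⟨(n, α), by simp [hn, mem_multiIdxLE, hα], rfl⟩

theorem shapeFn_mem {σ : ℝ} {i : Fin d → ℤ} {W : Submodule ℝ ((Fin d → ℝ) → ℝ)}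
    (hW : ∀ α : Fin d → ℕ, ∑ l, α l ≤ P → shapeFn σ i (monom α) ∈ W)
    {p : (Fin d → ℝ) → ℝ} (hp : p ∈ polyLE d P) : shapeFn σ i p ∈ W := by
  induction hp using Submodule.span_induction with
  | mem f hf => obtain ⟨α, hα, rfl⟩ := hf; exact hW α hα
  | zero =>
    convert W.zero_mem using 1
    funext x; simp [shapeFn]
  | add f g _ _ hf hg =>
    convert W.add_mem hf hg using 1
    funext x; simp [shapeFn, mul_add]
  | smul c f _ hf =>
    convert W.smul_mem c hf using 1
    funext x; simp [shapeFn]; ring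

theorem shapeFn_mem_refSpace {n : Fin d → ℤ} (hn : n ∈ refBox d) {p : (Fin d → ℝ) → ℝ}
    (hp : p ∈ polyLE d P) : shapeFn 1 n p ∈ refSpace d P :=
  shapeFn_mem (W := refSpace d P) (fun α hα => Submodule.subset_span ⟨n, α, hn, hα, rfl⟩) hp

theorem shapeFn_mem_pufemAll (σ : ℝ) (i : Fin d → ℤ) {p : (Fin d → ℝ) → ℝ}
    (hp : p ∈ polyLE d P) : shapeFn σ i p ∈ pufemAll d σ P :=
  shapeFn_mem (W := pufemAll d σ P) (fun α hα => Submodule.subset_span ⟨i, α, hα, rfl⟩) hp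

theorem shapeFn_mem_pufem {Ω : Set (Fin d → ℝ)} {σ : ℝ} {i : Fin d → ℤ}
    (hi : (patch σ i ∩ fictitious Ω σ).Nonempty) {p : (Fin d → ℝ) → ℝ}
    (hp : p ∈ polyLE d P) : shapeFn σ i p ∈ pufem Ω σ P :=
  shapeFn_mem (W := pufem Ω σ P) (fun α hα => Submodule.subset_span ⟨i, α, hi, hα, rfl⟩) hp

theorem pufem_le_pufemAll (Ω : Set (Fin d → ℝ)) (σ : ℝ) : pufem Ω σ P ≤ pufemAll d σ P :=
  Submodule.span_mono fun _ ⟨i, α, _, hα, hf⟩ => ⟨i, α, hα, hf⟩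

theorem contDiff_of_mem_pufemAll {σ : ℝ} (hσ : 0 < σ) {v : (Fin d → ℝ) → ℝ}
    (hv : v ∈ pufemAll d σ P) : ContDiff ℝ ∞ v := by
  induction hv using Submodule.span_induction with
  | mem f hf => obtain ⟨i, α, _, rfl⟩ := hf; exact (contDiff_pou hσ i).mul (contDiff_monom α)
  | zero => exact contDiff_const
  | add f g _ _ hf hg => exact hf.add hg
  | smul c f _ hf => exact hf.const_smul c

theorem refSpace_le_pufemAll : refSpace d P ≤ pufemAll d 1 P :=
  Submodule.span_mono fun _ ⟨i, α, _, hα, hf⟩ => ⟨i, α, hα, hf⟩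

theorem contDiff_of_mem_refSpace {f : (Fin d → ℝ) → ℝ} (hf : f ∈ refSpace d P) :
    ContDiff ℝ ∞ f :=
  contDiff_of_mem_pufemAll one_pos (refSpace_le_pufemAll hf)

/-- The grid point with index `i`. -/
def gridPt (σ : ℝ) (i : Fin d → ℤ) : Fin d → ℝ := fun l => (i l : ℝ) * σ

theorem pou_gridPt {σ : ℝ} (hσ : 0 < σ) (i j : Fin d → ℤ) (y : Fin d → ℝ) :
    pou σ j (gridPt σ i + σ • y) = pou 1 (j - i) y := by
  rw [← pou_affine hσ i j y]
  congr 1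
  funext l
  simp [gridPt]; ring

/-- Rescaling sends partition functions to partition functions of the unit grid and preserves
polynomial degree. Those with index outside [-1,2]^d vanish on the cube [-1,2]^d, which contains the
reference cell and its neighbours, so a finite set of generators suffices. -/
theorem exists_refSpace_eq {σ : ℝ} (hσ : 0 < σ) {v : (Fin d → ℝ) → ℝ}
    (hv : v ∈ pufemAll d σ P) (i : Fin d → ℤ) :
    ∃ f ∈ refSpace d P, ∀ y : Fin d → ℝ, (∀ l, y l ∈ Icc (-1 : ℝ) 2) →
      v (gridPt σ i + σ • y) = f y := by
  induction hv using Submodule.span_induction with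
  | mem g hg =>
    obtain ⟨j, α, hα, rfl⟩ := hg
    by_cases hn : j - i ∈ refBox d
    · refine ⟨_, shapeFn_mem_refSpace hn
        (comp_affine_mem_polyLE (gridPt σ i) σ (monom_mem_polyLE hα)), fun y _ => ?_⟩
      simp only [shapeFn, pou_gridPt hσ]
    · refine ⟨0, Submodule.zero_mem _, fun y hy => ?_⟩
      simp only [shapeFn, pou_gridPt hσ, Pi.zero_apply]
      rw [pou_one_eq_zero, zero_mul]
      simp only [refBox, Fintype.mem_piFinset, Finset.mem_Icc, not_forall, not_and_or, not_le] at hn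
      obtain ⟨l, hl⟩ := hn
      refine ⟨l, ?_⟩
      have hyl := hy l
      rcases hl with hl | hl
      · have : (((j - i) l : ℤ) : ℝ) ≤ -2 := by exact_mod_cast (by omega : (j - i) l ≤ -2)
        exact le_abs.2 (Or.inl (by linarith [hyl.1]))
      · have : (3 : ℝ) ≤ (((j - i) l : ℤ) : ℝ) := by exact_mod_cast (by omega : 3 ≤ (j - i) l)
        exact le_abs.2 (Or.inr (by linarith [hyl.2]))
  | zero => exact ⟨0, Submodule.zero_mem _, fun _ _ => rfl⟩
  | add v w _ _ hv hw =>
    obtain ⟨f, hf, hvf⟩ := hv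
    obtain ⟨g, hg, hwg⟩ := hw
    exact ⟨f + g, Submodule.add_mem _ hf hg, fun y hy => by
      rw [Pi.add_apply, Pi.add_apply, hvf y hy, hwg y hy]⟩
  | smul c v _ hv =>
    obtain ⟨f, hf, hvf⟩ := hv
    exact ⟨c • f, Submodule.smul_mem _ c hf, fun y hy => by
      rw [Pi.smul_apply, Pi.smul_apply, hvf y hy]⟩

/-- The iterated derivative at a point as a linear map on the reference space. -/
def iteratedFDerivRef (d P k : ℕ) (y : Fin d → ℝ) :
    refSpace d P →ₗ[ℝ] ContinuousMultilinearMap ℝ (fun _ : Fin k => (Fin d → ℝ)) ℝ where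
  toFun f := iteratedFDeriv ℝ k f.1 y
  map_add' f g := iteratedFDeriv_add_apply
    ((contDiff_of_mem_refSpace f.2).contDiffAt.of_le (by exact_mod_cast le_top))
    ((contDiff_of_mem_refSpace g.2).contDiffAt.of_le (by exact_mod_cast le_top))
  map_smul' c f := iteratedFDeriv_const_smul_apply
    ((contDiff_of_mem_refSpace f.2).contDiffAt.of_le (by exact_mod_cast le_top))

/-- The derivative `∂^α` as a linear map on the reference space. -/
def mderivRef (d P : ℕ) (α : Fin d → ℕ) : refSpace d P →ₗ[ℝ] (Fin d → ℝ) → ℝ where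
  toFun f := mderiv α f.1
  map_add' f g := mderiv_add α (contDiff_of_mem_refSpace f.2) (contDiff_of_mem_refSpace g.2)
  map_smul' c f := mderiv_smul α c (contDiff_of_mem_refSpace f.2)

/-- The `L²` seminorm over the cell with index `n` on the reference space. -/
def refL2 (d P : ℕ) (n : Fin d → ℤ) : Seminorm ℝ (refSpace d P) :=
  l2Seminorm (isBounded_cell 1 n) (refSpace d P).subtype
    fun f => (contDiff_of_mem_refSpace f.2).continuous

/-- The `L²` seminorm of `∂^α f` over the reference cell. -/
def refL2Deriv (d P : ℕ) (α : Fin d → ℕ) : Seminorm ℝ (refSpace d P) :=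
  l2Seminorm (isBounded_cell 1 0) (mderivRef d P α)
    fun f => continuous_mderiv α (contDiff_of_mem_refSpace f.2)

theorem iteratedFDeriv_eq_zero_of_eqOn {f : (Fin d → ℝ) → ℝ} {U : Set (Fin d → ℝ)}
    (hU : IsOpen U) (h : EqOn f 0 U) (k : ℕ) {y : Fin d → ℝ} (hy : y ∈ U) :
    iteratedFDeriv ℝ k f y = 0 := by
  have := Filter.EventuallyEq.iteratedFDeriv ℝ (h.eventuallyEq_of_mem (hU.mem_nhds hy)) k
  rw [this.eq_of_nhds, iteratedFDeriv_zero]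
  rfl

/-- Inverse estimate by finite dimension: a function with zero L² norm on the open cell vanishes
there, hence so do its derivatives; compactness of the closed cell bounds the family of evaluations
for each f. -/
theorem exists_norm_iteratedFDeriv_ref_le (d P k : ℕ) : ∃ C : ℝ, 0 < C ∧
    ∀ f ∈ refSpace d P, ∀ y ∈ cell 1 (0 : Fin d → ℤ),
      ‖iteratedFDeriv ℝ k f y‖ ≤ C * l2norm (cell 1 0) f := by
  let p := fun y : cell 1 (0 : Fin d → ℤ) =>
    (normSeminorm ℝ (ContinuousMultilinearMap ℝ (fun _ : Fin k => (Fin d → ℝ)) ℝ)).comp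
      (iteratedFDerivRef d P k y.1)
  have hb : ∀ f, ∃ M, ∀ y, p y f ≤ M := by
    intro f
    have hc : IsCompact (closure (cell 1 (0 : Fin d → ℤ))) :=
      (isBounded_cell 1 0).isCompact_closure
    obtain ⟨M, hM⟩ := hc.exists_bound_of_continuousOn (f := iteratedFDeriv ℝ k f.1)
      ((contDiff_of_mem_refSpace f.2).continuous_iteratedFDeriv
        (m := k) (by exact_mod_cast le_top)).continuousOn
    exact ⟨M, fun y => hM y.1 (subset_closure y.2)⟩
  have hk : ∀ f, refL2 d P 0 f = 0 → ∀ y, p y f = 0 := by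
    intro f hf y
    have h0 := eqOn_zero_of_l2norm_eq_zero (isOpen_cell 1 0) (isBounded_cell 1 0)
      (contDiff_of_mem_refSpace f.2).continuous hf
    show ‖iteratedFDeriv ℝ k f.1 y‖ = 0
    rw [iteratedFDeriv_eq_zero_of_eqOn (isOpen_cell 1 0) h0 k y.2, norm_zero]
  obtain ⟨C, hC, h⟩ := exists_seminorm_family_le p (refL2 d P 0) hb hk
  exact ⟨C, hC, fun f hf y hy => h ⟨y, hy⟩ ⟨f, hf⟩⟩

/-- Leibniz's rule combined with the pointwise inverse estimate for each factor. -/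
theorem exists_abs_mderiv_mul_ref_le (d P k : ℕ) : ∃ C : ℝ, 0 < C ∧
    ∀ f ∈ refSpace d P, ∀ g ∈ refSpace d P, ∀ α ∈ multiIdxEq d k,
      ∀ y ∈ cell 1 (0 : Fin d → ℤ),
        |mderiv α (fun x => f x * g x) y| ≤ C * (l2norm (cell 1 0) f * l2norm (cell 1 0) g) := by
  choose C hC h using fun j => exists_norm_iteratedFDeriv_ref_le d P j
  refine ⟨1 + ∑ i ∈ Finset.range (k + 1), (k.choose i : ℝ) * C i * C (k - i), ?_,
    fun f hf g hg α hα y hy => ?_⟩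
  · have : 0 ≤ ∑ i ∈ Finset.range (k + 1), (k.choose i : ℝ) * C i * C (k - i) :=
      Finset.sum_nonneg fun i _ => by have := hC i; have := hC (k - i); positivity
    linarith
  have hf' := contDiff_of_mem_refSpace hf
  have hg' := contDiff_of_mem_refSpace hg
  have h1 := abs_mderiv_le α (hf'.mul hg') y
  rw [mem_multiIdxEq.1 hα] at h1
  refine h1.trans ((norm_iteratedFDeriv_mul_le hf' hg' y (n := k)
    (by exact_mod_cast le_top)).trans ?_)
  have hF := l2norm_nonneg (cell 1 0) f
  have hG := l2norm_nonneg (cell 1 0) g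
  rw [add_mul, one_mul, Finset.sum_mul]
  refine le_add_of_nonneg_of_le (mul_nonneg hF hG) (Finset.sum_le_sum fun i _ => ?_)
  calc (k.choose i : ℝ) * ‖iteratedFDeriv ℝ i f y‖ * ‖iteratedFDeriv ℝ (k - i) g y‖
      ≤ (k.choose i : ℝ) * (C i * l2norm (cell 1 0) f) * (C (k - i) * l2norm (cell 1 0) g) := by
        have := hC i
        gcongr
        · exact h i f hf y hy
        · exact h (k - i) g hg y hy
    _ = _ := by ring

/-- All derivatives of f vanish at the shared node z by continuity from the cell n. Hence the Taylor
polynomial of degree P at z is zero, and the remainder involves only derivatives of order P+1 along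
a segment in the reference cell. -/
theorem eq_zero_of_derivs_vanish {f : (Fin d → ℝ) → ℝ} (hf : ContDiff ℝ ∞ f)
    {n z : Fin d → ℤ} (hz0 : IsNodeOf z 0) (hzn : IsNodeOf z n) (hn : EqOn f 0 (cell 1 n))
    (h0 : ∀ α ∈ multiIdxEq d (P + 1), EqOn (mderiv α f) 0 (cell 1 0)) :
    EqOn f 0 (cell 1 0) := by
  intro x hx
  set w : Fin d → ℝ := fun l => (z l : ℝ) with hw
  have hd : ∀ k, iteratedFDeriv ℝ k f w = 0 := by
    intro k
    have hcont : Continuous (iteratedFDeriv ℝ k f) :=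
      hf.continuous_iteratedFDeriv (m := k) (by exact_mod_cast le_top)
    have : closure (cell 1 n) ⊆ {y | iteratedFDeriv ℝ k f y = 0} :=
      closure_minimal (fun y hy => iteratedFDeriv_eq_zero_of_eqOn (isOpen_cell 1 n) hn k hy)
        (isClosed_eq hcont continuous_const)
    exact this (node_mem_closure_cell hzn)
  have hT : taylorPoly P f w x = 0 := by
    simp [taylorPoly, hd]
  have h := sub_taylorPoly_eq_integral P hf x w
  rw [hT, sub_zero] at h
  rw [h]
  have hint : ∫ t in (0 : ℝ)..1, (1 - t) ^ P * (iteratedFDeriv ℝ (P + 1) f (w + t • (x - w))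
      fun _ => x - w) = 0 := by
    rw [intervalIntegral.integral_of_le zero_le_one]
    refine (setIntegral_congr_fun (g := fun _ => (0 : ℝ)) measurableSet_Ioc ?_).trans (by simp)
    intro t ht
    -- The node w lies only in the closure; for t > 0 convexity moves the point into the open cell.
    have hmem : w + t • (x - w) ∈ cell 1 (0 : Fin d → ℤ) := by
      have := (convex_cell 1 (0 : Fin d → ℤ)).combo_closure_interior_mem_interior
        (node_mem_closure_cell hz0) ((isOpen_cell 1 (0 : Fin d → ℤ)).interior_eq.symm ▸ hx)
        (sub_nonneg.2 ht.2) ht.1 (by ring)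
      rw [(isOpen_cell 1 (0 : Fin d → ℤ)).interior_eq] at this
      convert this using 1
      module
    have hz : iteratedFDeriv ℝ (P + 1) f (w + t • (x - w)) = 0 := by
      rw [← norm_le_zero_iff]
      refine (norm_iteratedFDeriv_le_sum (P + 1) hf _).trans ?_
      rw [Finset.sum_eq_zero, mul_zero]
      intro α hα
      rw [h0 α hα hmem]
      simp
    simp [hz]
  rw [hint]
  simp

/-- The right-hand side is a seminorm whose kernel, by `eq_zero_of_derivs_vanish`, lies in that of
the left-hand side; finite dimension does the rest. -/
theorem exists_ref_neighbor_le (d P : ℕ) {n : Fin d → ℤ} (hn : Neighbors 0 n) :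
    ∃ C : ℝ, 0 < C ∧ ∀ f ∈ refSpace d P, l2norm (cell 1 0) f ≤ C * (l2norm (cell 1 n) f +
      ∑ α ∈ multiIdxEq d (P + 1), l2norm (cell 1 0) (mderiv α f)) := by
  obtain ⟨z, hz0, hzn⟩ := hn
  let q : Seminorm ℝ (refSpace d P) :=
    refL2 d P n + ∑ α ∈ multiIdxEq d (P + 1), refL2Deriv d P α
  have hq : ∀ f, q f = l2norm (cell 1 n) f.1 +
      ∑ α ∈ multiIdxEq d (P + 1), l2norm (cell 1 0) (mderiv α f.1) := by
    intro f
    show (refL2 d P n + ∑ α ∈ multiIdxEq d (P + 1), refL2Deriv d P α) f = _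
    rw [add_apply, sum_apply]
    rfl
  have hk : ∀ f, q f = 0 → ∀ _ : Unit, refL2 d P 0 f = 0 := by
    intro f hf _
    have hfs := contDiff_of_mem_refSpace f.2
    rw [hq, add_eq_zero_iff_of_nonneg (l2norm_nonneg _ _)
      (Finset.sum_nonneg fun _ _ => l2norm_nonneg _ _),
      Finset.sum_eq_zero_iff_of_nonneg fun _ _ => l2norm_nonneg _ _] at hf
    refine l2norm_eq_zero_of_eqOn (measurableSet_cell 1 0)
      (eq_zero_of_derivs_vanish (P := P) hfs hz0 hzn ?_ fun α hα => ?_)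
    · exact eqOn_zero_of_l2norm_eq_zero (isOpen_cell 1 n) (isBounded_cell 1 n) hfs.continuous hf.1
    · exact eqOn_zero_of_l2norm_eq_zero (isOpen_cell 1 0) (isBounded_cell 1 0)
        (continuous_mderiv α hfs) (hf.2 α hα)
  obtain ⟨C, hC, h⟩ := exists_seminorm_family_le (fun _ : Unit => refL2 d P 0) q
    (fun f => ⟨_, fun _ => le_rfl⟩) hk
  refine ⟨C, hC, fun f hf => ?_⟩
  rw [← hq ⟨f, hf⟩]
  exact h () ⟨f, hf⟩

end Reference

/-! ### Local estimates on the cells of the grid -/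

section Scaling

variable {d P : ℕ}

theorem gridPt_add_smul_mem_cell {σ : ℝ} (hσ : 0 < σ) (i n : Fin d → ℤ) (y : Fin d → ℝ) :
    gridPt σ i + σ • y ∈ cell σ (i + n) ↔ y ∈ cell 1 n := by
  simp only [cell, mem_ofPred_eq, gridPt, Pi.add_apply, Pi.smul_apply, smul_eq_mul, mem_Ioo,
    Int.cast_add, mul_one]
  refine forall_congr' fun l => and_congr ?_ ?_
  · rw [add_mul, add_lt_add_iff_left, mul_comm σ, mul_lt_mul_iff_left₀ hσ]
  · rw [add_assoc, add_mul, add_lt_add_iff_left, mul_comm σ, mul_lt_mul_iff_left₀ hσ]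

theorem integral_affine {σ : ℝ} (hσ : 0 < σ) (a : Fin d → ℝ) {S T : Set (Fin d → ℝ)}
    (hS : MeasurableSet S) (hT : MeasurableSet T) (h : ∀ y, a + σ • y ∈ S ↔ y ∈ T)
    (F : (Fin d → ℝ) → ℝ) :
    ∫ x in S, F x = σ ^ d * ∫ y in T, F (a + σ • y) := by
  rw [← integral_indicator hS, ← integral_indicator hT]
  have h1 : T.indicator (fun y => F (a + σ • y)) = fun y => S.indicator F (a + σ • y) := by
    funext y
    by_cases hy : y ∈ T
    · rw [indicator_of_mem hy, indicator_of_mem ((h y).2 hy)]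
    · rw [indicator_of_notMem hy, indicator_of_notMem (mt (h y).1 hy)]
  rw [h1]
  have h2 := Measure.integral_comp_smul (volume : Measure (Fin d → ℝ))
    (fun y => S.indicator F (a + y)) σ
  rw [h2, integral_add_left_eq_self (S.indicator F) a]
  rw [Module.finrank_fin_fun, abs_of_pos (by positivity), smul_eq_mul, mul_inv_cancel_left₀]
  positivity

theorem l2norm_eq_sqrt {S : Set (Fin d → ℝ)} {f : (Fin d → ℝ) → ℝ}
    (hf : MemLp f 2 (volume.restrict S)) : l2norm S f = √(∫ x in S, f x ^ 2) := by
  rw [← l2norm_sq hf, Real.sqrt_sq (l2norm_nonneg _ _)]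

theorem l2norm_affine {σ : ℝ} (hσ : 0 < σ) (a : Fin d → ℝ) {S T : Set (Fin d → ℝ)}
    (hS : MeasurableSet S) (hT : MeasurableSet T) (hSb : Bornology.IsBounded S)
    (hTb : Bornology.IsBounded T) (h : ∀ y, a + σ • y ∈ S ↔ y ∈ T)
    {v f : (Fin d → ℝ) → ℝ} (hv : Continuous v) (hf : Continuous f)
    (hvf : ∀ y ∈ T, v (a + σ • y) = f y) : l2norm S v = √(σ ^ d) * l2norm T f := by
  rw [l2norm_eq_sqrt (memLp_of_continuous_of_isBounded hSb hv 2),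
    l2norm_eq_sqrt (memLp_of_continuous_of_isBounded hTb hf 2), ← Real.sqrt_mul (by positivity),
    integral_affine hσ a hS hT h]
  congr 2
  exact setIntegral_congr_fun hT fun y hy => by simp only [hvf y hy]

theorem l2norm_cell_affine {σ : ℝ} (hσ : 0 < σ) (i n : Fin d → ℤ)
    {v f : (Fin d → ℝ) → ℝ} (hv : Continuous v) (hf : Continuous f)
    (hvf : ∀ y ∈ cell 1 n, v (gridPt σ i + σ • y) = f y) :
    l2norm (cell σ (i + n)) v = √(σ ^ d) * l2norm (cell 1 n) f :=
  l2norm_affine hσ _ (measurableSet_cell _ _) (measurableSet_cell _ _) (isBounded_cell _ _)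
    (isBounded_cell _ _) (gridPt_add_smul_mem_cell hσ i n) hv hf hvf

theorem exists_refSpace_eqOn_cell {σ : ℝ} (hσ : 0 < σ) {v : (Fin d → ℝ) → ℝ}
    (hv : v ∈ pufemAll d σ P) (i : Fin d → ℤ) :
    ∃ f ∈ refSpace d P, ∀ n : Fin d → ℤ, (∀ l, n l ∈ Icc (-1) 1) →
      ∀ y ∈ cell 1 n, v (gridPt σ i + σ • y) = f y := by
  obtain ⟨f, hf, h⟩ := exists_refSpace_eq hσ hv i
  refine ⟨f, hf, fun n hn y hy => h y fun l => ?_⟩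
  have h1 := hy l
  simp only [mul_one] at h1
  have h2 : (-1 : ℝ) ≤ n l := by exact_mod_cast (hn l).1
  have h3 : (n l : ℝ) ≤ 1 := by exact_mod_cast (hn l).2
  exact ⟨by linarith [h1.1], by linarith [h1.2]⟩

/-- Differentiation is local, so agreement of the rescaled functions on an open set is enough. -/
theorem mderiv_affine_eqOn {σ : ℝ} {v f : (Fin d → ℝ) → ℝ} (hv : ContDiff ℝ ∞ v)
    {a : Fin d → ℝ} {U : Set (Fin d → ℝ)} (hU : IsOpen U)
    (h : ∀ y ∈ U, v (a + σ • y) = f y) {k : ℕ} {α : Fin d → ℕ}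
    (hα : α ∈ multiIdxEq d k) {y : Fin d → ℝ} (hy : y ∈ U) :
    σ ^ k * mderiv α v (a + σ • y) = mderiv α f y := by
  rw [← mderiv_eqOn α hU (f := fun y => v (a + σ • y)) h hy, mderiv_comp_affine _ _ _ hv,
    mem_multiIdxEq.1 hα]

theorem zero_mem_unitRange : ∀ l : Fin d, (0 : Fin d → ℤ) l ∈ Icc (-1) 1 := fun l => by simp

theorem l2norm_mderiv_cell {σ : ℝ} (hσ : 0 < σ) (i : Fin d → ℤ) {v f : (Fin d → ℝ) → ℝ}
    (hv : ContDiff ℝ ∞ v) (hf : ContDiff ℝ ∞ f)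
    (hvf : ∀ y ∈ cell 1 0, v (gridPt σ i + σ • y) = f y) {k : ℕ} {α : Fin d → ℕ}
    (hα : α ∈ multiIdxEq d k) :
    σ ^ k * l2norm (cell σ i) (mderiv α v) = √(σ ^ d) * l2norm (cell 1 0) (mderiv α f) := by
  have h := l2norm_cell_affine hσ i 0 (v := σ ^ k • mderiv α v) (f := mderiv α f)
    ((continuous_mderiv α hv).const_smul _) (continuous_mderiv α hf) fun y hy => by
      rw [Pi.smul_apply, smul_eq_mul, mderiv_affine_eqOn hv (isOpen_cell 1 0) hvf hα hy]
  rw [l2norm_smul, add_zero, abs_of_pos (by positivity)] at h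
  exact h

theorem l2norm_le_of_abs_le {S : Set (Fin d → ℝ)}
    (hb : Bornology.IsBounded S) {f : (Fin d → ℝ) → ℝ} (hf : Continuous f) {M : ℝ}
    (hM : 0 ≤ M) (h : ∀ x ∈ S, |f x| ≤ M) : l2norm S f ≤ √(volume.real S) * M := by
  rw [l2norm_eq_sqrt (memLp_of_continuous_of_isBounded hb hf 2)]
  have h1 : ∫ x in S, f x ^ 2 ≤ M ^ 2 * volume.real S := by
    refine (le_abs_self _).trans ?_
    rw [← Real.norm_eq_abs]
    refine norm_setIntegral_le_of_norm_le_const hb.measure_lt_top fun x hx => ?_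
    rw [norm_pow]
    exact pow_le_pow_left₀ (norm_nonneg _) (h x hx) 2
  calc √(∫ x in S, f x ^ 2) ≤ √(M ^ 2 * volume.real S) := Real.sqrt_le_sqrt h1
    _ = _ := by rw [mul_comm, Real.sqrt_mul measureReal_nonneg, Real.sqrt_sq hM]

/-- Inverse inequality on a cell. -/
theorem exists_l2norm_mderiv_le (d P k : ℕ) : ∃ C : ℝ, 0 < C ∧
    ∀ σ : ℝ, 0 < σ → ∀ v ∈ pufemAll d σ P, ∀ (i : Fin d → ℤ), ∀ α ∈ multiIdxEq d k,
      σ ^ k * l2norm (cell σ i) (mderiv α v) ≤ C * l2norm (cell σ i) v := by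
  obtain ⟨C, hC, h⟩ := exists_norm_iteratedFDeriv_ref_le d P k
  refine ⟨(√(volume.real (cell 1 (0 : Fin d → ℤ))) + 1) * C, by positivity,
    fun σ hσ v hv i α hα => ?_⟩
  obtain ⟨f, hf, hvf⟩ := exists_refSpace_eqOn_cell hσ hv i
  have hfs := contDiff_of_mem_refSpace hf
  have hvs := contDiff_of_mem_pufemAll hσ hv
  rw [l2norm_mderiv_cell hσ i hvs hfs (hvf 0 zero_mem_unitRange) hα]
  have h2 := l2norm_cell_affine hσ i 0 hvs.continuous hfs.continuous (hvf 0 zero_mem_unitRange)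
  rw [add_zero] at h2
  rw [h2]
  have h3 : l2norm (cell 1 0) (mderiv α f) ≤
      √(volume.real (cell 1 (0 : Fin d → ℤ))) * (C * l2norm (cell 1 0) f) := by
    refine l2norm_le_of_abs_le (isBounded_cell 1 0)
      (continuous_mderiv α hfs) (mul_nonneg hC.le (l2norm_nonneg _ _)) fun y hy => ?_
    refine (abs_mderiv_le α hfs y).trans ?_
    rw [mem_multiIdxEq.1 hα]
    exact h f hf y hy
  have h4 := l2norm_nonneg (cell 1 (0 : Fin d → ℤ)) f
  calc √(σ ^ d) * l2norm (cell 1 0) (mderiv α f)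
      ≤ √(σ ^ d) * (√(volume.real (cell 1 (0 : Fin d → ℤ))) * (C * l2norm (cell 1 0) f)) := by
        gcongr
    _ ≤ √(σ ^ d) * ((√(volume.real (cell 1 (0 : Fin d → ℤ))) + 1) *
          (C * l2norm (cell 1 0) f)) := by
        gcongr; linarith
    _ = _ := by ring

/-- Inverse inequality for products on a cell. -/
theorem exists_integral_abs_mderiv_mul_le (d P k : ℕ) : ∃ C : ℝ, 0 < C ∧
    ∀ σ : ℝ, 0 < σ → ∀ v ∈ pufemAll d σ P, ∀ w ∈ pufemAll d σ P, ∀ (i : Fin d → ℤ),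
      ∀ α ∈ multiIdxEq d k, σ ^ k * ∫ x in cell σ i, |mderiv α (fun x => v x * w x) x| ≤
        C * (l2norm (cell σ i) v * l2norm (cell σ i) w) := by
  obtain ⟨C, hC, h⟩ := exists_abs_mderiv_mul_ref_le d P k
  refine ⟨C * (volume.real (cell 1 (0 : Fin d → ℤ)) + 1), by positivity,
    fun σ hσ v hv w hw i α hα => ?_⟩
  obtain ⟨f, hf, hvf⟩ := exists_refSpace_eqOn_cell hσ hv i
  obtain ⟨g, hg, hwg⟩ := exists_refSpace_eqOn_cell hσ hw i
  have hfs := contDiff_of_mem_refSpace hf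
  have hgs := contDiff_of_mem_refSpace hg
  have hvs := contDiff_of_mem_pufemAll hσ hv
  have hws := contDiff_of_mem_pufemAll hσ hw
  have hv2 := l2norm_cell_affine hσ i 0 hvs.continuous hfs.continuous (hvf 0 zero_mem_unitRange)
  have hw2 := l2norm_cell_affine hσ i 0 hws.continuous hgs.continuous (hwg 0 zero_mem_unitRange)
  rw [add_zero] at hv2 hw2
  rw [hv2, hw2, integral_affine hσ (gridPt σ i) (measurableSet_cell σ i) (measurableSet_cell 1 0)
    (fun y => by rw [← gridPt_add_smul_mem_cell hσ i 0 y, add_zero]), mul_left_comm,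
    ← integral_const_mul]
  have h1 : ∫ y in cell 1 (0 : Fin d → ℤ),
      σ ^ k * |mderiv α (fun x => v x * w x) (gridPt σ i + σ • y)| ≤
        C * (l2norm (cell 1 0) f * l2norm (cell 1 0) g) * volume.real (cell 1 (0 : Fin d → ℤ)) := by
    refine (le_abs_self _).trans ?_
    rw [← Real.norm_eq_abs]
    refine norm_setIntegral_le_of_norm_le_const (isBounded_cell 1 0).measure_lt_top fun y hy => ?_
    have h2 := mderiv_affine_eqOn (σ := σ) (f := fun x => f x * g x) (hvs.mul hws)
      (isOpen_cell 1 0) (a := gridPt σ i)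
      (fun y hy => by rw [hvf 0 zero_mem_unitRange y hy, hwg 0 zero_mem_unitRange y hy]) hα hy
    rw [Real.norm_eq_abs, abs_mul, abs_abs, ← abs_mul, h2]
    exact h f hf g hg α hα y hy
  have hF := l2norm_nonneg (cell 1 (0 : Fin d → ℤ)) f
  have hG := l2norm_nonneg (cell 1 (0 : Fin d → ℤ)) g
  have hs : √(σ ^ d) * √(σ ^ d) = σ ^ d := Real.mul_self_sqrt (by positivity)
  calc σ ^ d * _ ≤ σ ^ d * (C * (l2norm (cell 1 0) f * l2norm (cell 1 0) g) *
        volume.real (cell 1 (0 : Fin d → ℤ))) := by gcongr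
    _ ≤ σ ^ d * (C * (l2norm (cell 1 0) f * l2norm (cell 1 0) g) *
        (volume.real (cell 1 (0 : Fin d → ℤ)) + 1)) := by gcongr; linarith
    _ = (√(σ ^ d) * √(σ ^ d)) * (C * (l2norm (cell 1 0) f * l2norm (cell 1 0) g) *
        (volume.real (cell 1 (0 : Fin d → ℤ)) + 1)) := by rw [hs]
    _ = _ := by ring

theorem sub_mem_of_neighbors {i i' : Fin d → ℤ} (h : Neighbors i i') :
    ∀ l, (i' - i) l ∈ Icc (-1) 1 := by
  obtain ⟨n, h1, h2⟩ := h
  intro l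
  have := h1 l
  have := h2 l
  simp only [Pi.sub_apply, mem_Icc]
  omega

theorem neighbors_zero_sub {i i' : Fin d → ℤ} (h : Neighbors i i') : Neighbors 0 (i' - i) := by
  obtain ⟨n, h1, h2⟩ := h
  refine ⟨n - i, fun l => ?_, fun l => ?_⟩
  · have := h1 l
    simp only [Pi.sub_apply, Pi.zero_apply]
    omega
  · have := h2 l
    simp only [Pi.sub_apply]
    omega

/-- The norm on a cell is controlled by the norm on a neighbour and the derivatives of order
`P + 1`. -/
theorem exists_l2norm_neighbor_le (d P : ℕ) : ∃ C : ℝ, 0 < C ∧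
    ∀ σ : ℝ, 0 < σ → ∀ v ∈ pufemAll d σ P, ∀ i i' : Fin d → ℤ, Neighbors i i' →
      l2norm (cell σ i) v ≤ C * (l2norm (cell σ i') v +
        ∑ α ∈ multiIdxEq d (P + 1), σ ^ (P + 1) * l2norm (cell σ i) (mderiv α v)) := by
  classical
  -- The constant 1 at offsets that are no neighbours is a dummy, which makes the choice total.
  have hex : ∀ n : Fin d → ℤ, ∃ C : ℝ, 0 < C ∧ (Neighbors 0 n → ∀ f ∈ refSpace d P,
      l2norm (cell 1 0) f ≤ C * (l2norm (cell 1 n) f +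
      ∑ α ∈ multiIdxEq d (P + 1), l2norm (cell 1 0) (mderiv α f))) := by
    intro n
    by_cases hn : Neighbors 0 n
    · obtain ⟨C, hC, h⟩ := exists_ref_neighbor_le d P hn
      exact ⟨C, hC, fun _ => h⟩
    · exact ⟨1, one_pos, fun h => absurd h hn⟩
  choose c hc h using hex
  let B : Finset (Fin d → ℤ) := Fintype.piFinset fun _ => Finset.Icc (-1) 1
  -- Only the finitely many offsets in [-1,1]^d occur, and the sum dominates each of their
  -- constants.
  refine ⟨∑ n ∈ B, c n, Finset.sum_pos (fun n _ => hc n) ⟨0, by simp [B]⟩,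
    fun σ hσ v hv i i' hi => ?_⟩
  obtain ⟨f, hf, hvf⟩ := exists_refSpace_eqOn_cell hσ hv i
  have hfs := contDiff_of_mem_refSpace hf
  have hvs := contDiff_of_mem_pufemAll hσ hv
  have hn := sub_mem_of_neighbors hi
  have h0 := l2norm_cell_affine hσ i 0 hvs.continuous hfs.continuous (hvf 0 zero_mem_unitRange)
  have h1 := l2norm_cell_affine hσ i (i' - i) hvs.continuous hfs.continuous (hvf _ hn)
  rw [add_zero] at h0
  rw [add_sub_cancel] at h1
  have h2 : ∀ α ∈ multiIdxEq d (P + 1), σ ^ (P + 1) * l2norm (cell σ i) (mderiv α v) =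
      √(σ ^ d) * l2norm (cell 1 0) (mderiv α f) := fun α hα =>
    l2norm_mderiv_cell hσ i hvs hfs (hvf 0 zero_mem_unitRange) hα
  rw [Finset.sum_congr rfl h2, h0, h1, ← Finset.mul_sum, ← mul_add, mul_left_comm]
  refine mul_le_mul_of_nonneg_left ?_ (Real.sqrt_nonneg _)
  refine (h _ (neighbors_zero_sub hi) f hf).trans (mul_le_mul_of_nonneg_right ?_ ?_)
  · exact Finset.single_le_sum (f := c) (fun n _ => (hc n).le)
      (by simpa [B, Fintype.mem_piFinset] using hn)
  · exact add_nonneg (l2norm_nonneg _ _) (Finset.sum_nonneg fun _ _ => l2norm_nonneg _ _)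

end Scaling

/-! ### Smooth functions as elements of Sobolev spaces -/

section SmoothSobolev

variable {d k : ℕ} {Ω : Set (Fin d → ℝ)}

theorem integral_mul_listDeriv (L : List (Fin d)) {f φ : (Fin d → ℝ) → ℝ}
    (hf : ContDiff ℝ ∞ f) (hφ : ContDiff ℝ ∞ φ) (hc : HasCompactSupport φ) :
    ∫ x, f x * listDeriv L φ x = (-1) ^ L.length * ∫ x, listDeriv L f x * φ x := by
  induction L generalizing f with
  | nil => simp
  | cons l L ih =>
    have hg : ContDiff ℝ ∞ (listDeriv L φ) := contDiff_listDeriv L hφ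
    have hgc : HasCompactSupport (listDeriv L φ) := by
      clear ih hg
      induction L with
      | nil => exact hc
      | cons l L ih => exact ih.fderiv_apply ℝ _
    have hfl := contDiff_pderiv l hf
    have hgl := contDiff_pderiv l hg
    have hglc : HasCompactSupport (pderiv l (listDeriv L φ)) := hgc.fderiv_apply ℝ _
    have h1 := integral_mul_fderiv_eq_neg_fderiv_mul_of_integrable (μ := volume)
      (f := f) (g := listDeriv L φ) (v := Pi.single l 1)
      ((hfl.continuous.mul hg.continuous).integrable_of_hasCompactSupport hgc.mul_left)
      ((hf.continuous.mul hgl.continuous).integrable_of_hasCompactSupport hglc.mul_left)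
      ((hf.continuous.mul hg.continuous).integrable_of_hasCompactSupport hgc.mul_left)
      (fun x _ => hf.differentiable (by simp) x) (fun x _ => hg.differentiable (by simp) x)
    have h2 := ih hfl
    -- Integration by parts removes the outermost derivative of φ first, and it becomes the
    -- innermost one on f; commutativity restores the order.
    have h3 : listDeriv L (pderiv l f) = listDeriv (l :: L) f := by
      have : listDeriv L (pderiv l f) = listDeriv (L ++ [l]) f := by rw [listDeriv_append]; rfl
      rw [this]
      exact listDeriv_perm (List.perm_append_singleton l L) hf
    rw [h3] at h2
    simp only [listDeriv_cons]
    rw [listDeriv_cons] at h2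
    calc ∫ x, f x * pderiv l (listDeriv L φ) x = -∫ x, pderiv l f x * listDeriv L φ x := h1
      _ = _ := by rw [h2, List.length_cons, pow_succ]; ring

theorem mderiv_eq_zero_of_notMem_tsupport (α : Fin d → ℕ) {φ : (Fin d → ℝ) → ℝ}
    {x : Fin d → ℝ} (hx : x ∉ tsupport φ) : mderiv α φ x = 0 := by
  have h : φ =ᶠ[nhds x] 0 := notMem_tsupport_iff_eventuallyEq.1 hx
  rw [mderiv_eq_listDeriv, (listDeriv_eventuallyEq _ h).eq_of_nhds, listDeriv_zero]
  rfl

/-- The test function is supported inside Ω, so both integrals extend to the whole space and no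
boundary terms arise. -/
theorem setIntegral_mul_mderiv (α : Fin d → ℕ) {f φ : (Fin d → ℝ) → ℝ}
    (hf : ContDiff ℝ ∞ f) (hφ : IsTest Ω φ) :
    ∫ x in Ω, f x * mderiv α φ x = (-1) ^ (∑ l, α l) * ∫ x in Ω, mderiv α f x * φ x := by
  rw [setIntegral_eq_integral_of_forall_compl_eq_zero,
    setIntegral_eq_integral_of_forall_compl_eq_zero, mderiv_eq_listDeriv, mderiv_eq_listDeriv,
    integral_mul_listDeriv _ hf hφ.1 hφ.2.1, length_multiIdxList]
  · intro x hx
    rw [image_eq_zero_of_notMem_tsupport fun h => hx (hφ.2.2 h), mul_zero]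
  · intro x hx
    rw [mderiv_eq_zero_of_notMem_tsupport α fun h => hx (hφ.2.2 h), mul_zero]

theorem mderiv_zero (f : (Fin d → ℝ) → ℝ) : mderiv (0 : Fin d → ℕ) f = f := by
  rw [mderiv_eq_listDeriv]
  have : multiIdxList (0 : Fin d → ℕ) = [] :=
    List.eq_nil_of_length_eq_zero (by rw [length_multiIdxList]; simp)
  rw [this]; rfl

theorem exists_sobolev_of_contDiff {p : ℝ≥0∞} [Fact (1 ≤ p)] (k : ℕ)
    (hb : Bornology.IsBounded Ω) {f : (Fin d → ℝ) → ℝ} (hf : ContDiff ℝ ∞ f) :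
    ∃ w : Sobolev k p Ω, ∀ α : multiIdxLE d k, w.1 α =ᵐ[volume.restrict Ω] mderiv α.1 f := by
  have hm : ∀ α : Fin d → ℕ, MemLp (mderiv α f) p (volume.restrict Ω) := fun α =>
    memLp_of_continuous_of_isBounded hb (continuous_mderiv α hf) p
  refine ⟨⟨WithLp.toLp p fun α : multiIdxLE d k => (hm α.1).toLp _, fun α φ hφ => ?_⟩,
    fun α => (hm α.1).coeFn_toLp⟩
  have h1 : ∫ x in Ω, (hm 0).toLp _ x * mderiv α.1 φ x = ∫ x in Ω, f x * mderiv α.1 φ x := by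
    refine integral_congr_ae ?_
    filter_upwards [(hm 0).coeFn_toLp] with x hx
    rw [hx, mderiv_zero]
  have h2 : ∫ x in Ω, (hm α.1).toLp _ x * φ x = ∫ x in Ω, mderiv α.1 f x * φ x := by
    refine integral_congr_ae ?_
    filter_upwards [(hm α.1).coeFn_toLp] with x hx
    rw [hx]
  show ∫ x in Ω, (hm 0).toLp _ x * mderiv α.1 φ x =
    (-1) ^ (∑ l, α.1 l) * ∫ x in Ω, (hm α.1).toLp _ x * φ x
  rw [h1, h2, setIntegral_mul_mderiv _ hf hφ]

/-- Fundamental lemma of the calculus of variations, applied to g - g'. -/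
theorem weakDeriv_unique {p : ℝ≥0∞} [hp : Fact (1 ≤ p)] (hΩ : IsOpen Ω) {α : Fin d → ℕ}
    {f g g' : LpOn p Ω} (h : IsWeakDeriv Ω α f g) (h' : IsWeakDeriv Ω α f g') : g = g' := by
  refine Lp.ext ?_
  have hloc : LocallyIntegrableOn (fun x => g x - g' x) Ω volume :=
    locallyIntegrableOn_of_locallyIntegrable_restrict
      (((Lp.memLp g).sub (Lp.memLp g')).locallyIntegrable hp.out)
  have h0 := hΩ.ae_eq_zero_of_integral_contDiff_smul_eq_zero hloc fun φ hφ hc hs => by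
    have ht : IsTest Ω φ := ⟨hφ, hc, hs⟩
    rw [← setIntegral_eq_integral_of_forall_compl_eq_zero (s := Ω)]
    · have hi := integrable_mul_test g (φ := φ) ⟨hφ, hc⟩
      have hi' := integrable_mul_test g' (φ := φ) ⟨hφ, hc⟩
      have h1 : ∫ x in Ω, φ x • (g x - g' x) = (∫ x in Ω, g x * φ x) - ∫ x in Ω, g' x * φ x := by
        rw [← integral_sub hi hi']
        refine integral_congr_ae (Filter.Eventually.of_forall fun x => ?_)
        simp only [smul_eq_mul]; ring
      have h2 := h φ ht
      rw [h' φ ht] at h2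
      have h3 : ((-1 : ℝ) ^ (∑ l, α l)) ≠ 0 := pow_ne_zero _ (by norm_num)
      rw [h1, mul_left_cancel₀ h3 h2, sub_self]
    · intro x hx
      rw [image_eq_zero_of_notMem_tsupport fun h => hx (hs h), zero_smul]
  filter_upwards [(ae_restrict_iff' hΩ.measurableSet).2 h0] with x hx
  exact sub_eq_zero.1 hx

/-- An element is a whole family of weak derivatives, but uniqueness determines the family from its
zeroth member. Hence `sobolevOf` is linear on smooth functions and its components are classical
derivatives. -/
theorem sobolev_ext {p : ℝ≥0∞} [hp : Fact (1 ≤ p)] (hΩ : IsOpen Ω) {w w' : Sobolev k p Ω}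
    (h : toFn w =ᵐ[volume.restrict Ω] toFn w') : w = w' := by
  have h0 : w.1 ⟨0, zero_mem_multiIdxLE d k⟩ = w'.1 ⟨0, zero_mem_multiIdxLE d k⟩ := Lp.ext h
  refine Subtype.ext (PiLp.ext fun α => ?_)
  have h1 := w.2 α
  rw [h0] at h1
  exact weakDeriv_unique hΩ h1 (w'.2 α)

theorem sobolev_coe_ae_eq_mderiv {p : ℝ≥0∞} [hp : Fact (1 ≤ p)] (hΩ : IsOpen Ω)
    (hb : Bornology.IsBounded Ω) {f : (Fin d → ℝ) → ℝ} (hf : ContDiff ℝ ∞ f)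
    {w : Sobolev k p Ω} (h : toFn w =ᵐ[volume.restrict Ω] f) (α : multiIdxLE d k) :
    w.1 α =ᵐ[volume.restrict Ω] mderiv α.1 f := by
  obtain ⟨w', hw'⟩ := exists_sobolev_of_contDiff (p := p) k hb hf
  have h0 := hw' ⟨0, zero_mem_multiIdxLE d k⟩
  rw [mderiv_zero] at h0
  rw [sobolev_ext hΩ (h.trans h0.symm : toFn w =ᵐ[volume.restrict Ω] toFn w')]
  exact hw' α

/-- Rules out the default value 0 of `sobolevOf` for smooth functions on bounded sets. -/
theorem toFn_sobolevOf {p : ℝ≥0∞} [hp : Fact (1 ≤ p)] (k : ℕ) (hb : Bornology.IsBounded Ω)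
    {f : (Fin d → ℝ) → ℝ} (hf : ContDiff ℝ ∞ f) :
    toFn (sobolevOf k p Ω f) =ᵐ[volume.restrict Ω] f := by
  have hex : ∃ w : Sobolev k p Ω, toFn w =ᵐ[volume.restrict Ω] f := by
    obtain ⟨w, hw⟩ := exists_sobolev_of_contDiff (p := p) k hb hf
    have h0 := hw ⟨0, zero_mem_multiIdxLE d k⟩
    rw [mderiv_zero] at h0
    exact ⟨w, h0⟩
  unfold sobolevOf
  rw [dif_pos hex]
  exact hex.choose_spec

theorem toFn_add {p : ℝ≥0∞} [Fact (1 ≤ p)] (w w' : Sobolev k p Ω) :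
    toFn (w + w') = toFn w + toFn w' := map_add (toLpL k p Ω) w w'

theorem toFn_smul {p : ℝ≥0∞} [Fact (1 ≤ p)] (c : ℝ) (w : Sobolev k p Ω) :
    toFn (c • w) = c • toFn w := map_smul (toLpL k p Ω) c w

theorem sobolevOf_add {p : ℝ≥0∞} [hp : Fact (1 ≤ p)] (k : ℕ) (hΩ : IsOpen Ω)
    (hb : Bornology.IsBounded Ω) {f g : (Fin d → ℝ) → ℝ} (hf : ContDiff ℝ ∞ f)
    (hg : ContDiff ℝ ∞ g) :
    sobolevOf k p Ω (f + g) = sobolevOf k p Ω f + sobolevOf k p Ω g := by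
  refine sobolev_ext hΩ ((toFn_sobolevOf k hb (hf.add hg)).trans ?_)
  rw [toFn_add]
  filter_upwards [toFn_sobolevOf (p := p) k hb hf, toFn_sobolevOf (p := p) k hb hg,
    Lp.coeFn_add (toFn (sobolevOf k p Ω f)) (toFn (sobolevOf k p Ω g))] with x h1 h2 h3
  rw [h3, Pi.add_apply, h1, h2]

theorem sobolevOf_smul {p : ℝ≥0∞} [hp : Fact (1 ≤ p)] (k : ℕ) (hΩ : IsOpen Ω)
    (hb : Bornology.IsBounded Ω) (c : ℝ) {f : (Fin d → ℝ) → ℝ} (hf : ContDiff ℝ ∞ f) :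
    sobolevOf k p Ω (c • f) = c • sobolevOf k p Ω f := by
  have hcf : ContDiff ℝ ∞ (c • f) := contDiff_const.mul hf
  refine sobolev_ext hΩ ((toFn_sobolevOf k hb hcf).trans ?_)
  rw [toFn_smul]
  filter_upwards [toFn_sobolevOf (p := p) k hb hf,
    Lp.coeFn_smul c (toFn (sobolevOf k p Ω f))] with x h1 h3
  rw [h3, Pi.smul_apply, Pi.smul_apply, h1]

theorem sobolevSeminorm_eq (hΩ : IsOpen Ω) (hb : Bornology.IsBounded Ω)
    {f : (Fin d → ℝ) → ℝ} (hf : ContDiff ℝ ∞ f) {w : Sobolev k 1 Ω}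
    (h : toFn w =ᵐ[volume.restrict Ω] f) :
    sobolevSeminorm w = ∑ α ∈ multiIdxEq d k, ∫ x in Ω, |mderiv α f x| := by
  unfold sobolevSeminorm
  rw [PiLp.norm_eq_of_L1, ← Finset.sum_coe_sort (multiIdxEq d k)]
  refine Finset.sum_congr rfl fun α _ => ?_
  rw [L1.norm_eq_integral_norm]
  refine integral_congr_ae ?_
  filter_upwards [sobolev_coe_ae_eq_mderiv hΩ hb hf h ⟨α.1, multiIdxEq_subset_LE α.2⟩] with x hx
  rw [← Real.norm_eq_abs, ← hx]

theorem norm_eq_l2norm {g : LpOn 2 Ω} {f : (Fin d → ℝ) → ℝ}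
    (h : g =ᵐ[volume.restrict Ω] f) : ‖g‖ = l2norm Ω f := by
  rw [Lp.norm_def, eLpNorm_congr_ae h]; rfl

theorem norm_sobolevOf_le (k : ℕ) (hΩ : IsOpen Ω) (hb : Bornology.IsBounded Ω)
    {f : (Fin d → ℝ) → ℝ} (hf : ContDiff ℝ ∞ f) :
    ‖sobolevOf k 2 Ω f‖ ≤ ∑ α ∈ multiIdxLE d k, l2norm Ω (mderiv α f) := by
  have h := fun α => norm_eq_l2norm
    (sobolev_coe_ae_eq_mderiv hΩ hb hf (toFn_sobolevOf (p := 2) k hb hf) α)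
  rw [Submodule.coe_norm, PiLp.norm_eq_of_L2, ← Finset.sum_coe_sort (multiIdxLE d k)]
  refine (Real.sqrt_le_left (Finset.sum_nonneg fun _ _ => l2norm_nonneg _ _)).2 ?_
  simp only [h]
  rw [sq (∑ α : multiIdxLE d k, _), Finset.sum_mul]
  refine Finset.sum_le_sum fun α _ => ?_
  rw [sq]
  exact mul_le_mul_of_nonneg_left (Finset.single_le_sum
    (f := fun α : multiIdxLE d k => l2norm Ω (mderiv α.1 f)) (fun _ _ => l2norm_nonneg _ _)
    (Finset.mem_univ α)) (l2norm_nonneg _ _)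

theorem norm_sobolev_coe_le (w : Sobolev k 2 Ω) (α : multiIdxLE d k) : ‖w.1 α‖ ≤ ‖w‖ :=
  PiLp.norm_apply_le w.1 α

theorem norm_lower_le {j : ℕ} (h : j ≤ k) (w : Sobolev k 2 Ω) : ‖lower h w‖ ≤ ‖w‖ := by
  rw [Submodule.coe_norm, Submodule.coe_norm, PiLp.norm_eq_of_L2, PiLp.norm_eq_of_L2]
  refine Real.sqrt_le_sqrt ?_
  -- Extension by zero to all multi-indices, so that sums over two different subtypes become
  -- comparable.
  let F : (Fin d → ℕ) → ℝ := fun α =>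
    if hα : α ∈ multiIdxLE d k then ‖w.1 ⟨α, hα⟩‖ ^ 2 else 0
  have h1 : ∀ α : multiIdxLE d k, ‖w.1 α‖ ^ 2 = F α.1 := fun α => by simp [F, α.2]
  have h2 : ∀ α : multiIdxLE d j, ‖(lower h w).1 α‖ ^ 2 = F α.1 := fun α => by
    simp only [F, dif_pos (multiIdxLE_mono h α.2)]
    rfl
  simp only [h1, h2]
  rw [Finset.sum_coe_sort (multiIdxLE d j) F, Finset.sum_coe_sort (multiIdxLE d k) F]
  refine Finset.sum_le_sum_of_subset_of_nonneg (fun α hα => multiIdxLE_mono h hα) fun α _ _ => ?_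
  simp only [F]
  split_ifs
  positivity

end SmoothSobolev

/-! ### The grid and the discrete norm -/

section Grid

variable {d P : ℕ} {Ω : Set (Fin d → ℝ)} {σ : ℝ}

theorem finite_activeCells (hb : Bornology.IsBounded Ω) (hσ : 0 < σ) :
    (activeCells Ω σ).Finite := by
  obtain ⟨R, hR⟩ := hb.subset_closedBall 0
  let N : ℤ := ⌈R / σ⌉
  refine (Fintype.piFinset fun _ : Fin d => Finset.Icc (-N - 1) N).finite_toSet.subset ?_
  intro i hi
  obtain ⟨x, hx, hxΩ⟩ := nonempty_of_measure_ne_zero (ne_of_gt hi)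
  rw [Finset.mem_coe, Fintype.mem_piFinset]
  intro l
  have h1 : |x l| ≤ R := by
    have := hR hxΩ
    rw [mem_closedBall_zero_iff] at this
    exact (norm_le_pi_norm x l).trans this
  have h2 := abs_le.1 h1
  have h3 := hx l
  have hN : R ≤ N * σ := by
    have := Int.le_ceil (R / σ)
    rwa [div_le_iff₀ hσ] at this
  rw [Finset.mem_Icc]
  constructor
  · have : (-N - 1 : ℝ) < i l + 1 := by
      by_contra h
      have := mul_le_mul_of_nonneg_right (not_lt.1 h) hσ.le
      nlinarith [h3.1, h3.2, h2.1]
    have : -N - 1 < i l + 1 := by exact_mod_cast this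
    omega
  · have : (i l : ℝ) < N + 1 := by
      by_contra h
      have := mul_le_mul_of_nonneg_right (not_lt.1 h) hσ.le
      nlinarith [h3.1, h3.2, h2.2]
    have : i l < N + 1 := by exact_mod_cast this
    omega

theorem pairwise_disjoint_cell (hσ : 0 < σ) :
    Pairwise (Function.onFun Disjoint fun i : Fin d → ℤ => cell σ i) := by
  intro i j hij
  refine Set.disjoint_left.2 fun x hi hj => hij (funext fun l => ?_)
  have h1 := hi l
  have h2 := hj l
  have h3 : (i l : ℝ) < j l + 1 := lt_of_mul_lt_mul_right (h1.1.trans h2.2) hσ.le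
  have h4 : (j l : ℝ) < i l + 1 := lt_of_mul_lt_mul_right (h2.1.trans h1.2) hσ.le
  have h5 : i l < j l + 1 := by exact_mod_cast h3
  have h6 : j l < i l + 1 := by exact_mod_cast h4
  omega

theorem ae_ne_grid (d : ℕ) (σ : ℝ) :
    ∀ᵐ x : Fin d → ℝ, ∀ (l : Fin d) (n : ℤ), x l ≠ (n : ℝ) * σ := by
  rw [ae_all_iff]
  intro l
  rw [ae_all_iff]
  intro n
  rw [volume_pi]
  exact Measure.ae_eval_ne (fun _ : Fin d => (volume : Measure ℝ)) l _

theorem exists_mem_cell (hσ : 0 < σ) {x : Fin d → ℝ}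
    (hx : ∀ (l : Fin d) (n : ℤ), x l ≠ (n : ℝ) * σ) : ∃ i : Fin d → ℤ, x ∈ cell σ i := by
  refine ⟨fun l => ⌊x l / σ⌋, fun l => ⟨?_, ?_⟩⟩
  · have h := Int.floor_le (x l / σ)
    rw [le_div_iff₀ hσ] at h
    exact lt_of_le_of_ne h (hx l _).symm
  · have h := Int.lt_floor_add_one (x l / σ)
    rwa [div_lt_iff₀ hσ] at h

/-- Two null sets are discarded: the grid hyperplanes, and the intersections of Ω with the countably
many inactive cells. -/
theorem ae_mem_active_cell (hσ : 0 < σ) :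
    ∀ᵐ x : Fin d → ℝ, x ∈ Ω → ∃ i ∈ activeCells Ω σ, x ∈ cell σ i := by
  have h1 : ∀ᵐ x : Fin d → ℝ, ∀ i : Fin d → ℤ, i ∉ activeCells Ω σ → x ∉ cell σ i ∩ Ω := by
    rw [ae_all_iff]
    intro i
    by_cases hi : i ∈ activeCells Ω σ
    · exact Filter.Eventually.of_forall fun x h => absurd hi h
    · have h0 : volume (cell σ i ∩ Ω) = 0 := nonpos_iff_eq_zero.1 (not_lt.1 hi)
      filter_upwards [measure_eq_zero_iff_ae_notMem.1 h0] with x hx _ using hx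
  filter_upwards [h1, ae_ne_grid d σ] with x hx1 hx2 hxΩ
  obtain ⟨i, hi⟩ := exists_mem_cell hσ hx2
  exact ⟨i, by_contra fun h => hx1 i h ⟨hi, hxΩ⟩, hi⟩

theorem integral_biUnion_cells (hσ : 0 < σ) (A : Finset (Fin d → ℤ)) {F : (Fin d → ℝ) → ℝ}
    (hF : Continuous F) :
    ∫ x in ⋃ i ∈ A, cell σ i, F x = ∑ i ∈ A, ∫ x in cell σ i, F x :=
  integral_biUnion_finset A (fun i _ => measurableSet_cell σ i)
    ((pairwise_disjoint_cell hσ).set_pairwise _)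
    fun i _ => integrableOn_of_continuous_of_isBounded (isBounded_cell σ i) hF

/-- Passing from Ω to whole cells is what allows the uniform estimates on the reference cell to be
used near the boundary. -/
theorem setIntegral_le_sum_cells (hσ : 0 < σ) {A : Finset (Fin d → ℤ)}
    (hA : activeCells Ω σ ⊆ A) {F : (Fin d → ℝ) → ℝ} (hF : Continuous F) (h0 : ∀ x, 0 ≤ F x) :
    ∫ x in Ω, F x ≤ ∑ i ∈ A, ∫ x in cell σ i, F x := by
  rw [← integral_biUnion_cells hσ A hF]
  refine setIntegral_mono_set ?_ (Filter.Eventually.of_forall h0) ?_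
  · refine integrableOn_of_continuous_of_isBounded ?_ hF
    rw [Bornology.isBounded_biUnion_finset]
    exact fun i _ => isBounded_cell σ i
  · filter_upwards [ae_mem_active_cell (Ω := Ω) hσ] with x hx hxΩ
    obtain ⟨i, hi, hxi⟩ := hx hxΩ
    exact mem_biUnion (hA hi) hxi

theorem sum_cells_le_setIntegral (hσ : 0 < σ) (hb : Bornology.IsBounded Ω)
    {A : Finset (Fin d → ℤ)} (hA : ∀ i ∈ A, cell σ i ⊆ Ω) {F : (Fin d → ℝ) → ℝ}
    (hF : Continuous F) (h0 : ∀ x, 0 ≤ F x) :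
    ∑ i ∈ A, ∫ x in cell σ i, F x ≤ ∫ x in Ω, F x := by
  rw [← integral_biUnion_cells hσ A hF]
  exact setIntegral_mono_set (integrableOn_of_continuous_of_isBounded hb hF)
    (Filter.Eventually.of_forall h0) (iUnion₂_subset hA).eventuallyLE

/-- The discrete `L²` norm over the cells with index in `A`. -/
def cellNorm (σ : ℝ) (A : Finset (Fin d → ℤ)) (v : (Fin d → ℝ) → ℝ) : ℝ :=
  √(∑ i ∈ A, l2norm (cell σ i) v ^ 2)

theorem cellNorm_nonneg (σ : ℝ) (A : Finset (Fin d → ℤ)) (v : (Fin d → ℝ) → ℝ) :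
    0 ≤ cellNorm σ A v := Real.sqrt_nonneg _

theorem cellNorm_sq (σ : ℝ) (A : Finset (Fin d → ℤ)) (v : (Fin d → ℝ) → ℝ) :
    cellNorm σ A v ^ 2 = ∑ i ∈ A, l2norm (cell σ i) v ^ 2 :=
  Real.sq_sqrt (Finset.sum_nonneg fun _ _ => sq_nonneg _)

theorem l2norm_cell_sq (i : Fin d → ℤ) {v : (Fin d → ℝ) → ℝ} (hv : Continuous v) :
    l2norm (cell σ i) v ^ 2 = ∫ x in cell σ i, v x ^ 2 :=
  l2norm_sq (memLp_of_continuous_of_isBounded (isBounded_cell σ i) hv 2)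

theorem sum_l2norm_mul_le (σ : ℝ) (A : Finset (Fin d → ℤ)) (v w : (Fin d → ℝ) → ℝ) :
    ∑ i ∈ A, l2norm (cell σ i) v * l2norm (cell σ i) w ≤ cellNorm σ A v * cellNorm σ A w := by
  refine (abs_le_of_sq_le_sq ?_
    (mul_nonneg (cellNorm_nonneg _ _ _) (cellNorm_nonneg _ _ _))).trans' (le_abs_self _)
  rw [mul_pow, cellNorm_sq, cellNorm_sq]
  exact Finset.sum_mul_sq_le_sq_mul_sq _ _ _

theorem l2norm_le_cellNorm (hσ : 0 < σ) (hb : Bornology.IsBounded Ω) {A : Finset (Fin d → ℤ)}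
    (hA : activeCells Ω σ ⊆ A) {v : (Fin d → ℝ) → ℝ} (hv : Continuous v) :
    l2norm Ω v ≤ cellNorm σ A v := by
  rw [l2norm_eq_sqrt (memLp_of_continuous_of_isBounded hb hv 2)]
  refine Real.sqrt_le_sqrt ((setIntegral_le_sum_cells hσ hA (hv.pow 2) fun x => sq_nonneg _).trans
    (le_of_eq ?_))
  exact Finset.sum_congr rfl fun i _ => (l2norm_cell_sq i hv).symm

theorem abs_setIntegral_mul_le {S : Set (Fin d → ℝ)} {f g : (Fin d → ℝ) → ℝ}
    (hf : MemLp f 2 (volume.restrict S)) (hg : MemLp g 2 (volume.restrict S)) :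
    |∫ x in S, f x * g x| ≤ l2norm S f * l2norm S g := by
  have h := abs_real_inner_le_norm (hf.toLp f) (hg.toLp g)
  rw [norm_eq_l2norm hf.coeFn_toLp, norm_eq_l2norm hg.coeFn_toLp, L2.inner_def] at h
  convert h using 2
  refine integral_congr_ae ?_
  filter_upwards [hf.coeFn_toLp, hg.coeFn_toLp] with x h1 h2
  rw [h1, h2]
  simp [mul_comm]

/-- The contribution of a cell to the stabilisation form. -/
def cellEnergy (σ : ℝ) (P : ℕ) (i : Fin d → ℤ) (v : (Fin d → ℝ) → ℝ) : ℝ :=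
  ∑ α ∈ multiIdxEq d (P + 1), (σ ^ (P + 1) * l2norm (cell σ i) (mderiv α v)) ^ 2

theorem cellEnergy_nonneg (σ : ℝ) (P : ℕ) (i : Fin d → ℤ) (v : (Fin d → ℝ) → ℝ) :
    0 ≤ cellEnergy σ P i v := Finset.sum_nonneg fun _ _ => sq_nonneg _

theorem stab_eq_sum {C : Finset (Fin d → ℤ)} (hC : ∀ i, i ∈ C ↔ i ∈ cutCells Ω σ)
    (v w : (Fin d → ℝ) → ℝ) :
    stab Ω σ P v w = σ ^ (2 * (P + 1)) * ∑ i ∈ C, ∑ α ∈ multiIdxEq d (P + 1),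
      ∫ x in cell σ i, mderiv α v x * mderiv α w x := by
  unfold stab
  have : cutCells Ω σ = ↑C := by ext i; simp [hC]
  rw [this, finsum_mem_coe_finset]

theorem stab_self_eq_sum {C : Finset (Fin d → ℤ)} (hC : ∀ i, i ∈ C ↔ i ∈ cutCells Ω σ)
    {v : (Fin d → ℝ) → ℝ} (hv : ContDiff ℝ ∞ v) :
    stab Ω σ P v v = ∑ i ∈ C, cellEnergy σ P i v := by
  rw [stab_eq_sum hC, Finset.mul_sum]
  refine Finset.sum_congr rfl fun i _ => ?_
  rw [cellEnergy, Finset.mul_sum]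
  refine Finset.sum_congr rfl fun α _ => ?_
  rw [mul_pow, l2norm_cell_sq i (continuous_mderiv α hv), ← pow_mul, mul_comm 2]
  simp only [sq]

/-- Cauchy–Schwarz on each cell, then once more over the pairs (cell, multi-index). -/
theorem abs_stab_le {C : Finset (Fin d → ℤ)} (hC : ∀ i, i ∈ C ↔ i ∈ cutCells Ω σ)
    {v w : (Fin d → ℝ) → ℝ} (hv : ContDiff ℝ ∞ v) (hw : ContDiff ℝ ∞ w) :
    |stab Ω σ P v w| ≤ √(∑ i ∈ C, cellEnergy σ P i v) * √(∑ i ∈ C, cellEnergy σ P i w) := by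
  have hsig : σ ^ (2 * (P + 1)) = σ ^ (P + 1) * σ ^ (P + 1) := by ring
  have h0 : 0 ≤ σ ^ (P + 1) * σ ^ (P + 1) := mul_self_nonneg _
  rw [stab_eq_sum hC, ← Finset.sum_product', abs_mul, abs_of_nonneg (hsig ▸ h0)]
  have hE : ∀ u : (Fin d → ℝ) → ℝ, ∑ i ∈ C, cellEnergy σ P i u =
      ∑ z ∈ C ×ˢ multiIdxEq d (P + 1),
        (σ ^ (P + 1) * l2norm (cell σ z.1) (mderiv z.2 u)) ^ 2 := fun u => by
    rw [Finset.sum_product]; rfl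
  rw [hE, hE, ← Real.sqrt_mul (Finset.sum_nonneg fun _ _ => sq_nonneg _)]
  refine le_trans ?_ (Real.le_sqrt_of_sq_le (Finset.sum_mul_sq_le_sq_mul_sq _ _ _))
  calc σ ^ (2 * (P + 1)) * |∑ z ∈ C ×ˢ multiIdxEq d (P + 1),
        ∫ x in cell σ z.1, mderiv z.2 v x * mderiv z.2 w x|
      ≤ σ ^ (2 * (P + 1)) * ∑ z ∈ C ×ˢ multiIdxEq d (P + 1),
        l2norm (cell σ z.1) (mderiv z.2 v) * l2norm (cell σ z.1) (mderiv z.2 w) := by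
        refine mul_le_mul_of_nonneg_left ?_ (hsig ▸ h0)
        refine (Finset.abs_sum_le_sum_abs _ _).trans (Finset.sum_le_sum fun z _ => ?_)
        exact abs_setIntegral_mul_le
          (memLp_of_continuous_of_isBounded (isBounded_cell _ _) (continuous_mderiv _ hv) 2)
          (memLp_of_continuous_of_isBounded (isBounded_cell _ _) (continuous_mderiv _ hw) 2)
    _ = _ := by
        rw [Finset.mul_sum]
        refine Finset.sum_congr rfl fun z _ => ?_
        rw [hsig]; ring

/-- The inverse inequality for the stabilisation form. -/
theorem exists_cellEnergy_le (d P : ℕ) : ∃ C : ℝ, 0 < C ∧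
    ∀ σ : ℝ, 0 < σ → ∀ v ∈ pufemAll d σ P, ∀ i : Fin d → ℤ,
      cellEnergy σ P i v ≤ C * l2norm (cell σ i) v ^ 2 := by
  obtain ⟨C, hC, h⟩ := exists_l2norm_mderiv_le d P (P + 1)
  refine ⟨(multiIdxEq d (P + 1)).card * C ^ 2 + 1, by positivity, fun σ hσ v hv i => ?_⟩
  have h1 : cellEnergy σ P i v ≤
      (multiIdxEq d (P + 1)).card • (C * l2norm (cell σ i) v) ^ 2 := by
    refine Finset.sum_le_card_nsmul _ _ _ fun α hα => ?_
    exact pow_le_pow_left₀ (mul_nonneg (by positivity) (l2norm_nonneg _ _)) (h σ hσ v hv i α hα) 2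
  rw [nsmul_eq_mul, mul_pow] at h1
  nlinarith [sq_nonneg (l2norm (cell σ i) v)]

/-- Squared form of the neighbour estimate, suited to summation over cells; C ≥ 1 makes the powers
of 2C along a chain increasing. -/
theorem exists_l2norm_sq_neighbor_le (d P : ℕ) : ∃ C : ℝ, 1 ≤ C ∧
    ∀ σ : ℝ, 0 < σ → ∀ v ∈ pufemAll d σ P, ∀ i i' : Fin d → ℤ, Neighbors i i' →
      l2norm (cell σ i) v ^ 2 ≤ C * (l2norm (cell σ i') v ^ 2 + cellEnergy σ P i v) := by
  obtain ⟨C, hC, h⟩ := exists_l2norm_neighbor_le d P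
  set M : ℝ := ((multiIdxEq d (P + 1)).card : ℝ) with hM
  have hM0 : 0 ≤ M := Nat.cast_nonneg _
  refine ⟨2 * C ^ 2 * (M + 1) + 1, by nlinarith [sq_nonneg C], fun σ hσ v hv i i' hi => ?_⟩
  set S := ∑ α ∈ multiIdxEq d (P + 1), σ ^ (P + 1) * l2norm (cell σ i) (mderiv α v) with hS
  have h1 : S ^ 2 ≤ M * cellEnergy σ P i v := sq_sum_le_card_mul_sum_sq
  have hE := cellEnergy_nonneg σ P i v
  set a := l2norm (cell σ i') v
  have h2 := pow_le_pow_left₀ (l2norm_nonneg _ _) (h σ hσ v hv i i' hi) 2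
  calc l2norm (cell σ i) v ^ 2 ≤ (C * (a + S)) ^ 2 := h2
    _ = C ^ 2 * (a + S) ^ 2 := by ring
    _ ≤ C ^ 2 * (2 * (a ^ 2 + S ^ 2)) := by
        gcongr; nlinarith [sq_nonneg (a - S)]
    _ ≤ C ^ 2 * (2 * (a ^ 2 + M * cellEnergy σ P i v)) := by gcongr
    _ ≤ C ^ 2 * (2 * ((M + 1) * (a ^ 2 + cellEnergy σ P i v))) := by
        gcongr; nlinarith [mul_nonneg hM0 (sq_nonneg a)]
    _ ≤ _ := by nlinarith [sq_nonneg a]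

/-- Translation is injective, so each index of A is hit at most once; indices outside A contribute
nothing. -/
theorem sum_shift_le {A : Finset (Fin d → ℤ)} {G : (Fin d → ℤ) → ℝ} (h0 : ∀ i, 0 ≤ G i)
    (hG : ∀ i, i ∉ A → G i = 0) (n : Fin d → ℤ) : ∑ i ∈ A, G (i + n) ≤ ∑ i ∈ A, G i := by
  classical
  have h1 : ∑ i ∈ A, G (i + n) = ∑ i ∈ A.map (addRightEmbedding n), G i :=
    (Finset.sum_map A (addRightEmbedding n) G).symm
  rw [h1]
  have h : ∑ i ∈ A.map (addRightEmbedding n), G i =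
      ∑ i ∈ (A.map (addRightEmbedding n)).filter (· ∈ A), G i := by
    rw [Finset.sum_filter]
    refine Finset.sum_congr rfl fun i _ => ?_
    split_ifs with hi
    · rfl
    · exact hG i hi
  rw [h]
  exact Finset.sum_le_sum_of_subset_of_nonneg (fun i hi => (Finset.mem_filter.1 hi).2)
    fun i _ _ => h0 i

/-- The discrete norm is controlled by the uncut cells and the stabilisation form. -/
theorem exists_cellNorm_sq_le (d P K : ℕ) : ∃ C : ℝ, 0 < C ∧
    ∀ (Ω : Set (Fin d → ℝ)) (σ : ℝ), 0 < σ → CutCellsReach Ω σ K →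
    ∀ A B : Finset (Fin d → ℤ), (∀ i, i ∈ A ↔ i ∈ activeCells Ω σ) →
    (∀ i, i ∈ B ↔ i ∈ cutCells Ω σ) → ∀ v ∈ pufemAll d σ P,
      cellNorm σ A v ^ 2 ≤ C * (∑ i ∈ A \ B, l2norm (cell σ i) v ^ 2 +
        ∑ i ∈ B, cellEnergy σ P i v) := by
  classical
  obtain ⟨c, hc, h⟩ := exists_l2norm_sq_neighbor_le d P
  let N : Finset (Fin d → ℤ) := Fintype.piFinset fun _ => Finset.Icc (-(K : ℤ)) K
  have hN : 0 < N.card := Finset.card_pos.2 ⟨0, by simp [N]⟩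
  -- One factor 2c per step of a chain of at most K steps; the cardinality of the cube N of radius K
  -- bounds how often a cell is used by the chains.
  refine ⟨(2 * c) ^ K * N.card, by positivity, fun Ω σ hσ hK A B hA hB v hv => ?_⟩
  -- The controlled quantity per cell: energy on cut cells, squared norm on uncut ones, zero
  -- elsewhere. All cells of a chain starting at i lie in i + N, so its sum over i + N bounds each
  -- of their contributions.
  let G : (Fin d → ℤ) → ℝ := fun i => if i ∈ B then cellEnergy σ P i v else
    if i ∈ A then l2norm (cell σ i) v ^ 2 else 0
  have hBA : B ⊆ A := fun i hi => (hA i).2 ((hB i).1 hi).1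
  have hG0 : ∀ i, 0 ≤ G i := fun i => by
    simp only [G]
    split_ifs
    · exact cellEnergy_nonneg _ _ _ _
    · positivity
    · exact le_rfl
  have hGA : ∀ i, i ∉ A → G i = 0 := fun i hi => by
    simp only [G, if_neg (fun h => hi (hBA h)), if_neg hi]
  have hGsum : ∑ i ∈ A, G i = ∑ i ∈ A \ B, l2norm (cell σ i) v ^ 2 +
      ∑ i ∈ B, cellEnergy σ P i v := by
    rw [← Finset.sum_sdiff hBA]
    congr 1
    · refine Finset.sum_congr rfl fun i hi => ?_
      rw [Finset.mem_sdiff] at hi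
      simp only [G, if_neg hi.2, if_pos hi.1]
    · exact Finset.sum_congr rfl fun i hi => by simp only [G, if_pos hi]
  have h2c : 1 ≤ 2 * c := by linarith
  have hM : ∀ i j : Fin d → ℤ, (∀ l, (j - i) l ∈ Icc (-(K : ℤ)) K) →
      G j ≤ ∑ n ∈ N, G (i + n) := by
    intro i j hij
    have := Finset.single_le_sum (f := fun n => G (i + n)) (fun n _ => hG0 _)
      (show j - i ∈ N by simpa [N, Fintype.mem_piFinset] using hij)
    simpa using this
  have key : ∀ i ∈ A, l2norm (cell σ i) v ^ 2 ≤ (2 * c) ^ K * ∑ n ∈ N, G (i + n) := by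
    intro i hi
    have hS0 : 0 ≤ ∑ n ∈ N, G (i + n) := Finset.sum_nonneg fun n _ => hG0 _
    by_cases hiB : i ∈ B
    · obtain ⟨n, q, hnK, hq0, hqcut, hqn, i', hi', hni'⟩ := hK i ((hB i).1 hiB)
      have hdist : ∀ r ≤ n, ∀ l, (q r - i) l ∈ Icc (-(r : ℤ)) r := by
        intro r
        induction r with
        | zero => intro _ l; simp [hq0]
        | succ r ih =>
          intro hr l
          have h1 := ih (by omega) l
          have h2 := sub_mem_of_neighbors (hqn r (by omega)) l
          simp only [Pi.sub_apply, mem_Icc] at h1 h2 ⊢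
          push_cast
          omega
      have hqM : ∀ r ≤ n, cellEnergy σ P (q r) v ≤ ∑ n ∈ N, G (i + n) := by
        intro r hr
        have h1 := hM i (q r) fun l => by
          have := hdist r hr l
          simp only [mem_Icc] at this ⊢
          omega
        simpa only [G, if_pos ((hB _).2 (hqcut r hr))] using h1
      have hi'M : l2norm (cell σ i') v ^ 2 ≤ ∑ n ∈ N, G (i + n) := by
        have h1 := hM i i' fun l => by
          have h1 := hdist n le_rfl l
          have h2 := sub_mem_of_neighbors hni' l
          simp only [mem_Icc, Pi.sub_apply] at h1 h2 ⊢
          omega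
        have hnB : i' ∉ B := fun h => ((hB _).1 h).2 hi'.2
        simpa only [G, if_neg hnB, if_pos ((hA _).2 hi'.1)] using h1
      -- The chain is run backwards from its uncut end. After r + 1 steps the factor is (2c)^(r+1),
      -- which for r = n is at most (2c)^K since n + 1 ≤ K.
      have hind : ∀ r ≤ n, l2norm (cell σ (q (n - r))) v ^ 2 ≤
          (2 * c) ^ (r + 1) * ∑ n ∈ N, G (i + n) := by
        intro r
        induction r with
        | zero =>
          intro _
          refine (h σ hσ v hv _ _ hni').trans ?_
          have := hqM n le_rfl
          rw [zero_add, pow_one]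
          nlinarith
        | succ r ih =>
          intro hr
          have h1 := ih (by omega)
          have h2 := hqn (n - (r + 1)) (by omega)
          rw [show n - (r + 1) + 1 = n - r by omega] at h2
          refine (h σ hσ v hv _ _ h2).trans ?_
          have h3 := hqM (n - (r + 1)) (by omega)
          have h4 : (1 : ℝ) ≤ (2 * c) ^ (r + 1) := one_le_pow₀ h2c
          have h5 : ∑ n ∈ N, G (i + n) ≤ (2 * c) ^ (r + 1) * ∑ n ∈ N, G (i + n) :=
            le_mul_of_one_le_left hS0 h4
          rw [pow_succ (2 * c) (r + 1)]
          nlinarith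
      have h1 := hind n le_rfl
      rw [Nat.sub_self, hq0] at h1
      refine h1.trans (mul_le_mul_of_nonneg_right ?_ hS0)
      exact pow_le_pow_right₀ h2c hnK
    · have h1 := hM i i fun l => by simp
      simp only [G, if_neg hiB, if_pos hi] at h1
      exact h1.trans (le_mul_of_one_le_left hS0 (one_le_pow₀ h2c))
  rw [cellNorm_sq, ← hGsum]
  calc ∑ i ∈ A, l2norm (cell σ i) v ^ 2 ≤ ∑ i ∈ A, (2 * c) ^ K * ∑ n ∈ N, G (i + n) :=
        Finset.sum_le_sum key
    _ = (2 * c) ^ K * ∑ n ∈ N, ∑ i ∈ A, G (i + n) := by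
        rw [← Finset.mul_sum, Finset.sum_comm]
    _ ≤ (2 * c) ^ K * ∑ n ∈ N, ∑ i ∈ A, G i := by
        refine mul_le_mul_of_nonneg_left ?_ (by positivity)
        exact Finset.sum_le_sum fun n _ => sum_shift_le hG0 hGA n
    _ = _ := by rw [Finset.sum_const, nsmul_eq_mul, mul_assoc]

end Grid

/-! ### Mollification of Sobolev functions on `ℝ^d` -/

section Mollification

variable {d : ℕ}

theorem eLpNorm_two_sq {X : Type*} [MeasurableSpace X] (f : X → ℝ) (μ : Measure X) :
    eLpNorm f 2 μ ^ 2 = ∫⁻ x, ‖f x‖ₑ ^ 2 ∂μ := by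
  have h := eLpNorm_nnreal_pow_eq_lintegral (f := f) (μ := μ) (p := 2) (by norm_num)
  simpa using h

/-- Minkowski's integral inequality for averages with respect to a probability measure. -/
theorem lintegral_enorm_integral_sq_le {X Y : Type*} [MeasurableSpace X] [MeasurableSpace Y]
    (μ : Measure X) [SFinite μ] (ν : Measure Y) [IsProbabilityMeasure ν] {H : X → Y → ℝ}
    (hH : Measurable (Function.uncurry H)) :
    ∫⁻ x, ‖∫ t, H x t ∂ν‖ₑ ^ 2 ∂μ ≤ ∫⁻ t, eLpNorm (fun x => H x t) 2 μ ^ 2 ∂ν := by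
  calc ∫⁻ x, ‖∫ t, H x t ∂ν‖ₑ ^ 2 ∂μ ≤ ∫⁻ x, ∫⁻ t, ‖H x t‖ₑ ^ 2 ∂ν ∂μ := by
        refine lintegral_mono fun x => ?_
        have hm : AEStronglyMeasurable (H x) ν :=
          (hH.comp measurable_prodMk_left).aestronglyMeasurable
        -- For a probability measure the L¹ norm is at most the L² norm; Tonelli's theorem then
        -- concludes.
        have h1 : ‖∫ t, H x t ∂ν‖ₑ ≤ eLpNorm (H x) 2 ν := by
          refine (enorm_integral_le_lintegral_enorm _).trans ?_
          rw [← eLpNorm_one_eq_lintegral_enorm]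
          exact eLpNorm_le_eLpNorm_of_exponent_le (by norm_num) hm
        rw [← eLpNorm_two_sq]
        exact pow_le_pow_left' h1 2
    _ = ∫⁻ t, ∫⁻ x, ‖H x t‖ₑ ^ 2 ∂μ ∂ν :=
        lintegral_lintegral_swap (hH.enorm.pow_const 2).aemeasurable
    _ = _ := by simp only [eLpNorm_two_sq]

/-- Continuity of translation in L², from the continuity of the translation action on `Lp` for a
finite exponent. -/
theorem exists_eLpNorm_translate_sub_le (f : Lp ℝ 2 (volume : Measure (Fin d → ℝ))) {η : ℝ}
    (hη : 0 < η) : ∃ δ : ℝ, 0 < δ ∧ ∀ t : Fin d → ℝ, ‖t‖ < δ →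
      eLpNorm (fun x => f (x - t) - f x) 2 volume ≤ ENNReal.ofReal η := by
  have hp : Fact ((2 : ℝ≥0∞) ≠ ⊤) := ⟨by norm_num⟩
  have hc : Continuous fun t : Fin d → ℝ => DomAddAct.mk (-t) +ᵥ f := by
    have : Continuous fun t : Fin d → ℝ => (DomAddAct.mk (-t)) :=
      DomAddAct.continuous_mk.comp continuous_neg
    exact this.vadd continuous_const
  have h0 := Metric.continuous_iff.1 hc 0 η hη
  obtain ⟨δ, hδ, h⟩ := h0
  refine ⟨δ, hδ, fun t ht => ?_⟩
  have h1 := h t (by simpa using ht)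
  have h2 : DomAddAct.mk (-(0 : Fin d → ℝ)) +ᵥ f = f := by simp
  rw [h2, dist_eq_norm, Lp.norm_def] at h1
  have h3 : eLpNorm (fun x => f (x - t) - f x) 2 volume =
      eLpNorm ((DomAddAct.mk (-t) +ᵥ f) - f : Lp ℝ 2 (volume : Measure (Fin d → ℝ))) 2 volume := by
    refine eLpNorm_congr_ae ?_
    filter_upwards [Lp.coeFn_sub (DomAddAct.mk (-t) +ᵥ f) f,
      DomAddAct.vadd_Lp_ae_eq (DomAddAct.mk (-t)) f] with x hx1 hx2
    rw [hx1, Pi.sub_apply, hx2]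
    simp [neg_add_eq_sub]
  rw [h3, ← ENNReal.ofReal_toReal (Lp.eLpNorm_ne_top _)]
  exact ENNReal.ofReal_le_ofReal h1.le

/-- The convolution of `f` and `ρ`. -/
def mollify (f ρ : (Fin d → ℝ) → ℝ) : (Fin d → ℝ) → ℝ :=
  convolution f ρ (ContinuousLinearMap.mul ℝ ℝ) volume

theorem mollify_apply (f ρ : (Fin d → ℝ) → ℝ) (x : Fin d → ℝ) :
    mollify f ρ x = ∫ t, f t * ρ (x - t) := rfl

theorem mollify_apply' (f ρ : (Fin d → ℝ) → ℝ) (x : Fin d → ℝ) :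
    mollify f ρ x = ∫ t, ρ t * f (x - t) := by
  rw [mollify_apply, ← integral_sub_left_eq_self (fun t => f t * ρ (x - t)) volume x]
  refine integral_congr_ae (Filter.Eventually.of_forall fun t => ?_)
  simp only [sub_sub_cancel]
  ring

theorem contDiff_mollify {f ρ : (Fin d → ℝ) → ℝ} (hf : LocallyIntegrable f)
    (hρ : ContDiff ℝ ∞ ρ) (hc : HasCompactSupport ρ) : ContDiff ℝ ∞ (mollify f ρ) :=
  hc.contDiff_convolution_right _ hf hρ

theorem pderiv_mollify (l : Fin d) {f ρ : (Fin d → ℝ) → ℝ} (hf : LocallyIntegrable f)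
    (hρ : ContDiff ℝ ∞ ρ) (hc : HasCompactSupport ρ) :
    pderiv l (mollify f ρ) = mollify f (pderiv l ρ) := by
  funext x
  have h := hc.hasFDerivAt_convolution_right (ContinuousLinearMap.mul ℝ ℝ) hf
    (hρ.of_le (by exact_mod_cast le_top)) x
  unfold pderiv mollify
  rw [h.fderiv, convolution_precompR_apply _ hf (hc.fderiv ℝ)
    (hρ.continuous_fderiv (by simp))]

theorem mderiv_mollify (α : Fin d → ℕ) {f ρ : (Fin d → ℝ) → ℝ} (hf : LocallyIntegrable f)
    (hρ : ContDiff ℝ ∞ ρ) (hc : HasCompactSupport ρ) :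
    mderiv α (mollify f ρ) = mollify f (mderiv α ρ) := by
  rw [mderiv_eq_listDeriv, mderiv_eq_listDeriv]
  suffices h : listDeriv (multiIdxList α) (mollify f ρ) =
      mollify f (listDeriv (multiIdxList α) ρ) ∧
      HasCompactSupport (listDeriv (multiIdxList α) ρ) from h.1
  induction multiIdxList α with
  | nil => exact ⟨rfl, hc⟩
  | cons l L ih =>
    refine ⟨?_, ih.2.fderiv_apply ℝ _⟩
    rw [listDeriv_cons, ih.1, pderiv_mollify l hf (contDiff_listDeriv L hρ) ih.2]
    rfl

theorem locallyIntegrable_lp (f : LpOn 2 (univ : Set (Fin d → ℝ))) : LocallyIntegrable f := by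
  have key : ∀ F : (Fin d → ℝ) → ℝ, LocallyIntegrable F (volume.restrict univ) →
      LocallyIntegrable F := fun F h => by rwa [Measure.restrict_univ] at h
  exact key _ ((Lp.memLp f).locallyIntegrable (by norm_num))

/-- The test function t ↦ ρ(x - t) is inserted into the definition of the weak derivative; the sign
from the reflection cancels the sign there. -/
theorem mderiv_mollify_of_isWeakDeriv {α : Fin d → ℕ} {f g : LpOn 2 (univ : Set (Fin d → ℝ))}
    (h : IsWeakDeriv univ α f g) {ρ : (Fin d → ℝ) → ℝ} (hρ : ContDiff ℝ ∞ ρ)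
    (hc : HasCompactSupport ρ) : mderiv α (mollify f ρ) = mollify g ρ := by
  rw [mderiv_mollify α (locallyIntegrable_lp f) hρ hc]
  funext x
  have hφ : ContDiff ℝ ∞ fun t => ρ (x + (-1 : ℝ) • t) := hρ.comp (by fun_prop)
  have hφc : HasCompactSupport fun t => ρ (x + (-1 : ℝ) • t) := by
    have := hc.comp_homeomorph (Homeomorph.subLeft x)
    convert this using 1
    funext t
    simp [sub_eq_add_neg]
  have h1 := h _ ⟨hφ, hφc, subset_univ _⟩
  simp only [mderiv_comp_affine α x (-1) hρ, setIntegral_univ] at h1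
  have h2 : ∀ t, f t * ((-1) ^ (∑ l, α l) * mderiv α ρ (x + (-1 : ℝ) • t)) =
      (-1) ^ (∑ l, α l) * (f t * mderiv α ρ (x - t)) := fun t => by
    rw [neg_one_smul, ← sub_eq_add_neg]; ring
  have h3 : ∀ t, g t * ρ (x + (-1 : ℝ) • t) = g t * ρ (x - t) := fun t => by
    rw [neg_one_smul, ← sub_eq_add_neg]
  simp only [h2, h3, integral_const_mul] at h1
  exact mul_left_cancel₀ (pow_ne_zero _ (by norm_num)) h1

/-- The probability measure with density `ρ`. -/
def densityMeasure (ρ : (Fin d → ℝ) → ℝ) : Measure (Fin d → ℝ) :=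
  volume.withDensity fun t => ENNReal.ofReal (ρ t)

theorem integral_densityMeasure {ρ : (Fin d → ℝ) → ℝ} (hρ : Continuous ρ) (h0 : ∀ t, 0 ≤ ρ t)
    (g : (Fin d → ℝ) → ℝ) : ∫ t, g t ∂(densityMeasure ρ) = ∫ t, ρ t * g t := by
  unfold densityMeasure
  rw [integral_withDensity_eq_integral_toReal_smul (by fun_prop)
    (Filter.Eventually.of_forall fun _ => ENNReal.ofReal_lt_top)]
  simp only [ENNReal.toReal_ofReal (h0 _), smul_eq_mul]

theorem isProbabilityMeasure_densityMeasure {ρ : (Fin d → ℝ) → ℝ} (hρ : Continuous ρ)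
    (hc : HasCompactSupport ρ) (h0 : ∀ t, 0 ≤ ρ t) (h1 : ∫ t, ρ t = 1) :
    IsProbabilityMeasure (densityMeasure ρ) := by
  refine ⟨?_⟩
  unfold densityMeasure
  rw [withDensity_apply _ MeasurableSet.univ, setLIntegral_univ,
    ← ofReal_integral_eq_lintegral_ofReal (hρ.integrable_of_hasCompactSupport hc)
      (Filter.Eventually.of_forall h0), h1, ENNReal.ofReal_one]

/-- The convolution is an average of translates under the probability measure with density ρ, and
every translate has the same norm. -/
theorem eLpNorm_mollify_le {ρ : (Fin d → ℝ) → ℝ} (hρ : Continuous ρ)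
    (hc : HasCompactSupport ρ) (h0 : ∀ t, 0 ≤ ρ t) (h1 : ∫ t, ρ t = 1)
    {f : (Fin d → ℝ) → ℝ} (hf : Measurable f) :
    eLpNorm (mollify f ρ) 2 volume ≤ eLpNorm f 2 volume := by
  have := isProbabilityMeasure_densityMeasure hρ hc h0 h1
  have h := lintegral_enorm_integral_sq_le volume (densityMeasure ρ)
    (H := fun x t => f (x - t)) (hf.comp (measurable_fst.sub measurable_snd))
  simp only [integral_densityMeasure hρ h0, ← mollify_apply'] at h
  rw [← eLpNorm_two_sq] at h
  have h2 : ∀ t, eLpNorm (fun x => f (x - t)) 2 volume = eLpNorm f 2 volume := fun t =>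
    eLpNorm_comp_measurePreserving hf.aestronglyMeasurable (measurePreserving_sub_right volume t)
  simp only [h2, lintegral_const, measure_univ, mul_one] at h
  exact (ENNReal.pow_right_strictMono two_ne_zero).le_iff_le.1 h

/-- Since ρ has integral 1, the difference is an average of f(· - t) - f over the support of ρ. -/
theorem eLpNorm_mollify_sub_le {ρ : (Fin d → ℝ) → ℝ} (hρ : Continuous ρ)
    (hc : HasCompactSupport ρ) (h0 : ∀ t, 0 ≤ ρ t) (h1 : ∫ t, ρ t = 1)
    {f : (Fin d → ℝ) → ℝ} (hf : Measurable f) (hfl : LocallyIntegrable f) {M : ℝ≥0∞}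
    (hM : ∀ t, ρ t ≠ 0 → eLpNorm (fun x => f (x - t) - f x) 2 volume ≤ M) :
    eLpNorm (mollify f ρ - f) 2 volume ≤ M := by
  have hP := isProbabilityMeasure_densityMeasure hρ hc h0 h1
  have h := lintegral_enorm_integral_sq_le volume (densityMeasure ρ)
    (H := fun x t => f (x - t) - f x)
    ((hf.comp (measurable_fst.sub measurable_snd)).sub (hf.comp measurable_fst))
  have h2 : ∀ x, ∫ t, (f (x - t) - f x) ∂(densityMeasure ρ) = (mollify f ρ - f) x := by
    intro x
    have hi : Integrable fun t => ρ t * f (x - t) := by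
      have := hc.convolutionExists_right (ContinuousLinearMap.mul ℝ ℝ) hfl hρ x
      have h3 := this.integrable.comp_sub_left x
      refine h3.congr (Filter.Eventually.of_forall fun t => ?_)
      simp [mul_comm]
    rw [integral_densityMeasure hρ h0]
    simp only [mul_sub]
    rw [integral_sub hi ((hρ.integrable_of_hasCompactSupport hc).mul_const _),
      integral_mul_const, h1, one_mul, ← mollify_apply']
    rfl
  simp only [h2] at h
  rw [← eLpNorm_two_sq] at h
  have h3 : ∫⁻ t, eLpNorm (fun x => f (x - t) - f x) 2 volume ^ 2 ∂(densityMeasure ρ) ≤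
      ∫⁻ _, M ^ 2 ∂(densityMeasure ρ) := by
    refine lintegral_mono_ae ?_
    unfold densityMeasure
    rw [ae_withDensity_iff (by fun_prop)]
    refine Filter.Eventually.of_forall fun t ht => pow_le_pow_left' (hM t fun h => ht ?_) 2
    rw [h, ENNReal.ofReal_zero]
  rw [lintegral_const, measure_univ, mul_one] at h3
  exact (ENNReal.pow_right_strictMono two_ne_zero).le_iff_le.1 (h.trans h3)

/-- A Sobolev function on `ℝ^d` can be approximated in `L²` by smooth functions whose derivatives
are bounded by those of the given function. -/
theorem exists_smooth_approx {k : ℕ} (w : Sobolev k 2 (univ : Set (Fin d → ℝ))) {η : ℝ}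
    (hη : 0 < η) : ∃ g : (Fin d → ℝ) → ℝ, ContDiff ℝ ∞ g ∧
      eLpNorm (g - (toFn w : (Fin d → ℝ) → ℝ)) 2 volume ≤ ENNReal.ofReal η ∧
      ∀ α : multiIdxLE d k, eLpNorm (mderiv α.1 g) 2 volume ≤ ENNReal.ofReal ‖w.1 α‖ := by
  have hmem : MemLp (toFn w) 2 (volume : Measure (Fin d → ℝ)) := by
    simpa using Lp.memLp (toFn w)
  obtain ⟨δ, hδ, h⟩ := exists_eLpNorm_translate_sub_le (hmem.toLp _) hη
  -- The outer radius δ is the translation modulus for η, so every translate in the average is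
  -- η-close to f.
  let b : ContDiffBump (0 : Fin d → ℝ) := ⟨δ / 2, δ, by positivity, by linarith⟩
  let ρ := b.normed volume
  have hρ : ContDiff ℝ ∞ ρ := b.contDiff_normed
  have hc : HasCompactSupport ρ := b.hasCompactSupport_normed
  have h0 : ∀ t, 0 ≤ ρ t := b.nonneg_normed
  have h1 : ∫ t, ρ t = 1 := b.integral_normed
  refine ⟨mollify (toFn w) ρ, contDiff_mollify (locallyIntegrable_lp _) hρ hc, ?_, fun α => ?_⟩
  · refine eLpNorm_mollify_sub_le hρ.continuous hc h0 h1 (Lp.stronglyMeasurable _).measurable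
      (locallyIntegrable_lp _) fun t ht => ?_
    have ht' : ‖t‖ < δ := by
      have : t ∈ Function.support ρ := ht
      rw [b.support_normed_eq] at this
      simpa using this
    have h2 := h t ht'
    refine le_trans (le_of_eq (eLpNorm_congr_ae ?_)) h2
    have h3 := hmem.coeFn_toLp
    have h4 := (measurePreserving_sub_right (volume : Measure (Fin d → ℝ))
      t).quasiMeasurePreserving.ae_eq_comp h3
    filter_upwards [h3, h4] with x hx1 hx2
    simp only [Function.comp_apply] at hx2
    rw [hx1, hx2]
  · have h2 : mderiv α.1 (mollify (toFn w) ρ) = mollify (w.1 α) ρ :=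
      mderiv_mollify_of_isWeakDeriv (w.2 α) hρ hc
    rw [h2]
    refine (eLpNorm_mollify_le hρ.continuous hc h0 h1 (Lp.stronglyMeasurable _).measurable).trans ?_
    have key : ∀ F : (Fin d → ℝ) → ℝ, eLpNorm F 2 volume ≤ eLpNorm F 2 (volume.restrict univ) :=
      fun F => by rw [Measure.restrict_univ]
    rw [Lp.norm_def, ENNReal.ofReal_toReal (Lp.eLpNorm_ne_top _)]
    exact key _

end Mollification

/-! ### Polynomial approximation on the patches -/

section BrambleHilbert

variable {d P : ℕ}

/-- The substitution has Jacobian t^(-d), at most 2^d for t ≥ 1/2, and the image stays in S. -/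
theorem lintegral_comp_affine_le {S : Set (Fin d → ℝ)} (hS : MeasurableSet S) {t : ℝ}
    (ht : 1 / 2 ≤ t) (a : Fin d → ℝ) (h : ∀ x ∈ S, a + t • x ∈ S) {F : (Fin d → ℝ) → ℝ≥0∞}
    (hF : Measurable F) :
    ∫⁻ x in S, F (a + t • x) ≤ 2 ^ d * ∫⁻ x in S, F x := by
  have ht0 : 0 < t := by linarith
  have hm : Measurable (S.indicator F) := hF.indicator hS
  calc ∫⁻ x in S, F (a + t • x) ≤ ∫⁻ x in S, S.indicator F (a + t • x) := by
        refine setLIntegral_mono (by fun_prop) fun x hx => ?_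
        rw [indicator_of_mem (h x hx)]
    _ ≤ ∫⁻ x, S.indicator F (a + t • x) := setLIntegral_le_lintegral _ _
    _ = ENNReal.ofReal |(t ^ d)⁻¹| * ∫⁻ x, S.indicator F (a + x) := by
        have h1 := lintegral_map (μ := (volume : Measure (Fin d → ℝ)))
          (f := fun x => S.indicator F (a + x)) (g := fun x => t • x) (by fun_prop) (by fun_prop)
        rw [← h1, Measure.map_addHaar_smul _ ht0.ne', lintegral_smul_measure,
          Module.finrank_fin_fun, smul_eq_mul]
    _ = ENNReal.ofReal |(t ^ d)⁻¹| * ∫⁻ x in S, F x := by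
        rw [lintegral_add_left_eq_self (S.indicator F) a, lintegral_indicator hS]
    _ ≤ _ := by
        gcongr
        rw [abs_of_pos (by positivity), ← inv_pow]
        refine (ENNReal.ofReal_le_ofReal (pow_le_pow_left₀ (by positivity)
          (inv_anti₀ (by norm_num) ht) d)).trans ?_
        rw [one_div, inv_inv, ENNReal.ofReal_pow (by norm_num)]
        simp

/-- It suffices to bound the mean over y, as some y does not exceed it. For t ≥ 1/2 one substitutes
in x, for t ≤ 1/2 in y, whose coefficient is 1 - t; both Jacobians are at most 2^d. The resulting y
serves as centre of the Taylor expansion. -/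
theorem exists_segment_average_le {S : Set (Fin d → ℝ)} (hS : MeasurableSet S)
    (hc : Convex ℝ S) (h0 : volume S ≠ 0) (htop : volume S ≠ ⊤) {F : (Fin d → ℝ) → ℝ≥0∞}
    (hF : Measurable F) :
    ∃ y ∈ S, ∫⁻ t in Ioc (0 : ℝ) 1, ∫⁻ x in S, F (y + t • (x - y)) ≤ 2 ^ d * ∫⁻ x in S, F x := by
  have hm : Measurable fun z : ((Fin d → ℝ) × ℝ) × (Fin d → ℝ) =>
      F (z.1.1 + z.1.2 • (z.2 - z.1.1)) := by fun_prop
  have hm1 : Measurable fun z : (Fin d → ℝ) × ℝ =>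
      ∫⁻ x in S, F (z.1 + z.2 • (x - z.1)) := hm.lintegral_prod_right'
  have hm2 : Measurable fun y : Fin d → ℝ =>
      ∫⁻ t in Ioc (0 : ℝ) 1, ∫⁻ x in S, F (y + t • (x - y)) := hm1.lintegral_prod_right'
  obtain ⟨y, hy, h⟩ := exists_le_setLAverage h0 htop hm2.aemeasurable
  refine ⟨y, hy, h.trans ?_⟩
  rw [setLAverage_eq]
  refine ENNReal.div_le_of_le_mul ?_
  have key : ∀ t ∈ Ioc (0 : ℝ) 1, ∫⁻ y in S, ∫⁻ x in S, F (y + t • (x - y)) ≤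
      2 ^ d * (∫⁻ x in S, F x) * volume S := by
    intro t ht
    have hbound : ∀ z ∈ S, ∀ r : ℝ, 1 / 2 ≤ r → r ≤ 1 →
        ∫⁻ x in S, F ((1 - r) • z + r • x) ≤ 2 ^ d * ∫⁻ x in S, F x := fun z hz r hr hr1 =>
      lintegral_comp_affine_le hS hr _ (fun x hx => hc hz hx (by linarith) (by linarith)
        (by ring)) hF
    rcases le_total (1 / 2) t with h2 | h2
    · rw [← setLIntegral_const]
      refine setLIntegral_mono measurable_const fun y hy => ?_
      refine (le_of_eq (lintegral_congr fun x => ?_)).trans (hbound y hy t h2 ht.2)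
      congr 1; module
    · have hm3 : Measurable fun z : (Fin d → ℝ) × (Fin d → ℝ) => F (z.1 + t • (z.2 - z.1)) := by
        fun_prop
      rw [lintegral_lintegral_swap hm3.aemeasurable, ← setLIntegral_const]
      refine setLIntegral_mono measurable_const fun x hx => ?_
      refine (le_of_eq (lintegral_congr fun y => ?_)).trans
        (hbound x hx (1 - t) (by linarith) (by linarith [ht.1]))
      congr 1; module
  rw [lintegral_lintegral_swap hm1.aemeasurable]
  calc ∫⁻ t in Ioc (0 : ℝ) 1, ∫⁻ y in S, ∫⁻ x in S, F (y + t • (x - y))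
      ≤ ∫⁻ _ in Ioc (0 : ℝ) 1, 2 ^ d * (∫⁻ x in S, F x) * volume S :=
        setLIntegral_mono measurable_const key
    _ = _ := by rw [setLIntegral_const, Real.volume_Ioc]; simp

/-- Integral remainder of Taylor's formula. The bound 2 is the sup-norm diameter of the reference
patch (-1,1)^d. -/
theorem abs_sub_taylorPoly_le {f : (Fin d → ℝ) → ℝ} (hf : ContDiff ℝ ∞ f) {x y : Fin d → ℝ}
    (hxy : ‖x - y‖ ≤ 2) :
    |f x - taylorPoly P f y x| ≤
      2 ^ (P + 1) * ∫ t in Ioc (0 : ℝ) 1, ‖iteratedFDeriv ℝ (P + 1) f (y + t • (x - y))‖ := by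
  rw [sub_taylorPoly_eq_integral P hf, abs_mul, intervalIntegral.integral_of_le zero_le_one]
  have hcont : Continuous (iteratedFDeriv ℝ (P + 1) f) :=
    hf.continuous_iteratedFDeriv (m := (P + 1 : ℕ)) (by exact_mod_cast le_top)
  have hint : IntegrableOn (fun t : ℝ => ‖iteratedFDeriv ℝ (P + 1) f (y + t • (x - y))‖)
      (Ioc 0 1) := by
    refine (Continuous.integrableOn_Icc ?_).mono_set Ioc_subset_Icc_self
    exact (hcont.comp (by fun_prop)).norm
  have h1 : |((P.factorial : ℝ))⁻¹| ≤ 1 := by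
    rw [abs_of_nonneg (by positivity)]
    exact inv_le_one_of_one_le₀ (by exact_mod_cast P.factorial_pos)
  refine (mul_le_of_le_one_left (abs_nonneg _) h1).trans ?_
  rw [← integral_const_mul, ← Real.norm_eq_abs]
  refine norm_integral_le_of_norm_le (hint.const_mul _) ?_
  filter_upwards [ae_restrict_mem measurableSet_Ioc] with t ht
  rw [norm_mul]
  have h2 : ‖(1 - t) ^ P‖ ≤ 1 := by
    rw [norm_pow]
    refine pow_le_one₀ (norm_nonneg _) ?_
    rw [Real.norm_eq_abs, abs_le]
    constructor <;> linarith [ht.1, ht.2]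
  refine (mul_le_of_le_one_left (norm_nonneg _) h2).trans ?_
  refine (ContinuousMultilinearMap.le_opNorm _ _).trans ?_
  rw [mul_comm]
  refine mul_le_mul_of_nonneg_right ?_ (norm_nonneg _)
  rw [Finset.prod_const, Finset.card_univ, Fintype.card_fin]
  exact pow_le_pow_left₀ (norm_nonneg _) hxy _

theorem patch_eq_pi (σ : ℝ) (i : Fin d → ℤ) : patch σ i =
    Set.pi univ fun l => Ioo (((i l : ℝ) - 1) * σ) (((i l : ℝ) + 1) * σ) := by
  ext x; simp [patch]

theorem isOpen_patch (σ : ℝ) (i : Fin d → ℤ) : IsOpen (patch σ i) := by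
  rw [patch_eq_pi]
  exact isOpen_set_pi finite_univ fun _ _ => isOpen_Ioo

theorem isBounded_patch (σ : ℝ) (i : Fin d → ℤ) : Bornology.IsBounded (patch σ i) := by
  rw [patch_eq_pi]
  exact Bornology.IsBounded.pi fun l => Metric.isBounded_Ioo _ _

theorem convex_patch (σ : ℝ) (i : Fin d → ℤ) : Convex ℝ (patch σ i) := by
  rw [patch_eq_pi]
  exact convex_pi fun _ _ => convex_Ioo _ _

theorem gridPt_add_smul_mem_patch {σ : ℝ} (hσ : 0 < σ) (i : Fin d → ℤ) (y : Fin d → ℝ) :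
    gridPt σ i + σ • y ∈ patch σ i ↔ y ∈ patch 1 0 := by
  simp only [patch, mem_ofPred_eq, gridPt, Pi.add_apply, Pi.smul_apply, smul_eq_mul, mem_Ioo,
    mul_one, Pi.zero_apply, Int.cast_zero]
  refine forall_congr' fun l => and_congr ?_ ?_
  · rw [sub_eq_add_neg, add_mul, add_lt_add_iff_left, mul_comm σ, mul_lt_mul_iff_left₀ hσ, zero_sub]
  · rw [add_mul, add_lt_add_iff_left, mul_comm σ, mul_lt_mul_iff_left₀ hσ, zero_add]

theorem ofReal_l2norm {S : Set (Fin d → ℝ)} {f : (Fin d → ℝ) → ℝ}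
    (hf : MemLp f 2 (volume.restrict S)) :
    eLpNorm f 2 (volume.restrict S) = ENNReal.ofReal (l2norm S f) :=
  (ENNReal.ofReal_toReal hf.eLpNorm_ne_top).symm

theorem l2norm_sum_le {ι : Type*} (s : Finset ι) {S : Set (Fin d → ℝ)}
    {f : ι → (Fin d → ℝ) → ℝ} (hf : ∀ i ∈ s, MemLp (f i) 2 (volume.restrict S)) :
    l2norm S (∑ i ∈ s, f i) ≤ ∑ i ∈ s, l2norm S (f i) := by
  unfold l2norm
  rw [← ENNReal.toReal_sum fun i hi => (hf i hi).eLpNorm_ne_top]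
  exact ENNReal.toReal_mono (ENNReal.sum_ne_top.2 fun i hi => (hf i hi).eLpNorm_ne_top)
    (eLpNorm_sum_le (fun i hi => (hf i hi).1) (by norm_num))

theorem l2norm_mono {S T : Set (Fin d → ℝ)} (hS : MeasurableSet S) (hST : S ⊆ T)
    {f g : (Fin d → ℝ) → ℝ} (hg : MemLp g 2 (volume.restrict T)) (h : ∀ x ∈ S, |f x| ≤ |g x|) :
    l2norm S f ≤ l2norm T g := by
  refine ENNReal.toReal_mono hg.eLpNorm_ne_top ?_
  refine (eLpNorm_mono_ae (g := g) ?_).trans (eLpNorm_mono_measure _ (Measure.restrict_mono hST le_rfl))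
  filter_upwards [ae_restrict_mem hS] with x hx using h x hx

/-- Bramble–Hilbert lemma on the reference patch. -/
theorem exists_polyLE_ref_approx (d P : ℕ) {f : (Fin d → ℝ) → ℝ} (hf : ContDiff ℝ ∞ f) :
    ∃ p ∈ polyLE d P, l2norm (patch 1 0) (f - p) ≤ 2 ^ (P + 1) * 2 ^ d * (d : ℝ) ^ (P + 1) *
      ∑ α ∈ multiIdxEq d (P + 1), l2norm (patch 1 0) (mderiv α f) := by
  set S : Set (Fin d → ℝ) := patch 1 0 with hS
  have hSo : IsOpen S := isOpen_patch 1 0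
  have hSb : Bornology.IsBounded S := isBounded_patch 1 0
  have hcont : Continuous (iteratedFDeriv ℝ (P + 1) f) :=
    hf.continuous_iteratedFDeriv (m := (P + 1 : ℕ)) (by exact_mod_cast le_top)
  let G : (Fin d → ℝ) → ℝ := fun z => ‖iteratedFDeriv ℝ (P + 1) f z‖
  have hG : Continuous G := hcont.norm
  have hne : S.Nonempty := ⟨0, fun l => by simp⟩
  -- The centre y depends on f: it is chosen so that the segment averages of the squared (P+1)-st
  -- derivative are controlled.
  obtain ⟨y, hy, hyavg⟩ := exists_segment_average_le hSo.measurableSet (convex_patch 1 0)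
    (hSo.measure_pos _ hne).ne' hSb.measure_lt_top.ne (F := fun z => ‖G z‖ₑ ^ 2)
    (hG.measurable.enorm.pow_const 2)
  have hp := taylorPoly_mem_polyLE P f y
  refine ⟨_, hp, ?_⟩
  have hfp : MemLp (f - taylorPoly P f y) 2 (volume.restrict S) :=
    memLp_of_continuous_of_isBounded hSb
      (hf.continuous.sub (contDiff_of_mem_polyLE hp).continuous) 2
  have hGm : MemLp G 2 (volume.restrict S) := memLp_of_continuous_of_isBounded hSb hG 2
  let H : (Fin d → ℝ) → ℝ := fun x => ∫ t in Ioc (0 : ℝ) 1, G (y + t • (x - y))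
  have hprob : IsProbabilityMeasure (volume.restrict (Ioc (0 : ℝ) 1)) := ⟨by simp⟩
  have hHle : eLpNorm H 2 (volume.restrict S) ^ 2 ≤
      2 ^ d * eLpNorm G 2 (volume.restrict S) ^ 2 := by
    rw [eLpNorm_two_sq, eLpNorm_two_sq]
    refine (lintegral_enorm_integral_sq_le (volume.restrict S) (volume.restrict (Ioc (0 : ℝ) 1))
      (H := fun x t => G (y + t • (x - y))) ?_).trans ?_
    · exact (hG.comp (by fun_prop)).measurable
    · simp only [eLpNorm_two_sq]
      exact hyavg
  have hle : eLpNorm (f - taylorPoly P f y) 2 (volume.restrict S) ≤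
      ENNReal.ofReal (2 ^ (P + 1)) * eLpNorm H 2 (volume.restrict S) := by
    refine eLpNorm_le_mul_eLpNorm_of_ae_le_mul ?_ 2
    filter_upwards [ae_restrict_mem hSo.measurableSet] with x hx
    have hxy : ‖x - y‖ ≤ 2 := by
      refine (pi_norm_le_iff_of_nonneg (by norm_num)).2 fun l => ?_
      have h1 := hx l
      have h2 := hy l
      simp only [Pi.zero_apply, Int.cast_zero, mul_one, mem_Ioo] at h1 h2
      rw [Pi.sub_apply, Real.norm_eq_abs, abs_le]
      constructor <;> linarith [h1.1, h1.2, h2.1, h2.2]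
    refine (abs_sub_taylorPoly_le hf hxy).trans (mul_le_mul_of_nonneg_left ?_ (by positivity))
    exact le_abs_self _
  have hHle' : eLpNorm H 2 (volume.restrict S) ≤ 2 ^ d * eLpNorm G 2 (volume.restrict S) := by
    refine (ENNReal.pow_right_strictMono two_ne_zero).le_iff_le.1 (hHle.trans ?_)
    show _ ≤ (2 ^ d * eLpNorm G 2 (volume.restrict S)) ^ 2
    rw [mul_pow]
    exact mul_le_mul' (le_self_pow₀ (one_le_pow₀ (by norm_num : (1 : ℝ≥0∞) ≤ 2)) two_ne_zero) le_rfl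
  have hreal : l2norm S (f - taylorPoly P f y) ≤ 2 ^ (P + 1) * (2 ^ d * l2norm S G) := by
    have h1 := hle.trans (mul_le_mul_right hHle' _)
    rw [ofReal_l2norm hfp, ofReal_l2norm hGm] at h1
    have h2 : (2 : ℝ≥0∞) ^ d = ENNReal.ofReal (2 ^ d) := by
      rw [ENNReal.ofReal_pow (by norm_num)]; simp
    rw [h2, ← ENNReal.ofReal_mul (by positivity), ← ENNReal.ofReal_mul (by positivity)] at h1
    refine (ENNReal.ofReal_le_ofReal_iff ?_).1 h1
    have := l2norm_nonneg S G
    positivity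
  have hGle : l2norm S G ≤ (d : ℝ) ^ (P + 1) *
      ∑ α ∈ multiIdxEq d (P + 1), l2norm S (mderiv α f) := by
    have hm : ∀ α ∈ multiIdxEq d (P + 1),
        MemLp (fun x => |mderiv α f x|) 2 (volume.restrict S) := fun α _ =>
      memLp_of_continuous_of_isBounded hSb (continuous_mderiv α hf).abs 2
    have habs : ∀ α, l2norm S (fun x => |mderiv α f x|) = l2norm S (mderiv α f) := fun α => by
      unfold l2norm
      exact congrArg _ (eLpNorm_norm (mderiv α f))
    have h1 : l2norm S G ≤ l2norm S ((d : ℝ) ^ (P + 1) •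
        ∑ α ∈ multiIdxEq d (P + 1), fun x => |mderiv α f x|) := by
      refine l2norm_mono hSo.measurableSet subset_rfl
        ((memLp_finsetSum' _ hm).const_smul _) fun x _ => ?_
      rw [abs_of_nonneg (norm_nonneg _)]
      refine (norm_iteratedFDeriv_le_sum (P + 1) hf x).trans (le_trans (le_of_eq ?_) (le_abs_self _))
      simp [Finset.sum_apply]
    rw [l2norm_smul, abs_of_nonneg (by positivity)] at h1
    refine h1.trans (mul_le_mul_of_nonneg_left ?_ (by positivity))
    exact (l2norm_sum_le _ hm).trans (le_of_eq (Finset.sum_congr rfl fun α _ => habs α))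
  calc l2norm S (f - taylorPoly P f y) ≤ 2 ^ (P + 1) * (2 ^ d * l2norm S G) := hreal
    _ ≤ 2 ^ (P + 1) * (2 ^ d * ((d : ℝ) ^ (P + 1) *
        ∑ α ∈ multiIdxEq d (P + 1), l2norm S (mderiv α f))) := by gcongr
    _ = _ := by ring

/-- Bramble–Hilbert lemma on the patches of the grid. -/
theorem exists_polyLE_patch_approx (d P : ℕ) : ∃ C : ℝ, 0 < C ∧
    ∀ σ : ℝ, 0 < σ → ∀ f : (Fin d → ℝ) → ℝ, ContDiff ℝ ∞ f → ∀ i : Fin d → ℤ,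
      ∃ p ∈ polyLE d P, l2norm (patch σ i) (f - p) ≤
        C * ∑ α ∈ multiIdxEq d (P + 1), σ ^ (P + 1) * l2norm (patch σ i) (mderiv α f) := by
  refine ⟨2 ^ (P + 1) * 2 ^ d * (d : ℝ) ^ (P + 1) + 1, by positivity, fun σ hσ f hf i => ?_⟩
  let f' : (Fin d → ℝ) → ℝ := fun y => f (gridPt σ i + σ • y)
  have hf' : ContDiff ℝ ∞ f' := hf.comp (by fun_prop)
  obtain ⟨q, hq, hle⟩ := exists_polyLE_ref_approx d P hf'
  let p : (Fin d → ℝ) → ℝ := fun x => q (-(σ⁻¹ • gridPt σ i) + σ⁻¹ • x)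
  have hp : p ∈ polyLE d P := comp_affine_mem_polyLE _ _ hq
  refine ⟨p, hp, ?_⟩
  have hpq : ∀ y, p (gridPt σ i + σ • y) = q y := fun y => by
    simp only [p]
    congr 1
    rw [smul_add, smul_smul, inv_mul_cancel₀ hσ.ne', one_smul]
    abel
  have hqs := contDiff_of_mem_polyLE hq
  have hps := contDiff_of_mem_polyLE hp
  have hsc : ∀ {v w : (Fin d → ℝ) → ℝ}, Continuous v → Continuous w →
      (∀ y ∈ patch 1 (0 : Fin d → ℤ), v (gridPt σ i + σ • y) = w y) →
      l2norm (patch σ i) v = √(σ ^ d) * l2norm (patch 1 0) w := fun hv hw h =>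
    l2norm_affine hσ _ (isOpen_patch _ _).measurableSet (isOpen_patch _ _).measurableSet
      (isBounded_patch _ _) (isBounded_patch _ _) (gridPt_add_smul_mem_patch hσ i) hv hw h
  have h1 : l2norm (patch σ i) (f - p) = √(σ ^ d) * l2norm (patch 1 0) (f' - q) :=
    hsc (hf.continuous.sub hps.continuous) (hf'.continuous.sub hqs.continuous) fun y _ => by
      rw [Pi.sub_apply, Pi.sub_apply, hpq]
  have h2 : ∀ α ∈ multiIdxEq d (P + 1), σ ^ (P + 1) * l2norm (patch σ i) (mderiv α f) =
      √(σ ^ d) * l2norm (patch 1 0) (mderiv α f') := fun α hα => by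
    have h3 := hsc (v := σ ^ (P + 1) • mderiv α f) (w := mderiv α f')
      ((continuous_mderiv α hf).const_smul _) (continuous_mderiv α hf') fun y hy => by
        rw [Pi.smul_apply, smul_eq_mul,
          mderiv_affine_eqOn hf (isOpen_patch 1 0) (fun _ _ => rfl) hα hy]
    rw [← h3, l2norm_smul, abs_of_pos (by positivity)]
  rw [h1, Finset.sum_congr rfl h2, ← Finset.mul_sum, mul_left_comm]
  refine mul_le_mul_of_nonneg_left (hle.trans ?_) (Real.sqrt_nonneg _)
  exact mul_le_mul_of_nonneg_right (by linarith)
    (Finset.sum_nonneg fun _ _ => l2norm_nonneg _ _)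

end BrambleHilbert

/-! ### Quasi-interpolation -/

section QuasiInterpolation

variable {d P : ℕ} {σ : ℝ} {Ω : Set (Fin d → ℝ)}

theorem mem_unitVertices {n : Fin d → ℤ} : n ∈ unitVertices d ↔ ∀ l, n l = 0 ∨ n l = 1 := by
  simp [unitVertices, Fintype.mem_piFinset]

theorem zero_mem_unitVertices : (0 : Fin d → ℤ) ∈ unitVertices d :=
  mem_unitVertices.2 fun _ => Or.inl rfl

theorem cell_subset_patch (hσ : 0 < σ) (i : Fin d → ℤ) {n : Fin d → ℤ}
    (hn : n ∈ unitVertices d) : cell σ i ⊆ patch σ (i + n) := by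
  intro x hx l
  have h1 := hx l
  rcases mem_unitVertices.1 hn l with h | h <;>
    simp only [Pi.add_apply, h, Int.cast_add, Int.cast_zero, Int.cast_one] <;>
    constructor <;> nlinarith [h1.1, h1.2]

theorem sub_mem_unitVertices (hσ : 0 < σ) {i j : Fin d → ℤ}
    (h : (patch σ j ∩ cell σ i).Nonempty) : j - i ∈ unitVertices d := by
  obtain ⟨x, hj, hi⟩ := h
  refine mem_unitVertices.2 fun l => ?_
  have h1 := hj l
  have h2 := hi l
  have h3 : (j l : ℝ) - 1 < i l + 1 := lt_of_mul_lt_mul_right (h1.1.trans h2.2) hσ.le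
  have h4 : (i l : ℝ) < j l + 1 := lt_of_mul_lt_mul_right (h2.1.trans h1.2) hσ.le
  have h5 : j l - 1 < i l + 1 := by exact_mod_cast h3
  have h6 : i l < j l + 1 := by exact_mod_cast h4
  rw [Pi.sub_apply]
  omega

theorem cell_subset_fictitious {i : Fin d → ℤ} (hi : i ∈ activeCells Ω σ) :
    cell σ i ⊆ fictitious Ω σ :=
  interior_maximal (fun _ hx => mem_biUnion hi (subset_closure hx)) (isOpen_cell σ i)

theorem cell_nonempty (hσ : 0 < σ) (i : Fin d → ℤ) : (cell σ i).Nonempty :=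
  ⟨fun l => ((i l : ℝ) + 1 / 2) * σ, fun l => ⟨by nlinarith, by nlinarith⟩⟩

theorem patch_inter_fictitious_nonempty (hσ : 0 < σ) {i n : Fin d → ℤ}
    (hi : i ∈ activeCells Ω σ) (hn : n ∈ unitVertices d) :
    (patch σ (i + n) ∩ fictitious Ω σ).Nonempty :=
  (cell_nonempty hσ i).mono (subset_inter (cell_subset_patch hσ i hn) (cell_subset_fictitious hi))

/-- An open patch meeting the fictitious domain meets an active cell, and a bounded Ω has finitely
many active cells, each touched by finitely many patches. -/
theorem finiteDimensional_pufem (hb : Bornology.IsBounded Ω) (hσ : 0 < σ) :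
    FiniteDimensional ℝ (pufem Ω σ P) := by
  refine FiniteDimensional.span_of_finite ℝ ?_
  have hA := finite_activeCells hb hσ
  refine (((hA.prod (unitVertices d).finite_toSet).prod (multiIdxLE d P).finite_toSet).image
    fun z => fun x : Fin d → ℝ => pou σ (z.1.1 + z.1.2) x * ∏ l, x l ^ z.2 l).subset ?_
  rintro _ ⟨j, α, ⟨x, hxj, hx⟩, hα, rfl⟩
  obtain ⟨i, hi, hxi⟩ := mem_iUnion₂.1 (interior_subset hx)
  have hne := mem_closure_iff.1 hxi _ (isOpen_patch σ j) hxj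
  refine ⟨((i, j - i), α), ⟨⟨hi, sub_mem_unitVertices hσ hne⟩, mem_multiIdxLE.2 hα⟩, ?_⟩
  simp

theorem exists_eq_gridPt_add (hσ : 0 < σ) {i : Fin d → ℤ} {x : Fin d → ℝ} (hx : x ∈ cell σ i) :
    ∃ y ∈ cell 1 (0 : Fin d → ℤ), x = gridPt σ i + σ • y := by
  have h : gridPt σ i + σ • (σ⁻¹ • (x - gridPt σ i)) = x := by
    rw [smul_smul, mul_inv_cancel₀ hσ.ne', one_smul]; abel
  refine ⟨σ⁻¹ • (x - gridPt σ i), ?_, h.symm⟩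
  rw [← gridPt_add_smul_mem_cell hσ i 0, h, add_zero]
  exact hx

theorem pou_eq_zero_of_mem_cell (hσ : 0 < σ) {i j : Fin d → ℤ} {x : Fin d → ℝ}
    (hx : x ∈ cell σ i) (hj : j - i ∉ unitVertices d) : pou σ j x = 0 := by
  obtain ⟨y, hy, rfl⟩ := exists_eq_gridPt_add hσ hx
  rw [pou_gridPt hσ]
  refine pou_one_eq_zero ?_
  rw [mem_unitVertices] at hj
  push Not at hj
  obtain ⟨l, hl0, hl1⟩ := hj
  refine ⟨l, ?_⟩
  have h1 := hy l
  simp only [Pi.zero_apply, Int.cast_zero, zero_add, mul_one] at h1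
  rcases (by omega : (j - i) l ≤ -1 ∨ 2 ≤ (j - i) l) with h | h
  · have : (((j - i) l : ℤ) : ℝ) ≤ -1 := by exact_mod_cast h
    exact le_abs.2 (Or.inl (by linarith [h1.1]))
  · have : (2 : ℝ) ≤ (((j - i) l : ℤ) : ℝ) := by exact_mod_cast h
    exact le_abs.2 (Or.inr (by linarith [h1.2]))

theorem sum_pou_cell (hσ : 0 < σ) {i : Fin d → ℤ} {x : Fin d → ℝ} (hx : x ∈ cell σ i) :
    ∑ n ∈ unitVertices d, pou σ (i + n) x = 1 := by
  obtain ⟨y, hy, rfl⟩ := exists_eq_gridPt_add hσ hx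
  rw [← sum_pou_one (y := y) fun l => ?_]
  · refine Finset.sum_congr rfl fun n _ => ?_
    rw [pou_gridPt hσ, add_sub_cancel_left]
  · have h1 := hy l
    simp only [Pi.zero_apply, Int.cast_zero, zero_add, mul_one] at h1
    exact ⟨h1.1.le, h1.2.le⟩

theorem sum_shapeFn_apply (hσ : 0 < σ) {B : Finset (Fin d → ℤ)}
    (p : (Fin d → ℤ) → (Fin d → ℝ) → ℝ) {i : Fin d → ℤ}
    (hB : ∀ n ∈ unitVertices d, i + n ∈ B) {x : Fin d → ℝ} (hx : x ∈ cell σ i) :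
    (∑ j ∈ B, shapeFn σ j (p j)) x = ∑ n ∈ unitVertices d, pou σ (i + n) x * p (i + n) x := by
  classical
  have h1 : ∑ n ∈ unitVertices d, pou σ (i + n) x * p (i + n) x =
      ∑ j ∈ (unitVertices d).map (addLeftEmbedding i), pou σ j x * p j x :=
    (Finset.sum_map (unitVertices d) (addLeftEmbedding i) fun j => pou σ j x * p j x).symm
  rw [Finset.sum_apply, h1]
  refine (Finset.sum_subset ?_ ?_).symm
  · intro j hj
    obtain ⟨n, hn, rfl⟩ := Finset.mem_map.1 hj
    exact hB n hn
  · intro j _ hj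
    show pou σ j x * p j x = 0
    rw [pou_eq_zero_of_mem_cell hσ hx, zero_mul]
    exact fun h => hj (Finset.mem_map.2 ⟨j - i, h, by simp⟩)

/-- On the cell the partition functions sum to 1, so g - w is the sum of φ_j (g - p_j), with weights
between 0 and 1. -/
theorem l2norm_cell_sub_le (hσ : 0 < σ) {w g : (Fin d → ℝ) → ℝ} (hg : ContDiff ℝ ∞ g)
    {p : (Fin d → ℤ) → (Fin d → ℝ) → ℝ} (hp : ∀ j, p j ∈ polyLE d P) {i : Fin d → ℤ}
    (hw : ∀ x ∈ cell σ i, w x = ∑ n ∈ unitVertices d, pou σ (i + n) x * p (i + n) x) :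
    l2norm (cell σ i) (g - w) ≤
      ∑ n ∈ unitVertices d, l2norm (patch σ (i + n)) (g - p (i + n)) := by
  have hs : ∀ j, Continuous (g - p j) := fun j =>
    hg.continuous.sub (contDiff_of_mem_polyLE (hp j)).continuous
  have hss : ∀ j, Continuous (shapeFn σ j (g - p j)) := fun j =>
    (contDiff_pou hσ j).continuous.mul (hs j)
  have hm : ∀ n ∈ unitVertices d, MemLp (shapeFn σ (i + n) (g - p (i + n))) 2
      (volume.restrict (cell σ i)) := fun n _ =>
    memLp_of_continuous_of_isBounded (isBounded_cell σ i) (hss _) 2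
  have h1 : l2norm (cell σ i) (g - w) ≤
      l2norm (cell σ i) (∑ n ∈ unitVertices d, shapeFn σ (i + n) (g - p (i + n))) := by
    refine l2norm_mono (measurableSet_cell σ i) subset_rfl (memLp_finsetSum' _ hm) fun x hx => ?_
    refine le_of_eq (congrArg _ ?_)
    rw [Pi.sub_apply, hw x hx, Finset.sum_apply]
    simp only [shapeFn, Pi.sub_apply, mul_sub, Finset.sum_sub_distrib]
    rw [← Finset.sum_mul, sum_pou_cell hσ hx, one_mul]
  refine h1.trans ((l2norm_sum_le _ hm).trans (Finset.sum_le_sum fun n hn => ?_))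
  refine l2norm_mono (measurableSet_cell σ i) (cell_subset_patch hσ i hn)
    (memLp_of_continuous_of_isBounded (isBounded_patch _ _) (hs _) 2) fun x _ => ?_
  rw [shapeFn, abs_mul, abs_of_nonneg (pou_nonneg hσ _ _)]
  exact mul_le_of_le_one_left (abs_nonneg _) (pou_le_one hσ _ _)

/-- On the cell w is p_i plus a combination v of the differences p_(i+n) - p_i. Derivatives of order
P+1 annihilate p_i, and the inverse estimate need only be applied to v, which is as small as the
local approximation error of g. Applied to w itself it would give no smallness. -/
theorem exists_cellEnergy_quasi_le (d P : ℕ) : ∃ C : ℝ, 0 < C ∧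
    ∀ σ : ℝ, 0 < σ → ∀ w g : (Fin d → ℝ) → ℝ, ContDiff ℝ ∞ w → ContDiff ℝ ∞ g →
    ∀ p : (Fin d → ℤ) → (Fin d → ℝ) → ℝ, (∀ j, p j ∈ polyLE d P) → ∀ i : Fin d → ℤ,
    (∀ x ∈ cell σ i, w x = ∑ n ∈ unitVertices d, pou σ (i + n) x * p (i + n) x) →
    cellEnergy σ P i w ≤
      C * (∑ n ∈ unitVertices d, l2norm (patch σ (i + n)) (g - p (i + n))) ^ 2 := by
  obtain ⟨C, hC, h⟩ := exists_cellEnergy_le d P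
  -- The norm of v is at most 2X, by the triangle inequality through g; squaring gives the 4.
  refine ⟨4 * C, by positivity, fun σ hσ w g hw hg p hp i hwi => ?_⟩
  set X := ∑ n ∈ unitVertices d, l2norm (patch σ (i + n)) (g - p (i + n)) with hX
  have hps := fun j => contDiff_of_mem_polyLE (hp j)
  let v : (Fin d → ℝ) → ℝ := ∑ n ∈ unitVertices d, shapeFn σ (i + n) (p (i + n) - p i)
  have hv : v ∈ pufemAll d σ P := Submodule.sum_mem _ fun n _ =>
    shapeFn_mem_pufemAll σ _ (Submodule.sub_mem _ (hp _) (hp _))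
  have hvs := contDiff_of_mem_pufemAll hσ hv
  have hvw : EqOn w (v + p i) (cell σ i) := fun x hx => by
    rw [hwi x hx, Pi.add_apply]
    simp only [v, Finset.sum_apply, shapeFn, Pi.sub_apply, mul_sub, Finset.sum_sub_distrib]
    rw [← Finset.sum_mul, sum_pou_cell hσ hx]
    ring
  have hE : cellEnergy σ P i w = cellEnergy σ P i v := by
    refine Finset.sum_congr rfl fun α hα => ?_
    have h1 : EqOn (mderiv α w) (mderiv α v) (cell σ i) := fun x hx => by
      rw [mderiv_eqOn α (isOpen_cell σ i) hvw hx, mderiv_add α hvs (hps i),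
        mderiv_of_mem_polyLE hα (hp i), add_zero]
    congr 2
    unfold l2norm
    rw [eLpNorm_congr_ae ((ae_restrict_iff' (measurableSet_cell σ i)).2
      (Filter.Eventually.of_forall h1))]
  have h1 := l2norm_cell_sub_le hσ hg hp hwi
  have h2 : l2norm (cell σ i) (g - p i) ≤ X := by
    have h3 : l2norm (cell σ i) (g - p i) ≤ l2norm (patch σ (i + 0)) (g - p (i + 0)) := by
      refine l2norm_mono (measurableSet_cell σ i) (cell_subset_patch hσ i zero_mem_unitVertices)
        (memLp_of_continuous_of_isBounded (isBounded_patch _ _)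
          (hg.continuous.sub (hps _).continuous) 2) fun x _ => ?_
      rw [add_zero]
    exact h3.trans (Finset.single_le_sum
      (f := fun n => l2norm (patch σ (i + n)) (g - p (i + n)))
      (fun n _ => l2norm_nonneg _ _) zero_mem_unitVertices)
  have h4 : l2norm (cell σ i) v ≤ X + X := by
    have hm1 : MemLp (g - w) 2 (volume.restrict (cell σ i)) :=
      memLp_of_continuous_of_isBounded (isBounded_cell σ i) (hg.continuous.sub hw.continuous) 2
    have hm2 : MemLp (g - p i) 2 (volume.restrict (cell σ i)) :=
      memLp_of_continuous_of_isBounded (isBounded_cell σ i)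
        (hg.continuous.sub (hps i).continuous) 2
    have h5 : l2norm (cell σ i) v ≤ l2norm (cell σ i) ((-1 : ℝ) • (g - w) + (g - p i)) := by
      refine l2norm_mono (measurableSet_cell σ i) subset_rfl ((hm1.const_smul _).add hm2)
        fun x hx => le_of_eq (congrArg _ ?_)
      have := hvw hx
      simp only [Pi.add_apply, Pi.smul_apply, Pi.sub_apply, smul_eq_mul] at this ⊢
      linarith
    refine h5.trans ((l2norm_add_le (hm1.const_smul _) hm2).trans (add_le_add ?_ h2))
    rw [l2norm_smul]
    simpa using h1
  rw [hE]
  refine (h σ hσ v hv i).trans ?_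
  have := pow_le_pow_left₀ (l2norm_nonneg _ _) h4 2
  calc C * l2norm (cell σ i) v ^ 2 ≤ C * (X + X) ^ 2 := by gcongr
    _ = _ := by ring

theorem sum_cells_shift_le (hσ : 0 < σ) (A : Finset (Fin d → ℤ)) (n : Fin d → ℤ)
    {F : (Fin d → ℝ) → ℝ} (hF : Continuous F) (h0 : ∀ x, 0 ≤ F x) (hi : Integrable F) :
    ∑ i ∈ A, ∫ x in cell σ (i + n), F x ≤ ∫ x, F x := by
  have h1 : ∑ i ∈ A, ∫ x in cell σ (i + n), F x =
      ∑ i ∈ A.map (addRightEmbedding n), ∫ x in cell σ i, F x :=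
    (Finset.sum_map A (addRightEmbedding n) fun i => ∫ x in cell σ i, F x).symm
  rw [h1, ← integral_biUnion_cells hσ _ hF]
  exact setIntegral_le_integral hi (Filter.Eventually.of_forall h0)

/-- Finite overlap: up to a null set a patch is a union of cells, one per vertex offset, and for a
fixed offset these cells are disjoint. -/
theorem sum_patches_le (hσ : 0 < σ) (A : Finset (Fin d → ℤ)) (n : Fin d → ℤ)
    {F : (Fin d → ℝ) → ℝ} (hF : Continuous F) (h0 : ∀ x, 0 ≤ F x) (hi : Integrable F) :
    ∑ i ∈ A, ∫ x in patch σ (i + n), F x ≤ (unitVertices d).card * ∫ x, F x := by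
  classical
  have h1 : ∀ j : Fin d → ℤ, ∫ x in patch σ j, F x ≤
      ∑ r ∈ unitVertices d, ∫ x in cell σ (j - r), F x := fun j => by
    -- Here the patch itself plays the role of the domain.
    have h2 := setIntegral_le_sum_cells (Ω := patch σ j)
      (A := (unitVertices d).image fun r => j - r) hσ ?_ hF h0
    · rwa [Finset.sum_image fun a _ b _ h => sub_right_injective h] at h2
    · intro i hi
      have hne : (patch σ j ∩ cell σ i).Nonempty := by
        rw [inter_comm]; exact nonempty_of_measure_ne_zero (ne_of_gt hi)
      rw [Finset.mem_coe, Finset.mem_image]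
      exact ⟨j - i, sub_mem_unitVertices hσ hne, by simp⟩
  refine (Finset.sum_le_sum fun i _ => h1 (i + n)).trans ?_
  rw [Finset.sum_comm, ← nsmul_eq_mul]
  refine Finset.sum_le_card_nsmul _ _ _ fun r _ => ?_
  simp only [add_sub_assoc]
  exact sum_cells_shift_le hσ A (n - r) hF h0 hi

/-- Approximation of smooth functions by the finite element space. -/
theorem exists_quasiInterpolant (d P : ℕ) : ∃ C : ℝ, 0 < C ∧
    ∀ (Ω : Set (Fin d → ℝ)) (σ : ℝ), 0 < σ → ∀ A : Finset (Fin d → ℤ),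
    (∀ i, i ∈ A ↔ i ∈ activeCells Ω σ) → ∀ g : (Fin d → ℝ) → ℝ, ContDiff ℝ ∞ g →
    (∀ α ∈ multiIdxEq d (P + 1), MemLp (mderiv α g) 2 volume) →
    ∀ S : ℝ, 0 ≤ S → ∑ α ∈ multiIdxEq d (P + 1), ∫ x, mderiv α g x ^ 2 ≤ S ^ 2 →
    ∃ w ∈ pufem Ω σ P, cellNorm σ A (g - w) ≤ C * σ ^ (P + 1) * S ∧
      √(∑ i ∈ A, cellEnergy σ P i w) ≤ C * σ ^ (P + 1) * S := by
  classical
  obtain ⟨C₁, hC₁, hBH⟩ := exists_polyLE_patch_approx d P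
  obtain ⟨C₂, hC₂, hE⟩ := exists_cellEnergy_quasi_le d P
  set J := unitVertices d ×ˢ multiIdxEq d (P + 1) with hJ
  -- Squared Bramble–Hilbert constant, Cauchy–Schwarz over J, then the number of patches per cell
  -- times the number of cells per patch.
  set M : ℝ := C₁ ^ 2 * J.card * ((unitVertices d).card * (unitVertices d).card) with hM
  have hM0 : 0 ≤ M := by positivity
  refine ⟨√((1 + C₂) * M) + 1, by positivity, fun Ω σ hσ A hA g hg hgm S hS hgS => ?_⟩
  choose p hp hpg using hBH σ hσ g hg
  -- The vertices of active cells: their patches meet the fictitious domain, and no other partition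
  -- functions are nonzero on active cells.
  let B : Finset (Fin d → ℤ) := (A ×ˢ unitVertices d).image fun z => z.1 + z.2
  have hB : ∀ i ∈ A, ∀ n ∈ unitVertices d, i + n ∈ B := fun i hi n hn =>
    Finset.mem_image.2 ⟨(i, n), Finset.mem_product.2 ⟨hi, hn⟩, rfl⟩
  let w : (Fin d → ℝ) → ℝ := ∑ j ∈ B, shapeFn σ j (p j)
  have hw : w ∈ pufem Ω σ P := by
    refine Submodule.sum_mem _ fun j hj => ?_
    obtain ⟨⟨i, n⟩, hin, rfl⟩ := Finset.mem_image.1 hj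
    obtain ⟨hi, hn⟩ := Finset.mem_product.1 hin
    exact shapeFn_mem_pufem (patch_inter_fictitious_nonempty hσ ((hA i).1 hi) hn) (hp _)
  have hws := contDiff_of_mem_pufemAll hσ (pufem_le_pufemAll Ω σ hw)
  have hwi : ∀ i ∈ A, ∀ x ∈ cell σ i,
      w x = ∑ n ∈ unitVertices d, pou σ (i + n) x * p (i + n) x := fun i hi x hx =>
    sum_shapeFn_apply hσ p (hB i hi) hx
  let X : (Fin d → ℤ) → ℝ := fun i =>
    ∑ n ∈ unitVertices d, l2norm (patch σ (i + n)) (g - p (i + n))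
  have hX0 : ∀ i, 0 ≤ X i := fun i => Finset.sum_nonneg fun _ _ => l2norm_nonneg _ _
  have hX : ∀ i, X i ^ 2 ≤ C₁ ^ 2 * J.card * (σ ^ (P + 1)) ^ 2 *
      ∑ n ∈ unitVertices d, ∑ α ∈ multiIdxEq d (P + 1),
        ∫ x in patch σ (i + n), mderiv α g x ^ 2 := fun i => by
    have h1 : X i ≤ C₁ * ∑ z ∈ J, σ ^ (P + 1) * l2norm (patch σ (i + z.1)) (mderiv z.2 g) := by
      rw [hJ, Finset.sum_product, Finset.mul_sum]
      exact Finset.sum_le_sum fun n _ => hpg (i + n)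
    refine (pow_le_pow_left₀ (hX0 i) h1 2).trans ?_
    rw [mul_pow, ← Finset.mul_sum, mul_pow]
    have h2 : (∑ z ∈ J, l2norm (patch σ (i + z.1)) (mderiv z.2 g)) ^ 2 ≤ J.card *
        ∑ n ∈ unitVertices d, ∑ α ∈ multiIdxEq d (P + 1),
          ∫ x in patch σ (i + n), mderiv α g x ^ 2 := by
      refine sq_sum_le_card_mul_sum_sq.trans (le_of_eq ?_)
      rw [hJ, Finset.sum_product]
      congr 1
      refine Finset.sum_congr rfl fun n _ => Finset.sum_congr rfl fun α _ => ?_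
      exact l2norm_sq (memLp_of_continuous_of_isBounded (isBounded_patch _ _)
        (continuous_mderiv α hg) 2)
    calc C₁ ^ 2 * ((σ ^ (P + 1)) ^ 2 *
          (∑ z ∈ J, l2norm (patch σ (i + z.1)) (mderiv z.2 g)) ^ 2)
        ≤ C₁ ^ 2 * ((σ ^ (P + 1)) ^ 2 * (J.card * ∑ n ∈ unitVertices d,
          ∑ α ∈ multiIdxEq d (P + 1), ∫ x in patch σ (i + n), mderiv α g x ^ 2)) := by gcongr
      _ = _ := by ring
  have hsum : ∑ i ∈ A, X i ^ 2 ≤ M * (σ ^ (P + 1)) ^ 2 * S ^ 2 := by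
    have h1 : ∑ i ∈ A, ∑ n ∈ unitVertices d, ∑ α ∈ multiIdxEq d (P + 1),
        ∫ x in patch σ (i + n), mderiv α g x ^ 2 ≤
        (unitVertices d).card * ((unitVertices d).card * S ^ 2) := by
      rw [Finset.sum_comm, ← nsmul_eq_mul]
      refine Finset.sum_le_card_nsmul _ _ _ fun n _ => ?_
      rw [Finset.sum_comm]
      refine (Finset.sum_le_sum fun α hα => sum_patches_le hσ A n
        ((continuous_mderiv α hg).pow 2) (fun x => sq_nonneg _)
        (hgm α hα).integrable_sq).trans ?_
      rw [← Finset.mul_sum]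
      exact mul_le_mul_of_nonneg_left hgS (Nat.cast_nonneg _)
    refine (Finset.sum_le_sum fun i _ => hX i).trans ?_
    rw [← Finset.mul_sum]
    calc _ ≤ C₁ ^ 2 * J.card * (σ ^ (P + 1)) ^ 2 *
          ((unitVertices d).card * ((unitVertices d).card * S ^ 2)) := by gcongr
      _ = _ := by rw [hM]; ring
  have hfin : ∀ T : ℝ, T ≤ (1 + C₂) * ∑ i ∈ A, X i ^ 2 →
      √T ≤ (√((1 + C₂) * M) + 1) * σ ^ (P + 1) * S := fun T hT => by
    have h1 : T ≤ ((1 + C₂) * M) * (σ ^ (P + 1) * S) ^ 2 := hT.trans (by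
      calc _ ≤ (1 + C₂) * (M * (σ ^ (P + 1)) ^ 2 * S ^ 2) := by gcongr
        _ = _ := by ring)
    refine (Real.sqrt_le_sqrt h1).trans ?_
    rw [Real.sqrt_mul (by positivity), Real.sqrt_sq (by positivity), mul_assoc]
    gcongr
    linarith
  have hXs : 0 ≤ ∑ i ∈ A, X i ^ 2 := Finset.sum_nonneg fun _ _ => sq_nonneg _
  refine ⟨w, hw, hfin _ ?_, hfin _ ?_⟩
  · refine le_trans (Finset.sum_le_sum fun i hi => pow_le_pow_left₀ (l2norm_nonneg _ _)
      (l2norm_cell_sub_le hσ hg hp (hwi i hi)) 2) ?_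
    nlinarith
  · refine (Finset.sum_le_sum fun i hi => hE σ hσ w g hws hg p hp i (hwi i hi)).trans ?_
    rw [← Finset.mul_sum]
    nlinarith

end QuasiInterpolation

/-! ### The discrete problem -/

section Discrete

variable {d P m : ℕ} {σ ε : ℝ} {Ω : Set (Fin d → ℝ)} {A : Finset (Fin d → ℤ)}

theorem cellNorm_add_le {v w : (Fin d → ℝ) → ℝ} (hv : Continuous v) (hw : Continuous w) :
    cellNorm σ A (v + w) ≤ cellNorm σ A v + cellNorm σ A w := by
  have hN := cellNorm_nonneg σ A v
  have hN' := cellNorm_nonneg σ A w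
  refine abs_le_of_sq_le_sq' ?_ (add_nonneg hN hN') |>.2
  have h1 : cellNorm σ A (v + w) ^ 2 ≤
      ∑ i ∈ A, (l2norm (cell σ i) v + l2norm (cell σ i) w) ^ 2 := by
    rw [cellNorm_sq]
    exact Finset.sum_le_sum fun i _ => pow_le_pow_left₀ (l2norm_nonneg _ _)
      (l2norm_add_le (memLp_of_continuous_of_isBounded (isBounded_cell σ i) hv 2)
        (memLp_of_continuous_of_isBounded (isBounded_cell σ i) hw 2)) 2
  refine h1.trans ?_
  have h2 := sum_l2norm_mul_le σ A v w
  simp only [add_sq, Finset.sum_add_distrib, mul_assoc, ← Finset.mul_sum, cellNorm_sq]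
  linarith

theorem cellNorm_smul (c : ℝ) (v : (Fin d → ℝ) → ℝ) :
    cellNorm σ A (c • v) = |c| * cellNorm σ A v := by
  unfold cellNorm
  simp only [l2norm_smul, mul_pow, ← Finset.mul_sum]
  rw [Real.sqrt_mul (sq_nonneg _), Real.sqrt_sq (abs_nonneg c)]

theorem cellNorm_le_l2norm_univ (hσ : 0 < σ) {g : (Fin d → ℝ) → ℝ} (hg : Continuous g)
    (hm : MemLp g 2 volume) : cellNorm σ A g ≤ l2norm univ g := by
  have hm' : MemLp g 2 (volume.restrict univ) := by rwa [Measure.restrict_univ]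
  refine abs_le_of_sq_le_sq' ?_ (l2norm_nonneg _ _) |>.2
  rw [l2norm_sq hm', Measure.restrict_univ, cellNorm_sq]
  have h := sum_cells_shift_le hσ A 0 (hg.pow 2) (fun x => sq_nonneg (g x)) hm.integrable_sq
  simp only [add_zero] at h
  exact (Finset.sum_le_sum fun i _ => (l2norm_cell_sq i hg).le).trans h

theorem cellNorm_le_of_forall_le {v w : (Fin d → ℝ) → ℝ} {c : ℝ} (hc : 0 ≤ c)
    (h : ∀ i ∈ A, l2norm (cell σ i) v ≤ c * l2norm (cell σ i) w) :
    cellNorm σ A v ≤ c * cellNorm σ A w := by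
  refine abs_le_of_sq_le_sq' ?_ (mul_nonneg hc (cellNorm_nonneg _ _ _)) |>.2
  rw [mul_pow, cellNorm_sq, cellNorm_sq, Finset.mul_sum]
  refine Finset.sum_le_sum fun i hi => ?_
  rw [← mul_pow]
  exact pow_le_pow_left₀ (l2norm_nonneg _ _) (h i hi) 2

/-- The seminorm of the product over Ω is enlarged to whole active cells; there the inverse estimate
for products costs σ^(-(m+1)), and Cauchy–Schwarz sums over the cells. -/
theorem exists_quadrature_error_le (d P m : ℕ) : ∃ C : ℝ, 0 < C ∧
    ∀ Ω : Set (Fin d → ℝ), IsOpen Ω → Bornology.IsBounded Ω → ∀ σ h CQ : ℝ, 0 < σ → 0 ≤ h →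
    ∀ A : Finset (Fin d → ℤ), activeCells Ω σ ⊆ A →
    ∀ I : ((Fin d → ℝ) → ℝ) →ₗ[ℝ] ℝ, QuadratureBound Ω m h CQ I →
    ∀ v ∈ pufemAll d σ P, ∀ w ∈ pufemAll d σ P,
      |(∫ x in Ω, v x * w x) - I (fun x => v x * w x)| ≤
        |CQ| * C * (h ^ (m + 1) * (σ ^ (m + 1))⁻¹) * (cellNorm σ A v * cellNorm σ A w) := by
  obtain ⟨C, hC, hE⟩ := exists_integral_abs_mderiv_mul_le d P (m + 1)
  set M := multiIdxEq d (m + 1) with hM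
  refine ⟨M.card * C + 1, by positivity,
    fun Ω hΩ hb σ h CQ hσ hh A hA I hI v hv w hw => ?_⟩
  have hvw : ContDiff ℝ ∞ fun x => v x * w x :=
    (contDiff_of_mem_pufemAll hσ hv).mul (contDiff_of_mem_pufemAll hσ hw)
  set N := cellNorm σ A v * cellNorm σ A w with hN
  have hN0 : 0 ≤ N := mul_nonneg (cellNorm_nonneg _ _ _) (cellNorm_nonneg _ _ _)
  have hto := toFn_sobolevOf (p := 1) (m + 1) hb hvw
  refine (hI _ hvw.continuous _ hto).trans ?_
  rw [sobolevSeminorm_eq hΩ hb hvw hto]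
  have h1 : ∀ α ∈ M, ∫ x in Ω, |mderiv α (fun x => v x * w x) x| ≤
      (σ ^ (m + 1))⁻¹ * (C * N) := fun α hα => by
    rw [le_inv_mul_iff₀ (by positivity)]
    refine (mul_le_mul_of_nonneg_left (setIntegral_le_sum_cells hσ hA
      (continuous_mderiv α hvw).abs fun x => abs_nonneg _) (by positivity)).trans ?_
    rw [Finset.mul_sum]
    refine (Finset.sum_le_sum fun i _ => hE σ hσ v hv w hw i α hα).trans ?_
    rw [← Finset.mul_sum]
    exact mul_le_mul_of_nonneg_left (sum_l2norm_mul_le σ A v w) hC.le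
  have h2 := Finset.sum_le_card_nsmul M _ _ h1
  rw [nsmul_eq_mul] at h2
  have h3 : 0 ≤ ∑ α ∈ M, ∫ x in Ω, |mderiv α (fun x => v x * w x) x| :=
    Finset.sum_nonneg fun α _ => integral_nonneg fun x => abs_nonneg _
  calc CQ * h ^ (m + 1) * ∑ α ∈ M, ∫ x in Ω, |mderiv α (fun x => v x * w x) x|
      ≤ |CQ| * h ^ (m + 1) * (M.card * ((σ ^ (m + 1))⁻¹ * (C * N))) := by
        gcongr
        exact le_abs_self _
    _ = |CQ| * (M.card * C) * (h ^ (m + 1) * (σ ^ (m + 1))⁻¹) * N := by ring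
    _ ≤ _ := by
        gcongr
        linarith

/-- Inverse estimates for every order up to k; since σ ≤ 1, the highest order dominates. Used to
pair the data error, given in a dual norm, with discrete functions. -/
theorem exists_norm_sobolevOf_le (d P k : ℕ) : ∃ C : ℝ, 0 < C ∧
    ∀ Ω : Set (Fin d → ℝ), IsOpen Ω → Bornology.IsBounded Ω → ∀ σ : ℝ, 0 < σ → σ ≤ 1 →
    ∀ A : Finset (Fin d → ℤ), activeCells Ω σ ⊆ A → ∀ v ∈ pufemAll d σ P,
      ‖sobolevOf k 2 Ω v‖ ≤ C * (σ ^ k)⁻¹ * cellNorm σ A v := by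
  choose C hC hE using exists_l2norm_mderiv_le d P
  refine ⟨∑ α ∈ multiIdxLE d k, C (∑ l, α l),
    Finset.sum_pos (fun _ _ => hC _) ⟨0, zero_mem_multiIdxLE d k⟩,
    fun Ω hΩ hb σ hσ hσ1 A hA v hv => ?_⟩
  have hvs := contDiff_of_mem_pufemAll hσ hv
  refine (norm_sobolevOf_le k hΩ hb hvs).trans ?_
  rw [Finset.sum_mul, Finset.sum_mul]
  refine Finset.sum_le_sum fun α hα => ?_
  refine (l2norm_le_cellNorm hσ hb hA (continuous_mderiv α hvs)).trans ?_
  refine cellNorm_le_of_forall_le (mul_nonneg (hC _).le (by positivity)) fun i _ => ?_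
  have h1 := hE (∑ l, α l) σ hσ v hv i α (mem_multiIdxEq.2 rfl)
  rw [← le_inv_mul_iff₀ (by positivity)] at h1
  refine h1.trans ?_
  have h2 : (σ ^ (∑ l, α l))⁻¹ ≤ (σ ^ k)⁻¹ :=
    inv_anti₀ (by positivity) (pow_le_pow_of_le_one hσ.le hσ1 (mem_multiIdxLE.1 hα))
  have h3 := mul_nonneg (hC (∑ l, α l)).le (l2norm_nonneg (cell σ i) v)
  nlinarith

theorem exists_sqrt_cellEnergy_le (d P : ℕ) : ∃ C : ℝ, 0 < C ∧
    ∀ σ : ℝ, 0 < σ → ∀ A B : Finset (Fin d → ℤ), B ⊆ A → ∀ v ∈ pufemAll d σ P,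
      √(∑ i ∈ B, cellEnergy σ P i v) ≤ C * cellNorm σ A v := by
  obtain ⟨C, hC, h⟩ := exists_cellEnergy_le d P
  refine ⟨√C, by positivity, fun σ hσ A B hBA v hv => ?_⟩
  unfold cellNorm
  rw [← Real.sqrt_mul hC.le]
  refine Real.sqrt_le_sqrt ?_
  rw [Finset.mul_sum]
  exact (Finset.sum_le_sum_of_subset_of_nonneg hBA fun i _ _ => cellEnergy_nonneg _ _ _ _).trans
    (Finset.sum_le_sum fun i _ => h σ hσ v hv i)

/-- Coercivity of the perturbed form. -/
theorem exists_coercive (d P m K : ℕ) (hε : 0 < ε) (CQ : ℝ) : ∃ c δ : ℝ, 0 < c ∧ 0 < δ ∧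
    ∀ Ω : Set (Fin d → ℝ), IsOpen Ω → Bornology.IsBounded Ω → ∀ σ h : ℝ, 0 < σ → 0 ≤ h →
    h ^ (m + 1) * (σ ^ (m + 1))⁻¹ ≤ δ → CutCellsReach Ω σ K →
    ∀ A : Finset (Fin d → ℤ), (∀ i, i ∈ A ↔ i ∈ activeCells Ω σ) →
    ∀ I : ((Fin d → ℝ) → ℝ) →ₗ[ℝ] ℝ, QuadratureBound Ω m h CQ I →
    ∀ v ∈ pufemAll d σ P, c * cellNorm σ A v ^ 2 ≤ formAh Ω σ P ε I v v := by
  classical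
  obtain ⟨C, hC, hco⟩ := exists_cellNorm_sq_le d P K
  obtain ⟨q, hq, hqu⟩ := exists_quadrature_error_le d P m
  set c := min 1 ε / C with hc
  have hmin : 0 < min 1 ε := lt_min one_pos hε
  have hc0 : 0 < c := by positivity
  -- The exact form has coercivity constant c; the threshold δ ensures that the quadrature error
  -- consumes at most half of it.
  refine ⟨c / 2, c / 2 / (|CQ| * q + 1), by positivity, by positivity,
    fun Ω hΩ hb σ h hσ hh hδ hK A hA I hI v hv => ?_⟩
  have hvs := contDiff_of_mem_pufemAll hσ hv
  have hAs : activeCells Ω σ ⊆ A := fun i hi => (hA i).2 hi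
  let B := A.filter fun i => ¬ cell σ i ⊆ Ω
  have hB : ∀ i, i ∈ B ↔ i ∈ cutCells Ω σ := fun i => by
    simp [B, hA, cutCells]
  have h1 := hco Ω σ hσ hK A B hA hB v hv
  have h2 := hqu Ω hΩ hb σ h CQ hσ hh A hAs I hI v hv v hv
  have h3 : ∑ i ∈ A \ B, l2norm (cell σ i) v ^ 2 ≤ ∫ x in Ω, v x * v x := by
    have h4 := sum_cells_le_setIntegral (Ω := Ω) (A := A \ B) hσ hb (fun i hi => by
      simp only [B, Finset.mem_sdiff, Finset.mem_filter, not_and, not_not] at hi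
      exact hi.2 hi.1) (hvs.continuous.pow 2) fun x => sq_nonneg (v x)
    simp only [← sq]
    exact (Finset.sum_le_sum fun i _ => (l2norm_cell_sq i hvs.continuous).le).trans h4
  have h5 := stab_self_eq_sum (P := P) hB hvs
  have hE : 0 ≤ ∑ i ∈ B, cellEnergy σ P i v :=
    Finset.sum_nonneg fun i _ => cellEnergy_nonneg _ _ _ _
  have hL : 0 ≤ ∑ i ∈ A \ B, l2norm (cell σ i) v ^ 2 := Finset.sum_nonneg fun i _ => sq_nonneg _
  have h6 : c * cellNorm σ A v ^ 2 ≤ (∫ x in Ω, v x * v x) + ε * stab Ω σ P v v := by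
    rw [h5]
    calc c * cellNorm σ A v ^ 2 ≤ c * (C * (∑ i ∈ A \ B, l2norm (cell σ i) v ^ 2 +
          ∑ i ∈ B, cellEnergy σ P i v)) := by gcongr
      _ = min 1 ε * ∑ i ∈ A \ B, l2norm (cell σ i) v ^ 2 +
          min 1 ε * ∑ i ∈ B, cellEnergy σ P i v := by
          rw [hc]; field_simp
      _ ≤ 1 * (∫ x in Ω, v x * v x) + ε * ∑ i ∈ B, cellEnergy σ P i v := by
          refine add_le_add (mul_le_mul (min_le_left _ _) h3 hL zero_le_one) ?_
          exact mul_le_mul_of_nonneg_right (min_le_right _ _) hE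
      _ = _ := by rw [one_mul]
  have h7 : |CQ| * q * (h ^ (m + 1) * (σ ^ (m + 1))⁻¹) ≤ c / 2 := by
    have hx : 0 ≤ h ^ (m + 1) * (σ ^ (m + 1))⁻¹ := by positivity
    rw [le_div_iff₀ (by positivity)] at hδ
    nlinarith
  have h8 := (le_abs_self _).trans h2
  have h9 := mul_le_mul_of_nonneg_right h7 (sq_nonneg (cellNorm σ A v))
  rw [← sq] at h8
  unfold formAh
  linarith

/-- The quantity equals σ^((s-1)(m+1)), which tends to 0 because s > 1. -/
theorem exists_rpow_small (m : ℕ) {s δ : ℝ} (hs : 1 < s) (hδ : 0 < δ) : ∃ σ₀ : ℝ, 0 < σ₀ ∧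
    ∀ σ : ℝ, 0 < σ → σ < σ₀ → (σ ^ s) ^ (m + 1) * (σ ^ (m + 1))⁻¹ ≤ δ := by
  have hcont : ContinuousAt (fun σ : ℝ => (σ ^ (s - 1)) ^ (m + 1)) 0 :=
    (Real.continuousAt_rpow_const 0 (s - 1) (Or.inr (by linarith))).pow _
  obtain ⟨r, hr, h⟩ := Metric.continuousAt_iff.1 hcont δ hδ
  refine ⟨r, hr, fun σ hσ hσr => ?_⟩
  have h1 := h (x := σ) (by rw [Real.dist_eq, sub_zero, abs_of_pos hσ]; exact hσr)
  rw [Real.zero_rpow (by linarith), zero_pow (Nat.succ_ne_zero m), Real.dist_eq, sub_zero] at h1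
  have h2 : (σ ^ s) ^ (m + 1) * (σ ^ (m + 1))⁻¹ = (σ ^ (s - 1)) ^ (m + 1) := by
    rw [Real.rpow_sub hσ, Real.rpow_one, div_pow, div_eq_mul_inv]
  rw [h2]
  exact (le_abs_self _).trans h1.le

theorem stab_comm (u v : (Fin d → ℝ) → ℝ) : stab Ω σ P u v = stab Ω σ P v u := by
  unfold stab
  simp only [mul_comm]

theorem formAh_comm (I : ((Fin d → ℝ) → ℝ) →ₗ[ℝ] ℝ) (u v : (Fin d → ℝ) → ℝ) :
    formAh Ω σ P ε I u v = formAh Ω σ P ε I v u := by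
  unfold formAh
  rw [stab_comm]
  simp only [mul_comm]

theorem exists_cutCells_finset (hb : Bornology.IsBounded Ω) (hσ : 0 < σ) :
    ∃ B : Finset (Fin d → ℤ), ∀ i, i ∈ B ↔ i ∈ cutCells Ω σ := by
  have hfin : (cutCells Ω σ).Finite := (finite_activeCells hb hσ).subset fun i hi => hi.1
  exact ⟨hfin.toFinset, fun i => by simp⟩

theorem formAh_add_left (hb : Bornology.IsBounded Ω) (hσ : 0 < σ)
    (I : ((Fin d → ℝ) → ℝ) →ₗ[ℝ] ℝ) {u u' v : (Fin d → ℝ) → ℝ} (hu : ContDiff ℝ ∞ u)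
    (hu' : ContDiff ℝ ∞ u') (hv : ContDiff ℝ ∞ v) :
    formAh Ω σ P ε I (u + u') v = formAh Ω σ P ε I u v + formAh Ω σ P ε I u' v := by
  obtain ⟨B, hB⟩ := exists_cutCells_finset hb hσ
  have h1 : (fun x => (u + u') x * v x) = (fun x => u x * v x) + fun x => u' x * v x := by
    funext x; simp [add_mul]
  have h2 : stab Ω σ P (u + u') v = stab Ω σ P u v + stab Ω σ P u' v := by
    rw [stab_eq_sum hB, stab_eq_sum hB, stab_eq_sum hB, ← mul_add, ← Finset.sum_add_distrib]
    congr 1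
    refine Finset.sum_congr rfl fun i _ => ?_
    rw [← Finset.sum_add_distrib]
    refine Finset.sum_congr rfl fun α _ => ?_
    have hint : ∀ {w : (Fin d → ℝ) → ℝ}, ContDiff ℝ ∞ w →
        IntegrableOn (fun x => mderiv α w x * mderiv α v x) (cell σ i) := fun hw =>
      integrableOn_of_continuous_of_isBounded (isBounded_cell σ i)
        ((continuous_mderiv α hw).mul (continuous_mderiv α hv))
    rw [← integral_add (hint hu) (hint hu'), mderiv_add α hu hu']
    simp only [Pi.add_apply, add_mul]
  unfold formAh
  rw [h1, I.map_add, h2]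
  ring

theorem formAh_smul_left (hb : Bornology.IsBounded Ω) (hσ : 0 < σ)
    (I : ((Fin d → ℝ) → ℝ) →ₗ[ℝ] ℝ) (c : ℝ) {u : (Fin d → ℝ) → ℝ} (hu : ContDiff ℝ ∞ u)
    (v : (Fin d → ℝ) → ℝ) :
    formAh Ω σ P ε I (c • u) v = c * formAh Ω σ P ε I u v := by
  obtain ⟨B, hB⟩ := exists_cutCells_finset hb hσ
  have h1 : (fun x => (c • u) x * v x) = c • fun x => u x * v x := by
    funext x; simp [mul_assoc]
  have h2 : stab Ω σ P (c • u) v = c * stab Ω σ P u v := by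
    rw [stab_eq_sum hB, stab_eq_sum hB, mul_left_comm c]
    congr 1
    rw [Finset.mul_sum]
    refine Finset.sum_congr rfl fun i _ => ?_
    rw [Finset.mul_sum]
    refine Finset.sum_congr rfl fun α _ => ?_
    rw [← integral_const_mul, mderiv_smul α c hu]
    simp only [Pi.smul_apply, smul_eq_mul, mul_assoc]
  unfold formAh
  rw [h1, I.map_smul, h2, smul_eq_mul]
  ring

/-- A linear functional is represented by a bilinear form on a finite-dimensional space if it
vanishes on the right kernel of the form. -/
theorem exists_forall_eq_of_ker {V : Type*} [AddCommGroup V] [Module ℝ V]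
    [FiniteDimensional ℝ V] (b : V →ₗ[ℝ] V →ₗ[ℝ] ℝ) (ℓ : V →ₗ[ℝ] ℝ)
    (h : ∀ v, (∀ u, b u v = 0) → ℓ v = 0) : ∃ u, ∀ v, b u v = ℓ v := by
  have hmem : ℓ ∈ (LinearMap.ker b.flip).dualAnnihilator := by
    rw [Submodule.mem_dualAnnihilator]
    intro v hv
    refine h v fun u => ?_
    rw [← LinearMap.flip_apply, LinearMap.mem_ker.1 hv, LinearMap.zero_apply]
  rw [← LinearMap.range_dualMap_eq_dualAnnihilator_ker] at hmem
  obtain ⟨φ, hφ⟩ := hmem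
  refine ⟨(Module.evalEquiv ℝ V).symm φ, fun v => ?_⟩
  rw [← hφ, LinearMap.dualMap_apply, ← LinearMap.flip_apply]
  exact Module.apply_evalEquiv_symm_apply ℝ V (b.flip v) φ

/-- Existence of a discrete solution. -/
theorem exists_solves (hΩ : IsOpen Ω) (hb : Bornology.IsBounded Ω) (hσ : 0 < σ)
    (I : ((Fin d → ℝ) → ℝ) →ₗ[ℝ] ℝ) (uh : SobolevDual (m + 1) Ω) {N : ((Fin d → ℝ) → ℝ) → ℝ}
    {c t : ℝ} (hc : 0 < c)
    (hco : ∀ v ∈ pufem Ω σ P, c * N v ^ 2 ≤ formAh Ω σ P ε I v v)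
    (ht : ∀ v ∈ pufem Ω σ P, ‖sobolevOf (m + 1) 2 Ω v‖ ≤ t * N v) :
    ∃ uσ, Solves Ω σ P m ε I uh uσ := by
  have hfd : FiniteDimensional ℝ (pufem Ω σ P) := finiteDimensional_pufem hb hσ
  have hs : ∀ v : pufem Ω σ P, ContDiff ℝ ∞ v.1 := fun v =>
    contDiff_of_mem_pufemAll hσ (pufem_le_pufemAll Ω σ v.2)
  let b : pufem Ω σ P →ₗ[ℝ] pufem Ω σ P →ₗ[ℝ] ℝ :=
    LinearMap.mk₂ ℝ (fun u v => formAh Ω σ P ε I u.1 v.1)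
      (fun u u' v => formAh_add_left hb hσ I (hs u) (hs u') (hs v))
      (fun a u v => formAh_smul_left hb hσ I a (hs u) v.1)
      (fun u v v' => by
        rw [formAh_comm, formAh_comm I u.1 v.1, formAh_comm I u.1 v'.1]
        exact formAh_add_left hb hσ I (hs v) (hs v') (hs u))
      (fun a u v => by
        rw [formAh_comm, formAh_comm I u.1 v.1]
        exact formAh_smul_left hb hσ I a (hs v) u.1)
  let ℓ : pufem Ω σ P →ₗ[ℝ] ℝ :=
    { toFun := fun v => uh (sobolevOf (m + 1) 2 Ω v.1)
      map_add' := fun v w => by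
        rw [Submodule.coe_add, sobolevOf_add (m + 1) hΩ hb (hs v) (hs w), map_add]
      map_smul' := fun a v => by
        rw [Submodule.coe_smul, sobolevOf_smul (m + 1) hΩ hb a (hs v), map_smul]
        rfl }
  -- Elements are functions on all of ℝ^d, so the form is not assumed nondegenerate. By coercivity a
  -- function in its kernel has N v = 0, hence zero Sobolev norm on Ω, and the data do not see it.
  obtain ⟨u, hu⟩ := exists_forall_eq_of_ker b ℓ fun v hv => by
    have h1 : formAh Ω σ P ε I v.1 v.1 = 0 := hv v
    have h2 := hco v.1 v.2
    have h3 : N v.1 = 0 := by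
      have : N v.1 ^ 2 ≤ 0 := by nlinarith [sq_nonneg (N v.1)]
      exact pow_eq_zero_iff two_ne_zero |>.1 (le_antisymm this (sq_nonneg _))
    have h4 := ht v.1 v.2
    rw [h3, mul_zero] at h4
    show uh (sobolevOf (m + 1) 2 Ω v.1) = 0
    rw [norm_le_zero_iff.1 h4, map_zero]
  exact ⟨u.1, u.2, fun v hv => hu ⟨v, hv⟩⟩

/-- A continuous function with zero norm vanishes on the open active cells, then on their closures,
which cover the fictitious domain. -/
theorem eqOn_fictitious_of_cellNorm_eq_zero (hA : ∀ i, i ∈ A ↔ i ∈ activeCells Ω σ)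
    {v : (Fin d → ℝ) → ℝ} (hv : Continuous v) (h : cellNorm σ A v = 0) :
    EqOn v 0 (fictitious Ω σ) := by
  have h0 := cellNorm_sq σ A v
  rw [h, zero_pow two_ne_zero, eq_comm,
    Finset.sum_eq_zero_iff_of_nonneg fun _ _ => sq_nonneg _] at h0
  intro x hx
  obtain ⟨i, hi, hxi⟩ := mem_iUnion₂.1 (interior_subset hx)
  have h1 := eqOn_zero_of_l2norm_eq_zero (isOpen_cell σ i) (isBounded_cell σ i) hv
    (pow_eq_zero_iff two_ne_zero |>.1 (h0 i ((hA i).2 hi)))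
  exact h1.closure hv continuous_const hxi

/-- Uniqueness of the discrete solution. -/
theorem Solves.eqOn (hb : Bornology.IsBounded Ω) (hσ : 0 < σ)
    (hA : ∀ i, i ∈ A ↔ i ∈ activeCells Ω σ) {I : ((Fin d → ℝ) → ℝ) →ₗ[ℝ] ℝ}
    {uh : SobolevDual (m + 1) Ω} {c : ℝ} (hc : 0 < c)
    (hco : ∀ v ∈ pufem Ω σ P, c * cellNorm σ A v ^ 2 ≤ formAh Ω σ P ε I v v)
    {u w : (Fin d → ℝ) → ℝ} (hu : Solves Ω σ P m ε I uh u) (hw : Solves Ω σ P m ε I uh w) :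
    EqOn w u (fictitious Ω σ) := by
  have hs : ∀ v ∈ pufem Ω σ P, ContDiff ℝ ∞ v := fun v hv =>
    contDiff_of_mem_pufemAll hσ (pufem_le_pufemAll Ω σ hv)
  have he : w + (-1 : ℝ) • u ∈ pufem Ω σ P :=
    Submodule.add_mem _ hw.1 (Submodule.smul_mem _ _ hu.1)
  have h1 : formAh Ω σ P ε I (w + (-1 : ℝ) • u) (w + (-1 : ℝ) • u) = 0 := by
    rw [formAh_add_left hb hσ I (hs _ hw.1) (hs _ (Submodule.smul_mem _ _ hu.1)) (hs _ he),
      formAh_smul_left hb hσ I _ (hs _ hu.1), hw.2 _ he, hu.2 _ he]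
    ring
  have h2 := hco _ he
  have h3 : cellNorm σ A (w + (-1 : ℝ) • u) = 0 := by
    have : cellNorm σ A (w + (-1 : ℝ) • u) ^ 2 ≤ 0 := by
      nlinarith [sq_nonneg (cellNorm σ A (w + (-1 : ℝ) • u))]
    exact pow_eq_zero_iff two_ne_zero |>.1 (le_antisymm this (sq_nonneg _))
  intro x hx
  have h4 := eqOn_fictitious_of_cellNorm_eq_zero hA (hs _ he).continuous h3 hx
  simp only [Pi.add_apply, Pi.smul_apply, smul_eq_mul, Pi.zero_apply] at h4
  linarith

/-- The abstract error estimate. -/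
theorem Solves.l2norm_sub_le (hb : Bornology.IsBounded Ω) (hσ : 0 < σ)
    (hε : 0 ≤ ε) (hA : activeCells Ω σ ⊆ A) {B : Finset (Fin d → ℤ)}
    (hB : ∀ i, i ∈ B ↔ i ∈ cutCells Ω σ) {I : ((Fin d → ℝ) → ℝ) →ₗ[ℝ] ℝ}
    {uh : SobolevDual (m + 1) Ω} {c t q r : ℝ} (hc : 0 < c) (hq : 0 ≤ q)
    (ht0 : 0 ≤ t) (hr0 : 0 ≤ r)
    (hco : ∀ v ∈ pufem Ω σ P, c * cellNorm σ A v ^ 2 ≤ formAh Ω σ P ε I v v)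
    (hqu : ∀ v ∈ pufem Ω σ P, ∀ w ∈ pufem Ω σ P,
      |(∫ x in Ω, v x * w x) - I (fun x => v x * w x)| ≤ q * (cellNorm σ A v * cellNorm σ A w))
    (ht : ∀ v ∈ pufem Ω σ P, ‖sobolevOf (m + 1) 2 Ω v‖ ≤ t * cellNorm σ A v)
    (hr : ∀ v ∈ pufem Ω σ P, √(∑ i ∈ B, cellEnergy σ P i v) ≤ r * cellNorm σ A v)
    {u : LpOn 2 Ω} {p a b W : ℝ} (hp : ‖uh - l2Dual (m + 1) u‖ ≤ p) {w : (Fin d → ℝ) → ℝ}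
    (hw : w ∈ pufem Ω σ P) (hW : cellNorm σ A w ≤ W)
    (ha : l2norm Ω (fun x => u x - w x) ≤ a) (hbE : √(∑ i ∈ B, cellEnergy σ P i w) ≤ b)
    {uσ : (Fin d → ℝ) → ℝ} (hu : Solves Ω σ P m ε I uh uσ) :
    l2norm Ω (fun x => u x - uσ x) ≤ a + (q * W + a + p * t + ε * b * r) / c := by
  have hs : ∀ v ∈ pufem Ω σ P, ContDiff ℝ ∞ v := fun v hv =>
    contDiff_of_mem_pufemAll hσ (pufem_le_pufemAll Ω σ hv)
  have hum := Lp.memLp u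
  have hmem : ∀ {v : (Fin d → ℝ) → ℝ}, v ∈ pufem Ω σ P → MemLp v 2 (volume.restrict Ω) :=
    fun hv => memLp_of_continuous_of_isBounded hb (hs _ hv).continuous 2
  set e := w + (-1 : ℝ) • uσ with he_def
  have he : e ∈ pufem Ω σ P := Submodule.add_mem _ hw (Submodule.smul_mem _ _ hu.1)
  have hes := hs e he
  set N := cellNorm σ A e with hN
  have hN0 : 0 ≤ N := cellNorm_nonneg _ _ _
  have hwm : MemLp (fun x => u x - w x) 2 (volume.restrict Ω) := hum.sub (hmem hw)
  have heN : l2norm Ω e ≤ N := l2norm_le_cellNorm hσ hb hA hes.continuous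
  have hform : formAh Ω σ P ε I e e =
      I (fun x => w x * e x) + ε * stab Ω σ P w e - uh (sobolevOf (m + 1) 2 Ω e) := by
    rw [← hu.2 e he]
    conv_lhs => rw [he_def]
    rw [← he_def, formAh_add_left hb hσ I (hs _ hw) (hs _ (Submodule.smul_mem _ _ hu.1)) hes,
      formAh_smul_left hb hσ I _ (hs _ hu.1)]
    unfold formAh
    ring
  have hdual : l2Dual (m + 1) u (sobolevOf (m + 1) 2 Ω e) = ∫ x in Ω, u x * e x := by
    show inner ℝ u (toFn (sobolevOf (m + 1) 2 Ω e)) = _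
    rw [L2.inner_def]
    refine integral_congr_ae ?_
    filter_upwards [toFn_sobolevOf (p := 2) (m + 1) hb hes] with x hx
    rw [hx]
    simp [mul_comm]
  have h1 : |(∫ x in Ω, w x * e x) - I (fun x => w x * e x)| ≤ q * W * N :=
    (hqu w hw e he).trans (by
      rw [mul_assoc]
      gcongr)
  have h2 : |∫ x in Ω, (u x - w x) * e x| ≤ a * N :=
    (abs_setIntegral_mul_le hwm (hmem he)).trans
      (mul_le_mul ha heN (l2norm_nonneg _ _) ((l2norm_nonneg _ _).trans ha))
  have h2' : ∫ x in Ω, (u x - w x) * e x = (∫ x in Ω, u x * e x) - ∫ x in Ω, w x * e x := by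
    simp only [sub_mul]
    exact integral_sub (hum.integrable_mul (hmem he)) ((hmem hw).integrable_mul (hmem he))
  have h3 : |(uh - l2Dual (m + 1) u) (sobolevOf (m + 1) 2 Ω e)| ≤ p * (t * N) :=
    ((uh - l2Dual (m + 1) u).le_opNorm _).trans
      (mul_le_mul hp (ht e he) (norm_nonneg _) ((ContinuousLinearMap.opNorm_nonneg (uh - l2Dual (m + 1) u)).trans hp))
  rw [sub_apply, hdual] at h3
  have h4 : |stab Ω σ P w e| ≤ b * (r * N) :=
    (abs_stab_le hB (hs _ hw) hes).trans
      (mul_le_mul hbE (hr e he) (Real.sqrt_nonneg _) ((Real.sqrt_nonneg _).trans hbE))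
  -- Adding and subtracting the exact integrals of u e and w e splits A_h(e, e) into quadrature
  -- error, approximation error, data error and stabilisation of w, each bounded by a multiple of N.
  have h5 : c * N ^ 2 ≤ (q * W + a + p * t + ε * b * r) * N := by
    refine (hco e he).trans ?_
    rw [hform]
    have h4' := mul_le_mul_of_nonneg_left ((le_abs_self _).trans h4) hε
    rw [h2'] at h2
    have h1' := (neg_le_abs _).trans h1
    have h2'' := (neg_le_abs _).trans h2
    have h3' := (neg_le_abs _).trans h3
    linarith
  have h6 : N ≤ (q * W + a + p * t + ε * b * r) / c := by
    rw [le_div_iff₀ hc]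
    -- A factor N is to be cancelled; for N = 0 the bound holds because all quantities on the right
    -- are nonnegative.
    rcases hN0.eq_or_lt with h0 | h0
    · rw [← h0, zero_mul]
      have hW0 : 0 ≤ W := (cellNorm_nonneg _ _ _).trans hW
      have ha0 : 0 ≤ a := (l2norm_nonneg _ _).trans ha
      have hp0 : 0 ≤ p := (ContinuousLinearMap.opNorm_nonneg (uh - l2Dual (m + 1) u)).trans hp
      have hb0 : 0 ≤ b := (Real.sqrt_nonneg _).trans hbE
      positivity
    · nlinarith
  have h7 : (fun x => u x - uσ x) = (fun x => u x - w x) + e := by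
    funext x
    simp only [he_def, Pi.add_apply, Pi.smul_apply, smul_eq_mul]
    ring
  rw [h7]
  exact (l2norm_add_le hwm (hmem he)).trans (add_le_add ha (heN.trans h6))

end Discrete

/-! ### Approximation of Sobolev functions -/

section Approximation

variable {d : ℕ}

theorem l2norm_univ_le_of_eLpNorm_le {f : (Fin d → ℝ) → ℝ} {M : ℝ} (hM : 0 ≤ M)
    (h : eLpNorm f 2 volume ≤ ENNReal.ofReal M) : l2norm univ f ≤ M := by
  unfold l2norm
  rw [Measure.restrict_univ]
  exact ENNReal.toReal_le_of_le_ofReal hM h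

theorem memLp_of_eLpNorm_le {f : (Fin d → ℝ) → ℝ} (hf : Continuous f) {M : ℝ}
    (h : eLpNorm f 2 volume ≤ ENNReal.ofReal M) : MemLp f 2 volume :=
  ⟨hf.aestronglyMeasurable, h.trans_lt ENNReal.ofReal_lt_top⟩

/-- Mollification followed by quasi-interpolation. Besides the approximation error, the abstract
estimate needs the stability bound on `cellNorm` (for the quadrature error) and the energy bound
(for the stabilisation error). -/
theorem exists_pufem_approx (d P k : ℕ) (hPk : P ≤ k) : ∃ C : ℝ, 0 < C ∧
    ∀ Ω : Set (Fin d → ℝ), IsOpen Ω → Bornology.IsBounded Ω → ∀ σ : ℝ, 0 < σ → σ ≤ 1 →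
    ∀ A : Finset (Fin d → ℤ), (∀ i, i ∈ A ↔ i ∈ activeCells Ω σ) →
    ∀ (w : Sobolev (k + 1) 2 (univ : Set (Fin d → ℝ))) (U : ℝ), 0 < U → ‖w‖ ≤ U →
    ∃ v ∈ pufem Ω σ P, cellNorm σ A v ≤ C * U ∧
      l2norm Ω (fun x => toFn w x - v x) ≤ C * σ ^ (P + 1) * U ∧
      √(∑ i ∈ A, cellEnergy σ P i v) ≤ C * σ ^ (P + 1) * U := by
  obtain ⟨C, hC, hq⟩ := exists_quasiInterpolant d P
  set M : ℝ := ((multiIdxEq d (P + 1)).card : ℝ) with hM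
  have hM0 : 0 ≤ M := Nat.cast_nonneg _
  refine ⟨1 + C * (M + 1), by positivity, fun Ω hΩ hb σ hσ hσ1 A hA w U hU hwU => ?_⟩
  -- The mollification tolerance equals the target order. It must be positive, which is why a bound
  -- U > 0 stands in for the norm of w.
  obtain ⟨g, hg, hgw, hgd⟩ := exists_smooth_approx w (η := σ ^ (P + 1) * U) (by positivity)
  have hgd' : ∀ α ∈ multiIdxLE d (k + 1), eLpNorm (mderiv α g) 2 volume ≤ ENNReal.ofReal U :=
    fun α hα => (hgd ⟨α, hα⟩).trans
      (ENNReal.ofReal_le_ofReal ((norm_sobolev_coe_le w ⟨α, hα⟩).trans hwU))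
  have hsub : ∀ α ∈ multiIdxEq d (P + 1), α ∈ multiIdxLE d (k + 1) := fun α hα =>
    multiIdxLE_mono (Nat.succ_le_succ hPk) (multiIdxEq_subset_LE hα)
  have hgm : ∀ α ∈ multiIdxLE d (k + 1), MemLp (mderiv α g) 2 volume := fun α hα =>
    memLp_of_eLpNorm_le (continuous_mderiv α hg) (hgd' α hα)
  have hS : ∑ α ∈ multiIdxEq d (P + 1), ∫ x, mderiv α g x ^ 2 ≤ ((M + 1) * U) ^ 2 := by
    have h1 : ∀ α ∈ multiIdxEq d (P + 1), ∫ x, mderiv α g x ^ 2 ≤ U ^ 2 := fun α hα => by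
      have hm : MemLp (mderiv α g) 2 (volume.restrict univ) := by
        rw [Measure.restrict_univ]; exact hgm α (hsub α hα)
      have h2 := l2norm_sq hm
      rw [Measure.restrict_univ] at h2
      rw [← h2]
      exact pow_le_pow_left₀ (l2norm_nonneg _ _)
        (l2norm_univ_le_of_eLpNorm_le hU.le (hgd' α (hsub α hα))) 2
    refine (Finset.sum_le_card_nsmul _ _ _ h1).trans ?_
    rw [nsmul_eq_mul, mul_pow]
    exact mul_le_mul_of_nonneg_right (by nlinarith) (sq_nonneg _)
  obtain ⟨v, hv, hv1, hv2⟩ := hq Ω σ hσ A hA g hg (fun α hα => hgm α (hsub α hα))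
    ((M + 1) * U) (by positivity) hS
  have hvs := contDiff_of_mem_pufemAll hσ (pufem_le_pufemAll Ω σ hv)
  have hAs : activeCells Ω σ ⊆ A := fun i hi => (hA i).2 hi
  have hgv : Continuous (g - v) := hg.continuous.sub hvs.continuous
  have hpow : σ ^ (P + 1) ≤ 1 := pow_le_one₀ hσ.le hσ1
  refine ⟨v, hv, ?_, ?_, hv2.trans ?_⟩
  · have h1 : v = g + (-1 : ℝ) • (g - v) := by
      rw [neg_one_smul]; abel
    have hg0 := hgd' 0 (zero_mem_multiIdxLE d (k + 1))
    have hgm0 := hgm 0 (zero_mem_multiIdxLE d (k + 1))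
    rw [mderiv_zero] at hg0 hgm0
    calc cellNorm σ A v = cellNorm σ A (g + (-1 : ℝ) • (g - v)) := by rw [← h1]
      _ ≤ cellNorm σ A g + cellNorm σ A ((-1 : ℝ) • (g - v)) :=
          cellNorm_add_le hg.continuous (hgv.const_smul _)
      _ ≤ U + C * σ ^ (P + 1) * ((M + 1) * U) := by
          rw [cellNorm_smul]
          refine add_le_add ((cellNorm_le_l2norm_univ hσ hg.continuous hgm0).trans
            (l2norm_univ_le_of_eLpNorm_le hU.le hg0)) ?_
          rwa [abs_neg, abs_one, one_mul]
      _ ≤ U + C * 1 * ((M + 1) * U) := add_le_add le_rfl (mul_le_mul_of_nonneg_right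
          (mul_le_mul_of_nonneg_left hpow hC.le) (mul_nonneg (add_nonneg hM0 zero_le_one) hU.le))
      _ = _ := by ring
  · have hwm : MemLp (⇑(toFn w)) 2 (volume.restrict Ω) :=
      (Lp.memLp (toFn w)).mono_measure (Measure.restrict_mono_set _ (subset_univ Ω))
    have hgmΩ := memLp_of_continuous_of_isBounded hb hg.continuous 2
    have hm1 : MemLp (g - ⇑(toFn w)) 2 (volume.restrict Ω) := hgmΩ.sub hwm
    have hm2 : MemLp (g - v) 2 (volume.restrict Ω) :=
      memLp_of_continuous_of_isBounded hb hgv 2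
    have h1 : (fun x => toFn w x - v x) = (-1 : ℝ) • (g - ⇑(toFn w)) + (g - v) := by
      funext x
      simp only [Pi.add_apply, Pi.smul_apply, Pi.sub_apply, smul_eq_mul]
      ring
    have h2 : l2norm Ω (g - ⇑(toFn w)) ≤ σ ^ (P + 1) * U := by
      unfold l2norm
      exact ENNReal.toReal_le_of_le_ofReal (by positivity)
        ((eLpNorm_mono_measure _ Measure.restrict_le_self).trans hgw)
    rw [h1]
    refine (l2norm_add_le (hm1.const_smul _) hm2).trans ?_
    rw [l2norm_smul]
    have h3 := (l2norm_le_cellNorm hσ hb hAs hgv).trans hv1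
    simp only [abs_neg, abs_one, one_mul]
    calc _ ≤ σ ^ (P + 1) * U + C * σ ^ (P + 1) * ((M + 1) * U) := add_le_add h2 h3
      _ = _ := by ring
  · have : 0 ≤ σ ^ (P + 1) * U := by positivity
    nlinarith

end Approximation

end SmoothPUFEM

end

/-! ### Assembly of the error estimate -/

open SmoothPUFEM

theorem mainTheorem1 (d P m K : ℕ) (hd : 0 < d) (s ε : ℝ) (hs : 1 < s) (hε : 0 < ε)
    (CE : ℕ → ℝ) (CQ CP : ℝ) :
    ∃ C σ₀ : ℝ, 0 < C ∧ 0 < σ₀ ∧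
      ∀ Ω : Set (Fin d → ℝ), IsOpen Ω → Bornology.IsBounded Ω → HasExtension Ω CE →
      ∀ σ h : ℝ, 0 < σ → σ < σ₀ → h = σ ^ s → CutCellsReach Ω σ K →
      ∀ I : ((Fin d → ℝ) → ℝ) →ₗ[ℝ] ℝ, QuadratureBound Ω m h CQ I →
      ∀ (u : Sobolev (max P m + 1) 2 Ω) (uh : SobolevDual (m + 1) Ω),
        ‖uh - l2Dual (m + 1) (toFn u)‖ ≤
          CP * h ^ (m + 1) * ‖lower (Nat.succ_le_succ (le_max_right P m)) u‖ →
        (∃ uσ, Solves Ω σ P m ε I uh uσ ∧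
          ∀ w, Solves Ω σ P m ε I uh w → EqOn w uσ (fictitious Ω σ)) ∧
        ∀ uσ, Solves Ω σ P m ε I uh uσ →
          eLpNorm (fun x => toFn u x - uσ x) 2 (volume.restrict Ω) ≤
            ENNReal.ofReal
              (C * (σ ^ (P + 1) + h ^ (m + 1) * (σ ^ (m + 1))⁻¹) * ‖u‖) := by
  obtain ⟨c, δ, hc, hδ, hco⟩ := exists_coercive d P m K hε CQ
  obtain ⟨q, hq, hqu⟩ := exists_quadrature_error_le d P m
  obtain ⟨t, ht, hsob⟩ := exists_norm_sobolevOf_le d P (m + 1)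
  obtain ⟨r, hr, hen⟩ := exists_sqrt_cellEnergy_le d P
  obtain ⟨C₀, hC₀, happ⟩ := exists_pufem_approx d P (max P m) (le_max_left P m)
  obtain ⟨σ₁, hσ₁, hsmall⟩ := exists_rpow_small m hs hδ
  set D := |CE (max P m + 1)| + 1 with hD
  have hD0 : 0 < D := by positivity
  -- Approximation error, plus quadrature, approximation, data and stabilisation errors divided by
  -- the coercivity constant. Below min 1 σ₁ both the inverse estimates and the absorption of the
  -- quadrature error are available.
  refine ⟨C₀ * D + (|CQ| * q * C₀ * D + C₀ * D + |CP| * t + ε * C₀ * D * r) / c, min 1 σ₁,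
    by positivity, lt_min one_pos hσ₁,
    fun Ω hΩ hb hE σ h hσ hσ₀ hh hK I hI u uh huh => ?_⟩
  have hσ1 : σ ≤ 1 := (hσ₀.trans_le (min_le_left _ _)).le
  have hh0 : 0 ≤ h := hh ▸ Real.rpow_nonneg hσ.le s
  have hhδ : h ^ (m + 1) * (σ ^ (m + 1))⁻¹ ≤ δ :=
    hh ▸ hsmall σ hσ (hσ₀.trans_le (min_le_right _ _))
  set ρ := h ^ (m + 1) * (σ ^ (m + 1))⁻¹ with hρ
  have hρ0 : 0 ≤ ρ := by positivity
  have hfin := finite_activeCells hb hσ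
  set A := hfin.toFinset
  have hA : ∀ i, i ∈ A ↔ i ∈ activeCells Ω σ := fun i => hfin.mem_toFinset
  have hAs : activeCells Ω σ ⊆ A := fun i hi => (hA i).2 hi
  obtain ⟨B, hB⟩ := exists_cutCells_finset hb hσ
  have hBA : B ⊆ A := fun i hi => (hA i).2 ((hB i).1 hi).1
  have hle := pufem_le_pufemAll (P := P) Ω σ
  have hco' : ∀ v ∈ pufem Ω σ P, c * cellNorm σ A v ^ 2 ≤ formAh Ω σ P ε I v v := fun v hv =>
    hco Ω hΩ hb σ h hσ hh0 hhδ hK A hA I hI v (hle hv)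
  have hsob' : ∀ v ∈ pufem Ω σ P, ‖sobolevOf (m + 1) 2 Ω v‖ ≤
      t * (σ ^ (m + 1))⁻¹ * cellNorm σ A v := fun v hv =>
    hsob Ω hΩ hb σ hσ hσ1 A hAs v (hle hv)
  refine ⟨?_, fun uσ huσ => ?_⟩
  · obtain ⟨uσ, huσ⟩ := exists_solves hΩ hb hσ I uh hc hco' hsob'
    exact ⟨uσ, huσ, fun w hw => huσ.eqOn hb hσ hA hc hco' hw⟩
  obtain ⟨E, hEu, hEn⟩ := hE (max P m + 1)
  -- A positive bound U replaces ‖u‖, so that u = 0 needs no separate treatment in the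
  -- mollification.
  have hbound : ∀ U : ℝ, 0 < U → ‖u‖ ≤ U → l2norm Ω (fun x => toFn u x - uσ x) ≤
      (C₀ * D + (|CQ| * q * C₀ * D + C₀ * D + |CP| * t + ε * C₀ * D * r) / c) *
        (σ ^ (P + 1) + ρ) * U := fun U hU huU => by
    have hEU : ‖E u‖ ≤ D * U := (E.le_opNorm u).trans
      (mul_le_mul (hEn.trans ((le_abs_self _).trans (by linarith))) huU (norm_nonneg _) hD0.le)
    obtain ⟨w, hw, hwN, hwu, hwE⟩ := happ Ω hΩ hb σ hσ hσ1 A hA (E u) (D * U) (by positivity) hEU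
    have hwu' : l2norm Ω (fun x => toFn u x - w x) ≤ C₀ * σ ^ (P + 1) * (D * U) := by
      refine le_trans (le_of_eq ?_) hwu
      unfold l2norm
      congr 1
      refine eLpNorm_congr_ae ?_
      filter_upwards [hEu u] with x hx
      rw [hx]
    have hp : ‖uh - l2Dual (m + 1) (toFn u)‖ ≤ |CP| * h ^ (m + 1) * U := huh.trans (by
      gcongr
      · exact le_abs_self _
      · exact (norm_lower_le _ u).trans huU)
    have hwE' : √(∑ i ∈ B, cellEnergy σ P i w) ≤ C₀ * σ ^ (P + 1) * (D * U) :=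
      (Real.sqrt_le_sqrt (Finset.sum_le_sum_of_subset_of_nonneg hBA
        fun i _ _ => cellEnergy_nonneg _ _ _ _)).trans hwE
    have h1 := huσ.l2norm_sub_le hb hσ hε.le hAs hB hc (q := |CQ| * q * ρ)
      (t := t * (σ ^ (m + 1))⁻¹) (r := r) (by positivity) (by positivity) hr.le hco'
      (fun v hv w hw => hqu Ω hΩ hb σ h CQ hσ hh0 A hAs I hI v (hle hv) w (hle hw)) hsob'
      (fun v hv => hen σ hσ A B hBA v (hle hv)) hp hw hwN hwu' hwE'
    refine h1.trans ?_
    have hs0 : 0 ≤ σ ^ (P + 1) := by positivity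
    set S := σ ^ (P + 1)
    have h2 : |CQ| * q * ρ * (C₀ * (D * U)) + C₀ * S * (D * U) +
        |CP| * h ^ (m + 1) * U * (t * (σ ^ (m + 1))⁻¹) + ε * (C₀ * S * (D * U)) * r ≤
        (|CQ| * q * C₀ * D + C₀ * D + |CP| * t + ε * C₀ * D * r) * (S + ρ) * U := by
      -- Data accuracy h^(m+1) times the inverse-estimate loss σ^(-(m+1)) is exactly ρ.
      have e1 : |CP| * h ^ (m + 1) * U * (t * (σ ^ (m + 1))⁻¹) = |CP| * t * ρ * U := by
        rw [hρ]; ring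
      have p1 : 0 ≤ |CQ| * q * C₀ * D * S * U := by positivity
      have p2 : 0 ≤ C₀ * D * ρ * U := by positivity
      have p3 : 0 ≤ |CP| * t * S * U := by positivity
      have p4 : 0 ≤ ε * C₀ * D * r * ρ * U := by positivity
      rw [e1]
      linarith
    have h3 : C₀ * S * (D * U) ≤ C₀ * D * (S + ρ) * U := by
      have : 0 ≤ C₀ * D * ρ * U := by positivity
      linarith
    calc _ ≤ C₀ * D * (S + ρ) * U +
          (|CQ| * q * C₀ * D + C₀ * D + |CP| * t + ε * C₀ * D * r) * (S + ρ) * U / c := by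
          gcongr
      _ = _ := by ring
  have huσs := contDiff_of_mem_pufemAll hσ (hle huσ.1)
  have hmem : MemLp (fun x => toFn u x - uσ x) 2 (volume.restrict Ω) :=
    (Lp.memLp _).sub (memLp_of_continuous_of_isBounded hb huσs.continuous 2)
  rw [ofReal_l2norm hmem]
  refine ENNReal.ofReal_le_ofReal ?_
  set C₁ := (C₀ * D + (|CQ| * q * C₀ * D + C₀ * D + |CP| * t + ε * C₀ * D * r) / c) *
    (σ ^ (P + 1) + ρ) with hC₁
  -- Letting U decrease to ‖u‖ recovers the norm itself, also when it is zero.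
  have hlim : Filter.Tendsto (fun U : ℝ => C₁ * U) (nhdsWithin ‖u‖ (Ioi ‖u‖))
      (nhds (C₁ * ‖u‖)) :=
    ((continuous_const.mul continuous_id).tendsto ‖u‖).mono_left nhdsWithin_le_nhds
  refine ge_of_tendsto hlim ?_
  filter_upwards [self_mem_nhdsWithin] with U hU
  exact hbound U ((norm_nonneg u).trans_lt hU) (le_of_lt hU)
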